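/- **Setting.** Let $d\in\{1,2\}$, $N\in\mathbb N$ with $N\ge 1$, $\varepsilon=1/N$, $\mathcal L^\#=\varepsilon\mathbb Z^d$, $\mathcal L=\varepsilon\{-N+1,\dots,N\}^d$, $\Omega=(-1,1]^d$, and write $A^\#=\bigcup_{\xi\in2\mathbb Z^d}(\xi+A)$. Let $\mathcal T_\varepsilon^\#$ be the $\varepsilon\mathbb Z^d$-periodic triangulation of $\mathbb R^d$ with vertex set $\mathcal L^\#$ obtained from the cell $\varepsilon[0,1]^d$ (for $d=1$) or from its splitting into two triangles along one of its diagonals (for $d=2$), and let $\mathcal T_\varepsilon$ be the set of its elements contained in $\bar\Omega$. Lattice functions are identified with their continuous piecewise affine interpolants on $\mathcal T_\varepsilon^\#$. Let $\mathscr U$ be the space of such functions with values in $\mathbb R^d$ that are $2\mathbb Z^d$-periodic, and $\mathscr Y$ the space of those $y$ with $y(x)-\mathsf Ax$ being $2\mathbb Z^d$-periodic for some $\mathsf A\in\mathbb R^{d\times d}$. Let $\mathcal T_h$ be a triangulation of $\bar\Omega$ with vertices in $\mathcal L^\#$ whose $2\mathbb Z^d$-periodic extension $\mathcal T_h^\#$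 is a conforming triangulation of $\mathbb R^d$. Let $\mathcal T_h$ be the disjoint union of $\mathcal T_h^{\rm c},\mathcal T_h^{\rm i},\mathcal T_h^{\rm a}$, with regions $\Omega_{\rm c}=\bigcup\mathcal T_h^{\rm c}$, $\Omega_{\rm i}=\bigcup\mathcal T_h^{\rm i}$, $\Omega_{\rm a}=\bigcup\mathcal T_h^{\rm a}$. Let $\mathscr U_h$ be the space of continuous, $2\mathbb Z^d$-periodic $\mathbb R^d$-valued functions that are affine on every element of $\mathcal T_h^\#$. Put $\mathcal T_\varepsilon^{\rm c}=\{T\in\mathcal T_\varepsilon: T\subset\Omega_{\rm c}\}$. Let $\mathscr R\subset\mathbb Z^d\setminus\{0\}$ be finite, $D_rv(x)=\varepsilon^{-1}(v(x+\varepsilon r)-v(x))$, $D_{\mathscr R}v=(D_rv)_{r\in\mathscr R}$. Let $V\in C^2((\mathbb R^d)^{\mathscr R})$ and let $M^{\rm a}_{r,s}\ge0$ satisfy $\sup_{\mathbf g}\|\partial_{r,s}V(\mathbf g)\|\le M^{\rm a}_{r,s}$ ($\ell^2$-operator norm) for all $r,s\in\mathscr R$; put $M^{\rm a}=\sum_{r,s\in\mathscr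 R}|r||s|M^{\rm a}_{r,s}$ and $W(\mathsf F)=V((\mathsf Fr)_{r\in\mathscr R})$. For $x\in\mathcal L$ and $r\in\mathscr R$ the bond $(x,x+\varepsilon r)$ is the closed segment between its end points. Let $\mathcal L_{\rm a}$ be the set of $x\in\mathcal L$ such that $(x,x+\varepsilon r)\cap\Omega_{\rm a}^\#\ne\emptyset$ for some $r\in\mathscr R$, let $\mathscr B_{\rm i}$ be the set of bonds $(x,x+\varepsilon r)$, $x\in\mathcal L$, $r\in\mathscr R$, contained in $\Omega_{\rm i}^\#$, and let $E_{\rm i}\in C^2((\mathbb R^d)^{\mathscr B_{\rm i}})$. For $y\in\mathscr Y+\mathscr U_h$ define $$\mathcal E_{\rm a}(y)=\varepsilon^d\sum_{x\in\mathcal L}V(D_{\mathscr R}y(x)),$$ $$\mathcal E_{\rm ac}(y)=\int_{\Omega_{\rm c}}W(\nabla y)\,dx+\varepsilon^d\sum_{x\in\mathcal L_{\rm a}}V(D_{\mathscr R}y(x))+\varepsilon^dE_{\rm i}\big((D_ry(x))_{(x,x+\varepsilon r)\in\mathscr B_{\rm i}}\big),$$ and $\langle\delta\mathcal E(y),v\rangle=\frac{d}{dt}\mathcal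 E(y+tv)|_{t=0}$. For $q\in[1,\infty]$ let $\|\nabla v\|_{L^q(\Omega)}=\|\,|\nabla v|_q\,\|_{L^q(\Omega)}$, where $|\cdot|_q$ is the entrywise $\ell^q$-norm of a matrix. With $1/p+1/p'=1$ put $$\|\Phi\|_{W^{-1,p}_h}=\sup_{v\in\mathscr U_h,\ \|\nabla v\|_{L^{p'}(\Omega)}=1}\langle\Phi,v\rangle,\qquad \|\Phi\|_{W^{-1,p}_\varepsilon}=\sup_{v\in\mathscr U,\ \|\nabla v\|_{L^{p'}(\Omega)}=1}\langle\Phi,v\rangle$$ (a supremum over the empty set being $0$). For measurable $\omega\subset\mathbb R^d$ let ${\rm osc}(\nabla y;\omega)=\operatorname{ess\,sup}_{x,x'\in\omega}\varepsilon^{-1}|\nabla y(x)-\nabla y(x')|$ with the Frobenius norm, and for $T\in\mathcal T_\varepsilon$ let $\omega_T^{\rm c}=\Omega_{\rm c}^\#\cap\bigcup\{T'\in\mathcal T_\varepsilon^\#: T\cap T'\ne\emptyset\}$. **Theorem.** There is a universal constant $C_M>0$ (independent of all the data above) such that, whenever $\mathcal T_h^{\rm a}\cup\mathcal T_h^{\rm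 i}\subset\mathcal T_\varepsilon$, one has for all $y\in\mathscr Y$ and all $p\in[1,\infty)$ $$\|\delta\mathcal E_{\rm ac}(y)-\delta\mathcal E_{\rm a}(y)\|_{W^{-1,p}_h}\le M^{\rm a}C_M\,\varepsilon\Big(\sum_{T\in\mathcal T_\varepsilon^{\rm c}}|T|\,{\rm osc}(\nabla y;\omega_T^{\rm c})^p\Big)^{1/p}+\|\delta\mathcal E_{\rm ac}(y)-\delta\mathcal E_{\rm a}(y)\|_{W^{-1,p}_\varepsilon},$$ and, for $p=\infty$, the same inequality with $\big(\sum_{T}|T|\,{\rm osc}(\nabla y;\omega_T^{\rm c})^p\big)^{1/p}$ replaced by $\max_{T\in\mathcal T_\varepsilon^{\rm c}}{\rm osc}(\nabla y;\omega_T^{\rm c})$ (read as $0$ if $\mathcal T_\varepsilon^{\rm c}=\emptyset$). -/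

import Mathlib

open MeasureTheory Set
open scoped ENNReal

noncomputable section

namespace ACCoupling

/-! ### Lattice, reference cell, periodicity -/

/-- Euclidean space `ℝ^d`. -/
abbrev Vec (d : ℕ) : Type := EuclideanSpace ℝ (Fin d)

/-- The lattice spacing `ε = 1 / N`. -/
def eps (N : ℕ) : ℝ := 1 / (N : ℝ)

/-- An integer vector, seen in `ℝ^d`. -/
def intVec {d : ℕ} (r : Fin d → ℤ) : Vec d := WithLp.toLp 2 fun i => (r i : ℝ)

/-- The lattice point `ε z`, for `z ∈ ℤ^d`. -/
def latticePt {d : ℕ} (N : ℕ) (z : Fin d → ℤ) : Vec d := eps N • intVec z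

/-- Indices of the reference cell `ε {-N+1, …, N}^d`. -/
def refCell (d N : ℕ) : Finset (Fin d → ℤ) :=
  Fintype.piFinset fun _ => Finset.Icc (-(N : ℤ) + 1) (N : ℤ)

/-- The domain `Ω = (-1, 1]^d`. -/
def Omega (d : ℕ) : Set (Vec d) := {x | ∀ i, -1 < x i ∧ x i ≤ 1}

/-- Its closure `[-1, 1]^d`. -/
def OmegaBar (d : ℕ) : Set (Vec d) := {x | ∀ i, -1 ≤ x i ∧ x i ≤ 1}

/-- The translate `2 ξ + A`. -/
def shift {d : ℕ} (ξ : Fin d → ℤ) (A : Set (Vec d)) : Set (Vec d) :=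
  (fun x => (2 : ℝ) • intVec ξ + x) '' A

/-- The periodic extension `A^# = ⋃_{ξ ∈ 2 ℤ^d} (ξ + A)` of a set. -/
def perExt {d : ℕ} (A : Set (Vec d)) : Set (Vec d) := ⋃ ξ : Fin d → ℤ, shift ξ A

/-- `v` is `2 ℤ^d`-periodic. -/
def IsPeriodic {d : ℕ} (v : Vec d → Vec d) : Prop :=
  ∀ (ξ : Fin d → ℤ) (x : Vec d), v ((2 : ℝ) • intVec ξ + x) = v x

/-! ### Meshes

A coarse mesh is given by the set of the vertex sets of its elements; the elements themselves are
the (closed) convex hulls. -/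

/-- The (closed) elements of a mesh. -/
def elements {d : ℕ} (𝒯 : Set (Finset (Vec d))) : Set (Set (Vec d)) :=
  (fun s : Finset (Vec d) => convexHull ℝ (s : Set (Vec d))) '' 𝒯

/-- The union of the elements of a mesh. -/
def region {d : ℕ} (𝒯 : Set (Finset (Vec d))) : Set (Vec d) := ⋃₀ elements 𝒯

/-- The elements of the periodically extended mesh. -/
def extElements {d : ℕ} (𝒯 : Set (Finset (Vec d))) : Set (Set (Vec d)) :=
  {T | ∃ ξ : Fin d → ℤ, ∃ T₀ ∈ elements 𝒯, T = shift ξ T₀}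

/-- `𝒯` is a triangulation of `[-1, 1]^d` with vertices in the lattice `ε ℤ^d`, whose
`2 ℤ^d`-periodic extension is a regular (that is, conforming) triangulation of `ℝ^d`: two elements
of the extension meet at most in the common face spanned by their common vertices. -/
structure IsPeriodicTriangulation {d : ℕ} (N : ℕ) (𝒯 : Set (Finset (Vec d))) : Prop where
  vertices_mem : ∀ s ∈ 𝒯, ∀ x ∈ s, ∃ z : Fin d → ℤ, x = latticePt N z
  card_vertices : ∀ s ∈ 𝒯, s.card = d + 1
  affineIndependent : ∀ s ∈ 𝒯, AffineIndependent ℝ ((↑) : s → Vec d)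
  covers : region 𝒯 = OmegaBar d
  conforming : ∀ s ∈ 𝒯, ∀ t ∈ 𝒯, ∀ ξ : Fin d → ℤ,
    convexHull ℝ (s : Set (Vec d)) ∩ shift ξ (convexHull ℝ (t : Set (Vec d))) ⊆
      convexHull ℝ ((s : Set (Vec d)) ∩ shift ξ (t : Set (Vec d)))

/-- Reflection of the first unit-cell coordinate if `flip` is true. It selects which of the two
diagonals splits the unit square. -/
def cellCoord {d : ℕ} (flip : Bool) (t : Fin d → ℝ) (i : Fin d) : ℝ :=
  if flip = true ∧ i.val = 0 then 1 - t i else t i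

/-- An element of the atomistic mesh, in the cell `ε (z + [0, 1]^d)`, in terms of the cell
coordinates `t = x / ε - z`. For `d = 1` it is the whole cell. For `d = 2` the two permutations
give the triangles `t₀ ≥ t₁` and `t₁ ≥ t₀` if `flip = false`, and `t₀ + t₁ ≤ 1` and `t₀ + t₁ ≥ 1` if
`flip = true`. -/
def atomElement {d : ℕ} (N : ℕ) (flip : Bool) (z : Fin d → ℤ) (π : Equiv.Perm (Fin d)) :
    Set (Vec d) :=
  {x | (∀ i, 0 ≤ x i / eps N - z i ∧ x i / eps N - z i ≤ 1) ∧
    Antitone fun j => cellCoord flip (fun i => x i / eps N - z i) (π j)}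

/-- The atomistic mesh `𝒯_ε^#` of `ℝ^d`. -/
def atomMeshExt (d N : ℕ) (flip : Bool) : Set (Set (Vec d)) :=
  {T | ∃ (z : Fin d → ℤ) (π : Equiv.Perm (Fin d)), T = atomElement N flip z π}

/-- The atomistic mesh `𝒯_ε` of `[-1, 1]^d`. -/
def atomMesh (d N : ℕ) (flip : Bool) : Set (Set (Vec d)) :=
  {T | T ∈ atomMeshExt d N flip ∧ T ⊆ OmegaBar d}

/-- The atomistic elements `𝒯_ε^c` contained in the continuum region. -/
def atomMeshIn {d : ℕ} (N : ℕ) (flip : Bool) (Ωc : Set (Vec d)) : Set (Set (Vec d)) :=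
  {T | T ∈ atomMesh d N flip ∧ T ⊆ Ωc}

/-- The patch `ω_T^c`. -/
def patch {d : ℕ} (N : ℕ) (flip : Bool) (Ωc T : Set (Vec d)) : Set (Vec d) :=
  perExt Ωc ∩ ⋃₀ {T' | T' ∈ atomMeshExt d N flip ∧ (T ∩ T').Nonempty}

/-! ### Function spaces

Lattice functions are identified with their continuous piecewise affine interpolants, so that all
displacements and deformations are continuous functions on `ℝ^d`. -/

/-- Continuous functions that are affine on each element of a mesh. -/
def IsP1 {d : ℕ} (𝒯 : Set (Set (Vec d))) (v : Vec d → Vec d) : Prop :=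
  Continuous v ∧ ∀ T ∈ 𝒯, ∃ (L : Vec d →L[ℝ] Vec d) (b : Vec d), ∀ x ∈ T, v x = L x + b

/-- The periodic piecewise affine displacements. -/
def displacements {d : ℕ} (𝒯 : Set (Set (Vec d))) : Set (Vec d → Vec d) :=
  {u | IsP1 𝒯 u ∧ IsPeriodic u}

/-- The periodic piecewise affine deformations, `y(x) = A x + u(x)`. -/
def deformations {d : ℕ} (𝒯 : Set (Set (Vec d))) : Set (Vec d → Vec d) :=
  {y | IsP1 𝒯 y ∧ ∃ A : Vec d →L[ℝ] Vec d, IsPeriodic fun x => y x - A x}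

/-! ### Norms and oscillation -/

/-- The entrywise `ℓ^q`-norm of a `d × d` matrix (the Frobenius norm for `q = 2`). -/
def tensorNorm {d : ℕ} (q : ℝ≥0∞) (F : Vec d →L[ℝ] Vec d) : ℝ :=
  ‖(WithLp.toLp q (fun ij : Fin d × Fin d => F (EuclideanSpace.single ij.2 1) ij.1) :
    PiLp q fun _ : Fin d × Fin d => ℝ)‖

/-- `‖∇ v‖_{L^q(Ω)}`. -/
def gradNorm {d : ℕ} (q : ℝ≥0∞) (v : Vec d → Vec d) : ℝ≥0∞ :=
  eLpNorm (fun x => tensorNorm q (fderiv ℝ v x)) q (volume.restrict (Omega d))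

/-- The negative norm `sup {Φ(v) : v ∈ 𝒰, ‖∇ v‖_{L^{p'}(Ω)} = 1}`, with values in `[0, ∞]`. -/
def negNorm {d : ℕ} (p : ℝ≥0∞) (𝒰 : Set (Vec d → Vec d)) (Φ : (Vec d → Vec d) → ℝ) : ℝ≥0∞ :=
  ⨆ v ∈ 𝒰, ⨆ _ : gradNorm p.conjExponent v = 1, ENNReal.ofReal (Φ v)

/-- The oscillation `osc(∇y; ω)`. -/
def osc {d : ℕ} (N : ℕ) (y : Vec d → Vec d) (ω : Set (Vec d)) : ℝ≥0∞ :=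
  essSup (fun q : Vec d × Vec d =>
      ENNReal.ofReal (tensorNorm 2 (fderiv ℝ y q.1 - fderiv ℝ y q.2) / eps N))
    ((volume.restrict ω).prod (volume.restrict ω))

/-- `(∑_{T ∈ 𝒯_ε^c} |T| osc(∇y; ω_T^c)^p)^{1/p}` for `p < ∞`, and `max_{T ∈ 𝒯_ε^c} osc(∇y; ω_T^c)`
for `p = ∞`. -/
def oscSum {d : ℕ} (N : ℕ) (flip : Bool) (p : ℝ≥0∞) (Ωc : Set (Vec d)) (y : Vec d → Vec d) :
    ℝ≥0∞ :=
  if p = ∞ then ⨆ T ∈ atomMeshIn N flip Ωc, osc N y (patch N flip Ωc T)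
  else (∑' T : atomMeshIn N flip Ωc,
    volume (T : Set (Vec d)) * osc N y (patch N flip Ωc T) ^ p.toReal) ^ (1 / p.toReal)

/-! ### Energies -/

/-- The finite difference `(v(x + ε r) - v(x)) / ε` at `x = ε z`. -/
def finDiff {d : ℕ} (N : ℕ) (v : Vec d → Vec d) (z r : Fin d → ℤ) : Vec d :=
  (eps N)⁻¹ • (v (latticePt N (z + r)) - v (latticePt N z))

/-- The bond `(x, x + ε r)`, `x = ε z`, as a closed segment. -/
def bond {d : ℕ} (N : ℕ) (z r : Fin d → ℤ) : Set (Vec d) :=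
  segment ℝ (latticePt N z) (latticePt N (z + r))

/-- The second partial derivative `∂_{r,s} V(g)`, as a bilinear form. -/
def partial2 {d : ℕ} {R : Finset (Fin d → ℤ)} (V : (R → Vec d) → ℝ) (r s : R) (g : R → Vec d) :
    Vec d →L[ℝ] Vec d →L[ℝ] ℝ :=
  (fderiv ℝ (fun g' => (fderiv ℝ V g').comp
    (ContinuousLinearMap.single ℝ (fun _ : R => Vec d) s)) g).comp
      (ContinuousLinearMap.single ℝ (fun _ : R => Vec d) r)

/-- The constant `M^a = ∑_{r,s} |r| |s| M_{r,s}^a`. -/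
def boundConst {d : ℕ} {R : Finset (Fin d → ℤ)} (M : R → R → ℝ) : ℝ :=
  ∑ r : R, ∑ s : R, ‖intVec (r : Fin d → ℤ)‖ * ‖intVec (s : Fin d → ℤ)‖ * M r s

/-- The atomistic energy. -/
def energyA {d : ℕ} (N : ℕ) {R : Finset (Fin d → ℤ)} (V : (R → Vec d) → ℝ)
    (y : Vec d → Vec d) : ℝ :=
  eps N ^ d * ∑ z ∈ refCell d N, V fun r : R => finDiff N y z r

/-- The Cauchy--Born stored energy function. -/
def cauchyBorn {d : ℕ} {R : Finset (Fin d → ℤ)} (V : (R → Vec d) → ℝ)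
    (F : Vec d →L[ℝ] Vec d) : ℝ :=
  V fun r : R => F (intVec r)

open Classical in
/-- (Indices of) the nodes `ℒ_a` in the reference cell with a bond that meets `Ω_a^#`. -/
def atomNodes {d : ℕ} (N : ℕ) (R : Finset (Fin d → ℤ)) (Ωa : Set (Vec d)) :
    Finset (Fin d → ℤ) :=
  (refCell d N).filter fun z => ∃ r ∈ R, (bond N z r ∩ perExt Ωa).Nonempty

open Classical in
/-- (Indices `(z, r)` of) the interface bonds: those contained in `Ω_i^#`. -/
def interfaceBonds {d : ℕ} (N : ℕ) (R : Finset (Fin d → ℤ)) (Ωi : Set (Vec d)) :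
    Finset ((Fin d → ℤ) × (Fin d → ℤ)) :=
  (refCell d N ×ˢ R).filter fun b => bond N b.1 b.2 ⊆ perExt Ωi

/-- The a/c energy; `Ei` is the interface potential, a function of the finite differences of the
interface bonds. The formula applies to sums of piecewise affine functions on different meshes. -/
def energyAC {d : ℕ} (N : ℕ) {R : Finset (Fin d → ℤ)} (V : (R → Vec d) → ℝ)
    (Ωc Ωi Ωa : Set (Vec d)) (Ei : (interfaceBonds N R Ωi → Vec d) → ℝ)
    (y : Vec d → Vec d) : ℝ :=
  (∫ x in Ωc, cauchyBorn V (fderiv ℝ y x))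
    + eps N ^ d * ∑ z ∈ atomNodes N R Ωa, V (fun r : R => finDiff N y z r)
    + eps N ^ d * Ei fun b => finDiff N y b.1.1 b.1.2

/-- The first variation `⟨δE(y), v⟩ = d/dt E(y + t v)` at `t = 0`. -/
def firstVar {d : ℕ} (E : (Vec d → Vec d) → ℝ) (y v : Vec d → Vec d) : ℝ :=
  deriv (fun t : ℝ => E fun x => y x + t • v x) 0

end ACCoupling

end

open ACCoupling

/-! Let `u` be a coarse test displacement with `‖∇u‖_{p'} = 1`, and let `v` be its interpolant on
the atomistic mesh, with the same lattice values. Finite differences see lattice values only, so the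
error functional at `u` and at `v` differs by the single term `∫_{Ω_c} ∂W(∇y) : (∇u - ∇v)`
(`firstVar_sub_eq`). Two facts are needed: `‖∇v‖_{p'} ≤ ‖∇u‖_{p'}`, so that the value at `v` is at
most the negative norm over atomistic displacements (`ofReal_le_negNorm`), and a bound of the
integral by the oscillation of `∇y`.

Both rest in two dimensions on one estimate without any shape regularity (`eLpNorm_edgeFun_le`). Fix
a direction `j`. Each atomistic triangle has exactly one side transversal to `e_j` along the
lattice; give the triangle the variation of `u` over that side, divided by `ε`. The resulting
function is bounded in `L^q` by `∂_{1-j} u`, with constant one. Indeed, on a line `x_j = s` the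
`q`-variations of `u` over lattice cells are bounded by the sum of `|∂_{1-j} u|^q` times the lengths
of the slices of the coarse elements. Coarse vertices are lattice points, so an element that meets
the interior of a lattice strip crosses the whole strip, and the lengths of its slices are concave
across it. Hence the slices at `s` dominate the convex combination of the variations on the two
walls of the strip, and its weights are exactly the fractions of the line inside the two kinds of
triangles. Integration in `s` gives the claim. Since `∂_{1-j} v` on a triangle is the difference
quotient of `u` over that side, stability follows.

For the integral, elements outside the continuum part are atomistic, so `u = v` there and the
integral extends to all of `Ω`. It splits over atomistic elements, on which the stress is constant.
In one dimension the mean of `u' - v'` over a cell is zero and the term vanishes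
(`integral_sub_integral_eq_zero_one`). In two dimensions, Green's formula in the direction `j` turns
each component into integrals of `u - v` over walls and diagonals, and periodic summation by parts
(`sum_by_parts`) moves the differences to the stress. The stress jumps are at most `M ε osc`
(`abs_stress_sub_le`, `exists_cell_bound`). Where a neighbour is not in `Ω_c^#`, `u - v` vanishes on
the common side. The side integrals are controlled by the variations of `u` above and by `∂_j (u -
v)`, and Hölder's inequality finishes (`component_le`). -/

namespace ACCoupling

/-! ### Continuous piecewise affine functions of one variable -/

/-- On the interval `[A, B]` the continuous function `u` is affine with slope `m k` on each of the
finitely many convex closed sets `I k`, which cover the interval. -/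
structure IsPiecewiseAffineOn {ι : Type*} (s : Finset ι) (I : ι → Set ℝ) (m : ι → ℝ) (u : ℝ → ℝ)
    (A B : ℝ) : Prop where
  continuous : Continuous u
  closed : ∀ k ∈ s, IsClosed (I k)
  convex : ∀ k ∈ s, Convex ℝ (I k)
  affine : ∀ k ∈ s, ∃ b, ∀ x ∈ I k, u x = m k * x + b
  covers : Icc A B ⊆ ⋃ k ∈ s, I k

namespace IsPiecewiseAffineOn

variable {ι : Type*} {s : Finset ι} {I : ι → Set ℝ} {m : ι → ℝ} {u : ℝ → ℝ} {A B : ℝ}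

/-- A closed convex set meets `[A, B]` in a compact interval. Away from the endpoints of these
finitely many intervals, `u` coincides near the point with one affine function. -/
theorem exists_hasDerivAt (h : IsPiecewiseAffineOn s I m u A B) :
    ∃ Z : Set ℝ, Z.Countable ∧ ∀ x ∈ Ioo A B \ Z, ∃ k ∈ s, x ∈ I k ∧ HasDerivAt u (m k) x := by
  refine ⟨⋃ k ∈ s, {sInf (I k ∩ Icc A B), sSup (I k ∩ Icc A B)}, ?_, ?_⟩
  · exact s.countable_toSet.biUnion fun k _ => (Set.toFinite _).countable
  · rintro x ⟨hx, hxZ⟩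
    obtain ⟨k, hk, hxk⟩ := mem_iUnion₂.1 (h.covers (Ioo_subset_Icc_self hx))
    refine ⟨k, hk, hxk, ?_⟩
    have hmem : x ∈ I k ∩ Icc A B := ⟨hxk, Ioo_subset_Icc_self hx⟩
    have hIcc : I k ∩ Icc A B = Icc (sInf (I k ∩ Icc A B)) (sSup (I k ∩ Icc A B)) :=
      eq_Icc_of_connected_compact
        ⟨⟨x, hmem⟩, ((h.convex k hk).inter (convex_Icc A B)).isPreconnected⟩
        (isCompact_Icc.inter_left (h.closed k hk))
    have hne : x ≠ sInf (I k ∩ Icc A B) ∧ x ≠ sSup (I k ∩ Icc A B) := by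
      constructor <;> intro he <;> apply hxZ <;> refine mem_iUnion₂.2 ⟨k, hk, ?_⟩ <;> simp [← he]
    have hxI := hIcc ▸ hmem
    obtain ⟨b, hb⟩ := h.affine k hk
    have hnhds : ∀ᶠ z in nhds x, u z = m k * z + b := by
      filter_upwards [Ioo_mem_nhds (lt_of_le_of_ne hxI.1 hne.1.symm)
        (lt_of_le_of_ne hxI.2 hne.2)] with z hz
      have hz' := Ioo_subset_Icc_self hz
      rw [← hIcc] at hz'
      exact hb z hz'.1
    have hd : HasDerivAt (fun z => m k * z + b) (m k) x := by
      simpa using ((hasDerivAt_id x).const_mul (m k)).add_const b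
    exact hd.congr_of_eventuallyEq hnhds

theorem ae_deriv (h : IsPiecewiseAffineOn s I m u A B) :
    ∀ᵐ x ∂(volume.restrict (Ioc A B)), ∃ k ∈ s, x ∈ I k ∧ deriv u x = m k := by
  obtain ⟨Z, hZ, hd⟩ := h.exists_hasDerivAt
  rw [← restrict_Ioo_eq_restrict_Ioc, ae_restrict_iff' measurableSet_Ioo]
  have : ∀ᵐ x : ℝ, x ∉ Z := hZ.ae_notMem volume
  filter_upwards [this] with x hx hxI
  obtain ⟨k, hk, hxk, hdk⟩ := hd x ⟨hxI, hx⟩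
  exact ⟨k, hk, hxk, hdk.deriv⟩

theorem norm_deriv_le (h : IsPiecewiseAffineOn s I m u A B) :
    ∀ᵐ x ∂(volume.restrict (Ioc A B)), ‖deriv u x‖ ≤ ∑ k ∈ s, |m k| := by
  filter_upwards [h.ae_deriv] with x ⟨k, hk, _, hx⟩
  rw [hx]
  exact Finset.single_le_sum (f := fun k => |m k|) (fun k _ => abs_nonneg _) hk

theorem mono (h : IsPiecewiseAffineOn s I m u A B) {a b : ℝ} (ha : A ≤ a) (hb : b ≤ B) :
    IsPiecewiseAffineOn s I m u a b where
  continuous := h.continuous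
  closed := h.closed
  convex := h.convex
  affine := h.affine
  covers := (Icc_subset_Icc ha hb).trans h.covers

theorem integrableOn_deriv (h : IsPiecewiseAffineOn s I m u A B) :
    IntegrableOn (deriv u) (Ioc A B) :=
  Measure.integrableOn_of_bounded (M := ∑ k ∈ s, |m k|) (by simp)
    (measurable_deriv u).aestronglyMeasurable h.norm_deriv_le

theorem integral_deriv (h : IsPiecewiseAffineOn s I m u A B) (hAB : A ≤ B) :
    ∫ x in A..B, deriv u x = u B - u A := by
  obtain ⟨Z, hZ, hd⟩ := h.exists_hasDerivAt
  refine integral_eq_of_hasDerivAt_off_countable_of_le u _ hAB hZ h.continuous.continuousOn ?_ ?_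
  · intro x hx
    obtain ⟨k, -, -, hk⟩ := hd x hx
    rw [hk.deriv]
    exact hk
  · rw [intervalIntegrable_iff_integrableOn_Ioc_of_le hAB]
    exact h.integrableOn_deriv

theorem ofReal_abs_sub_le (h : IsPiecewiseAffineOn s I m u A B) (hAB : A ≤ B) :
    ENNReal.ofReal |u B - u A| ≤ ∫⁻ x in Ioc A B, ‖deriv u x‖ₑ := by
  rw [← h.integral_deriv hAB, intervalIntegral.integral_of_le hAB, ← Real.enorm_eq_ofReal_abs]
  exact enorm_integral_le_lintegral_enorm _

theorem ofReal_variation_le (h : IsPiecewiseAffineOn s I m u A B) {c : ℝ} (hc : c ∈ Icc A B) :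
    ENNReal.ofReal (|u c - u A| + |u B - u c|) ≤ ∫⁻ x in Ioc A B, ‖deriv u x‖ₑ := by
  rw [ENNReal.ofReal_add (abs_nonneg _) (abs_nonneg _), ← Ioc_union_Ioc_eq_Ioc hc.1 hc.2,
    lintegral_union measurableSet_Ioc (Ioc_disjoint_Ioc_of_le le_rfl)]
  exact add_le_add ((h.mono le_rfl hc.2).ofReal_abs_sub_le hc.1)
    ((h.mono hc.1 le_rfl).ofReal_abs_sub_le hc.2)

/-- Hölder's inequality between the exponents `1` and `q` on an interval of length `B - A`. The
intermediate point `c` costs nothing, as the integral of `|u'|` is additive. Later it is the point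
of an edge at which `|u - v|` is largest. -/
theorem ofReal_variation_rpow_le (h : IsPiecewiseAffineOn s I m u A B) (hAB : A < B) {c q : ℝ}
    (hc : c ∈ Icc A B) (hq : 1 ≤ q) :
    ENNReal.ofReal (B - A) * ENNReal.ofReal ((|u c - u A| + |u B - u c|) / (B - A)) ^ q ≤
      ∫⁻ x in Ioc A B, ‖deriv u x‖ₑ ^ q := by
  have hδ : 0 < B - A := sub_pos.2 hAB
  have hq0 : 0 < q := one_pos.trans_le hq
  set D := ENNReal.ofReal (B - A) with hD
  have hD0 : D ≠ 0 := by simpa [hD] using hAB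
  have hDt : D ≠ ∞ := ENNReal.ofReal_ne_top
  have h1 := eLpNorm_le_eLpNorm_mul_rpow_measure_univ (μ := volume.restrict (Ioc A B))
    (f := deriv u) (p := 1) (q := ENNReal.ofReal q) (by simpa using hq)
    (measurable_deriv u).aestronglyMeasurable
  rw [eLpNorm_one_eq_lintegral_enorm, eLpNorm_eq_lintegral_rpow_enorm_toReal (by simpa using hq0)
    ENNReal.ofReal_ne_top, ENNReal.toReal_ofReal hq0.le] at h1
  simp only [Measure.restrict_apply MeasurableSet.univ, univ_inter, Real.volume_Ioc,
    ENNReal.toReal_one, div_one] at h1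
  have h2 := (h.ofReal_variation_le hc).trans h1
  have h3 := ENNReal.rpow_le_rpow h2 hq0.le
  rw [ENNReal.mul_rpow_of_nonneg _ _ hq0.le, ← ENNReal.rpow_mul, ← ENNReal.rpow_mul,
    one_div_mul_cancel hq0.ne', ENNReal.rpow_one, sub_mul, one_div_mul_cancel hq0.ne', one_mul,
    ← hD] at h3
  rw [ENNReal.ofReal_div_of_pos hδ, ENNReal.div_rpow_of_nonneg _ _ hq0.le, ← mul_div_assoc]
  refine ENNReal.div_le_of_le_mul ?_
  calc D * ENNReal.ofReal (|u c - u A| + |u B - u c|) ^ q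
      ≤ D * ((∫⁻ x in Ioc A B, ‖deriv u x‖ₑ ^ q) * D ^ (q - 1)) := by gcongr
    _ = (∫⁻ x in Ioc A B, ‖deriv u x‖ₑ ^ q) * (D ^ (1 : ℝ) * D ^ (q - 1)) := by
        rw [ENNReal.rpow_one]; ring
    _ = _ := by rw [← ENNReal.rpow_add _ _ hD0 hDt]; simp [hD]

/-- Only an inequality in general: the pieces may overlap, as on a line through a common edge of two
elements, and may extend beyond the interval. -/
theorem lintegral_deriv_rpow_le (h : IsPiecewiseAffineOn s I m u A B) {q : ℝ} :
    ∫⁻ x in Ioc A B, ‖deriv u x‖ₑ ^ q ≤ ∑ k ∈ s, ‖m k‖ₑ ^ q * volume (I k) := by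
  calc ∫⁻ x in Ioc A B, ‖deriv u x‖ₑ ^ q
      ≤ ∫⁻ x in Ioc A B, ∑ k ∈ s, (I k).indicator (fun _ => ‖m k‖ₑ ^ q) x := by
        refine lintegral_mono_ae ?_
        filter_upwards [h.ae_deriv] with x ⟨k, hk, hxk, hx⟩
        rw [hx]
        refine le_trans (by simp [hxk]) (Finset.single_le_sum
          (f := fun k => (I k).indicator (fun _ => ‖m k‖ₑ ^ q) x) (fun _ _ => zero_le) hk)
    _ ≤ ∫⁻ x, ∑ k ∈ s, (I k).indicator (fun _ => ‖m k‖ₑ ^ q) x := setLIntegral_le_lintegral _ _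
    _ = ∑ k ∈ s, ‖m k‖ₑ ^ q * volume (I k) := by
        rw [lintegral_finsetSum' _ fun k hk =>
          (measurable_const.indicator (h.closed k hk).measurableSet).aemeasurable]
        exact Finset.sum_congr rfl fun k hk => by
          rw [lintegral_indicator_const (h.closed k hk).measurableSet]

end IsPiecewiseAffineOn

theorem eps_pos {N : ℕ} (hN : 0 < N) : 0 < eps N := by unfold eps; positivity

theorem eps_mul {N : ℕ} (hN : 0 < N) : eps N * N = 1 := by
  unfold eps; field_simp

theorem eps_mul_mem_Icc {N : ℕ} (hN : 0 < N) {j : ℤ} (h1 : -(N : ℤ) ≤ j) (h2 : j ≤ N) :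
    eps N * j ∈ Icc (-1 : ℝ) 1 := by
  have h1' : -(N : ℝ) ≤ j := by exact_mod_cast h1
  have h2' : (j : ℝ) ≤ N := by exact_mod_cast h2
  have := eps_mul hN
  have := eps_pos hN
  constructor <;> nlinarith

/-- The `q`-variation of a piecewise affine function over the lattice cells of `[-1, 1]` is bounded
in terms of its slopes. -/
theorem IsPiecewiseAffineOn.sum_variation_rpow_le {ι : Type*} {s : Finset ι} {I : ι → Set ℝ}
    {m : ι → ℝ} {u : ℝ → ℝ} (h : IsPiecewiseAffineOn s I m u (-1) 1) {N : ℕ} (hN : 0 < N)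
    {q : ℝ} (hq : 1 ≤ q) (c : ℤ → ℝ) (hc : ∀ j : ℤ, c j ∈ Icc (eps N * j) (eps N * (j + 1))) :
    ∑ j ∈ Finset.Ico (-(N : ℤ)) N, ENNReal.ofReal (eps N) *
      ENNReal.ofReal ((|u (c j) - u (eps N * j)| + |u (eps N * (j + 1)) - u (c j)|) / eps N) ^ q ≤
      ∑ k ∈ s, ‖m k‖ₑ ^ q * volume (I k) := by
  have he := eps_pos hN
  refine le_trans ?_ h.lintegral_deriv_rpow_le
  have hbd : ∀ j ∈ Finset.Ico (-(N : ℤ)) N,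
      -1 ≤ eps N * j ∧ eps N * j < eps N * (j + 1) ∧ eps N * (j + 1) ≤ 1 := by
    intro j hj
    rw [Finset.mem_Ico] at hj
    have h1 := eps_mul_mem_Icc hN hj.1 hj.2.le
    have h2 := eps_mul_mem_Icc hN (by lia : -(N : ℤ) ≤ j + 1) hj.2
    push_cast at h2
    exact ⟨h1.1, by nlinarith, h2.2⟩
  calc _ ≤ ∑ j ∈ Finset.Ico (-(N : ℤ)) N,
        ∫⁻ x in Ioc (eps N * j) (eps N * (j + 1)), ‖deriv u x‖ₑ ^ q := by
        refine Finset.sum_le_sum fun j hj => ?_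
        obtain ⟨h1, h2, h3⟩ := hbd j hj
        have := (h.mono h1 h3).ofReal_variation_rpow_le h2 (hc j) hq
        rwa [show eps N * (j + 1) - eps N * j = eps N by ring] at this
    _ = ∫⁻ x in ⋃ j ∈ Finset.Ico (-(N : ℤ)) N, Ioc (eps N * j) (eps N * (j + 1)),
          ‖deriv u x‖ₑ ^ q := by
        rw [lintegral_biUnion_finset _ fun j _ => measurableSet_Ioc]
        intro i _ j _ hij
        rcases lt_or_gt_of_ne hij with hlt | hlt
        · refine Ioc_disjoint_Ioc_of_le ?_
          have : (i : ℝ) + 1 ≤ j := by exact_mod_cast hlt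
          gcongr
        · refine (Ioc_disjoint_Ioc_of_le ?_).symm
          have : (j : ℝ) + 1 ≤ i := by exact_mod_cast hlt
          gcongr
    _ ≤ _ := by
        refine lintegral_mono_set (iUnion₂_subset fun j hj => ?_)
        obtain ⟨h1, h2, h3⟩ := hbd j hj
        exact Ioc_subset_Ioc h1 h3

/-! ### Continuous piecewise affine functions on `ℝ^d` -/

/-- A finite family of compact convex sets that covers `[-1, 1]^d`. -/
structure IsConvexCover {d : ℕ} (𝒯 : Set (Set (Vec d))) : Prop where
  finite : 𝒯.Finite
  compact : ∀ T ∈ 𝒯, IsCompact T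
  convex : ∀ T ∈ 𝒯, Convex ℝ T
  covers : OmegaBar d ⊆ ⋃₀ 𝒯

/-- `f` is continuous, and affine with gradient `L T` on each `T ∈ 𝒯`. -/
structure HasGradients {d : ℕ} (𝒯 : Set (Set (Vec d))) (f : Vec d → ℝ)
    (L : Set (Vec d) → Vec d →L[ℝ] ℝ) : Prop where
  continuous : Continuous f
  affine : ∀ T ∈ 𝒯, ∃ b, ∀ x ∈ T, f x = L T x + b

theorem HasGradients.isPiecewiseAffineOn {d : ℕ} {𝒯 : Set (Set (Vec d))} (h𝒯 : IsConvexCover 𝒯)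
    {f : Vec d → ℝ} {L : Set (Vec d) → Vec d →L[ℝ] ℝ} (hf : HasGradients 𝒯 f L) (x e : Vec d)
    {A B : ℝ} (hAB : ∀ s ∈ Icc A B, x + s • e ∈ OmegaBar d) :
    IsPiecewiseAffineOn h𝒯.finite.toFinset (fun T => (fun s : ℝ => x + s • e) ⁻¹' T)
      (fun T => L T e) (fun s => f (x + s • e)) A B where
  continuous := hf.continuous.comp (by fun_prop)
  closed T hT := (h𝒯.compact T (by simpa using hT)).isClosed.preimage (by fun_prop)
  convex T hT := by
    intro a ha b hb α β hα hβ hαβ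
    have := h𝒯.convex T (by simpa using hT) ha hb hα hβ hαβ
    simp only [mem_preimage]
    convert! this using 1
    have hx : x = α • x + β • x := by rw [← add_smul, hαβ, one_smul]
    conv_lhs => rw [hx]
    simp only [smul_eq_mul]
    module
  affine T hT := by
    obtain ⟨b, hb⟩ := hf.affine T (by simpa using hT)
    refine ⟨L T x + b, fun s hs => ?_⟩
    rw [hb _ hs]
    simp
    ring
  covers := by
    intro s hs
    obtain ⟨T, hT, hsT⟩ := h𝒯.covers (hAB s hs)
    exact mem_iUnion₂.2 ⟨T, by simpa using hT, hsT⟩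

/-! ### The domain and the gradients of piecewise affine functions -/

theorem convex_OmegaBar (d : ℕ) : Convex ℝ (OmegaBar d) := by
  intro x hx y hy a b ha hb hab i
  have h1 := hx i
  have h2 := hy i
  simp only [PiLp.add_apply, PiLp.smul_apply, smul_eq_mul]
  constructor <;> nlinarith

theorem isClosed_OmegaBar (d : ℕ) : IsClosed (OmegaBar d) := by
  have : OmegaBar d = ⋂ i, {x : Vec d | -1 ≤ x i ∧ x i ≤ 1} := by ext; simp [OmegaBar]
  rw [this]
  refine isClosed_iInter fun i => ?_
  exact (isClosed_le (f := fun _ : Vec d => (-1 : ℝ)) (g := fun x => x i)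
    (by fun_prop) (by fun_prop)).inter
    (isClosed_le (f := fun x : Vec d => x i) (g := fun _ => (1 : ℝ)) (by fun_prop) (by fun_prop))

theorem isCompact_OmegaBar (d : ℕ) : IsCompact (OmegaBar d) := by
  refine Metric.isCompact_of_isClosed_isBounded (isClosed_OmegaBar d) ?_
  have h2 : OmegaBar d ⊆ (WithLp.toLp 2) '' (Set.pi univ fun _ : Fin d => Icc (-1 : ℝ) 1) := by
    intro x hx
    exact ⟨x.ofLp, fun i _ => hx i, rfl⟩
  refine Bornology.IsBounded.subset ?_ h2
  exact ((isCompact_univ_pi fun _ => isCompact_Icc).image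
    (PiLp.continuous_toLp 2 _)).isBounded

theorem Omega_ae_eq_OmegaBar (d : ℕ) : Omega d =ᵐ[volume] OmegaBar d := by
  have h := (Measure.univ_pi_Ioc_ae_eq_Icc (μ := fun _ : Fin d => (volume : Measure ℝ))
    (f := fun _ => -1) (g := fun _ => 1))
  have h2 := (PiLp.volume_preserving_ofLp (Fin d)).quasiMeasurePreserving.preimage_ae_eq h
  refine Filter.EventuallyEq.trans (Filter.EventuallyEq.of_eq ?_)
    (h2.trans (Filter.EventuallyEq.of_eq ?_))
  · apply Set.ext
    intro x
    simp [Omega]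
  · apply Set.ext
    intro x
    simp only [OmegaBar, ← Set.pi_univ_Icc, mem_preimage, Set.mem_pi, mem_Icc, mem_ofPred_eq,
      mem_univ, true_imp_iff]

theorem restrict_Omega (d : ℕ) : volume.restrict (Omega d) = volume.restrict (OmegaBar d) :=
  Measure.restrict_congr_set (Omega_ae_eq_OmegaBar d)

theorem HasGradients.hasFDerivAt {d : ℕ} {𝒯 : Set (Set (Vec d))} {f : Vec d → ℝ}
    {L : Set (Vec d) → Vec d →L[ℝ] ℝ} (hf : HasGradients 𝒯 f L) {T : Set (Vec d)} (hT : T ∈ 𝒯)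
    {x : Vec d} (hx : x ∈ interior T) : HasFDerivAt f (L T) x := by
  obtain ⟨b, hb⟩ := hf.affine T hT
  have hd : HasFDerivAt (fun z => L T z + b) (L T) x := (L T).hasFDerivAt.add_const b
  refine hd.congr_of_eventuallyEq ?_
  filter_upwards [mem_interior_iff_mem_nhds.1 hx] with z hz using hb z hz

/-- The frontier of a convex set is a null set. Derivatives can therefore be read off the affine
formula on the element almost everywhere. -/
theorem IsConvexCover.ae_mem_interior {d : ℕ} {𝒯 : Set (Set (Vec d))} (h𝒯 : IsConvexCover 𝒯) :
    ∀ᵐ x ∂(volume : Measure (Vec d)), ∀ T ∈ 𝒯, x ∈ T → x ∈ interior T := by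
  refine (ae_ball_iff h𝒯.finite.countable).2 fun T hT => ?_
  have h0 : ∀ᵐ x ∂(volume : Measure (Vec d)), x ∉ frontier T :=
    measure_eq_zero_iff_ae_notMem.1 ((h𝒯.convex T hT).addHaar_frontier _)
  filter_upwards [h0] with x hx hxT
  by_contra hi
  exact hx ⟨subset_closure hxT, hi⟩

theorem IsConvexCover.ae_exists_mem_interior {d : ℕ} {𝒯 : Set (Set (Vec d))}
    (h𝒯 : IsConvexCover 𝒯) :
    ∀ᵐ x ∂(volume.restrict (Omega d)), ∃ T ∈ 𝒯, x ∈ interior T := by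
  rw [restrict_Omega, ae_restrict_iff' (isClosed_OmegaBar d).measurableSet]
  filter_upwards [h𝒯.ae_mem_interior] with x hx hxΩ
  obtain ⟨T, hT, hxT⟩ := h𝒯.covers hxΩ
  exact ⟨T, hT, hx T hT hxT⟩

/-- Integrals over the elements of an almost everywhere disjoint family of subsets of `Ω`. -/
theorem sum_gradient_rpow_le {d : ℕ} {𝒯 : Set (Set (Vec d))} (h𝒯 : IsConvexCover 𝒯)
    (hsub : ∀ T ∈ 𝒯, T ⊆ OmegaBar d)
    (hdisj : 𝒯.Pairwise (AEDisjoint volume)) {f : Vec d → ℝ}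
    {L : Set (Vec d) → Vec d →L[ℝ] ℝ} (hf : HasGradients 𝒯 f L) (e : Vec d) (q : ℝ) :
    ∑ T ∈ h𝒯.finite.toFinset, ‖L T e‖ₑ ^ q * volume T ≤
      ∫⁻ x in Omega d, ‖fderiv ℝ f x e‖ₑ ^ q := by
  rw [restrict_Omega]
  calc ∑ T ∈ h𝒯.finite.toFinset, ‖L T e‖ₑ ^ q * volume T
      = ∑ T ∈ h𝒯.finite.toFinset, ∫⁻ x in T, ‖fderiv ℝ f x e‖ₑ ^ q := by
        refine Finset.sum_congr rfl fun T hT => ?_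
        have hT' : T ∈ 𝒯 := by simpa using hT
        rw [← setLIntegral_const]
        refine setLIntegral_congr_fun_ae (h𝒯.compact T hT').isClosed.measurableSet ?_
        filter_upwards [h𝒯.ae_mem_interior] with x hx hxT
        rw [(hf.hasFDerivAt hT' (hx T hT' hxT)).fderiv]
    _ = ∫⁻ x in ⋃ T ∈ h𝒯.finite.toFinset, T, ‖fderiv ℝ f x e‖ₑ ^ q := by
        rw [lintegral_biUnion_finset₀]
        · simpa using hdisj
        · intro T hT
          exact (h𝒯.compact T (by simpa using hT)).isClosed.measurableSet.nullMeasurableSet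
    _ ≤ _ := lintegral_mono_set (iUnion₂_subset fun T hT => hsub T (by simpa using hT))

/-- The counterpart of `sum_gradient_rpow_le` for `q = ∞`: the interior of an element has positive
measure, so the essential supremum sees its gradient. -/
theorem enorm_gradient_le_eLpNorm_top {d : ℕ} {𝒯 : Set (Set (Vec d))}
    {T : Set (Vec d)} (hT : T ∈ 𝒯) (hsub : T ⊆ OmegaBar d)
    (hint : (interior T).Nonempty) {f : Vec d → ℝ}
    {L : Set (Vec d) → Vec d →L[ℝ] ℝ} (hf : HasGradients 𝒯 f L) (e : Vec d) :
    ‖L T e‖ₑ ≤ eLpNorm (fun x => fderiv ℝ f x e) ∞ (volume.restrict (Omega d)) := by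
  rw [restrict_Omega, eLpNorm_exponent_top]
  have h1 : ∀ᵐ x ∂(volume.restrict (interior T)), ‖fderiv ℝ f x e‖ₑ ≤
      eLpNormEssSup (fun x => fderiv ℝ f x e) (volume.restrict (OmegaBar d)) :=
    ae_restrict_of_ae_restrict_of_subset (interior_subset.trans hsub)
      (enorm_ae_le_eLpNormEssSup _ _)
  have h2 : ∀ᵐ x ∂(volume.restrict (interior T)), x ∈ interior T :=
    ae_restrict_mem isOpen_interior.measurableSet
  have : (ae (volume.restrict (interior T))).NeBot := by
    rw [ae_neBot, Ne, Measure.restrict_eq_zero]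
    exact (isOpen_interior.measure_pos _ hint).ne'
  obtain ⟨x, hx1, hx2⟩ := (h1.and h2).exists
  rwa [(hf.hasFDerivAt hT hx2).fderiv] at hx1

/-! ### The coarse mesh -/

theorem shift_zero {d : ℕ} (A : Set (Vec d)) : shift 0 A = A := by
  have : (intVec (0 : Fin d → ℤ)) = 0 := by ext; simp [intVec]
  simp [shift, this]

section CoarseMesh

variable {d N : ℕ} {Th : Set (Finset (Vec d))}

theorem IsPeriodicTriangulation.subset_OmegaBar (h : IsPeriodicTriangulation N Th)
    {T : Set (Vec d)} (hT : T ∈ elements Th) : T ⊆ OmegaBar d := by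
  rw [← h.covers]
  exact subset_sUnion_of_mem hT

/-- The vertices are lattice points of a bounded set, so there are only finitely many candidates for
vertex sets. -/
theorem IsPeriodicTriangulation.finite (hN : 0 < N) (h : IsPeriodicTriangulation N Th) :
    Th.Finite := by
  classical
  set P : Finset (Vec d) := (Fintype.piFinset fun _ : Fin d => Finset.Icc (-(N : ℤ)) N).image
    (latticePt N) with hP
  refine (P.powerset.finite_toSet).subset fun s hs => ?_
  simp only [Finset.coe_powerset, mem_preimage, mem_powerset_iff, Finset.coe_subset]
  intro x hx
  obtain ⟨z, rfl⟩ := h.vertices_mem s hs x hx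
  have hΩ : latticePt N z ∈ OmegaBar d :=
    h.subset_OmegaBar ⟨s, hs, rfl⟩ (subset_convexHull ℝ _ hx)
  refine Finset.mem_image.2 ⟨z, ?_, rfl⟩
  rw [Fintype.mem_piFinset]
  intro i
  obtain ⟨h1, h2⟩ := hΩ i
  have hz : (latticePt N z) i = (z i : ℝ) / N := by
    simp [latticePt, eps, intVec]; field_simp
  have hN' : (0 : ℝ) < N := by exact_mod_cast hN
  rw [hz, le_div_iff₀ hN'] at h1
  rw [hz, div_le_iff₀ hN'] at h2
  rw [Finset.mem_Icc]
  constructor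
  · have : (-(N : ℝ)) ≤ z i := by linarith
    exact_mod_cast this
  · have : (z i : ℝ) ≤ N := by linarith
    exact_mod_cast this

theorem isCompact_of_mem_elements {𝒯 : Set (Finset (Vec d))} {T : Set (Vec d)}
    (hT : T ∈ elements 𝒯) : IsCompact T := by
  obtain ⟨s, -, rfl⟩ := hT
  exact s.finite_toSet.isCompact_convexHull (𝕜 := ℝ)

theorem isClosed_region {𝒯 : Set (Finset (Vec d))} (h : 𝒯.Finite) : IsClosed (region 𝒯) := by
  rw [region, sUnion_eq_biUnion]
  exact (h.image _).isClosed_biUnion fun _ hT => (isCompact_of_mem_elements hT).isClosed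

theorem IsPeriodicTriangulation.isConvexCover (hN : 0 < N) (h : IsPeriodicTriangulation N Th) :
    IsConvexCover (elements Th) where
  finite := (h.finite hN).image _
  compact _ hT := isCompact_of_mem_elements hT
  convex := by
    rintro T ⟨s, -, rfl⟩
    exact convex_convexHull ℝ _
  covers := h.covers.ge

theorem IsPeriodicTriangulation.interior_nonempty (h : IsPeriodicTriangulation N Th)
    {T : Set (Vec d)} (hT : T ∈ elements Th) : (interior T).Nonempty := by
  obtain ⟨s, hs, rfl⟩ := hT
  rw [interior_convexHull_nonempty_iff_affineSpan_eq_top]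
  have h1 := (h.affineIndependent s hs).affineSpan_eq_top_iff_card_eq_finrank_add_one.2
    (by simp [h.card_vertices s hs])
  simpa using h1

theorem volume_convexHull_eq_zero_of_card_le (s : Finset (Vec d)) (hs : s.card ≤ d) :
    volume (convexHull ℝ (s : Set (Vec d))) = 0 := by
  rcases s.eq_empty_or_nonempty with rfl | hne
  · simp
  have hc : s.card = (s.card - 1) + 1 := (Nat.succ_pred_eq_of_pos hne.card_pos).symm
  have h1 := finrank_vectorSpan_range_le ℝ ((↑) : s → Vec d) (n := s.card - 1)
    (by simpa using hc)
  refine measure_mono_null (convexHull_subset_affineSpan _) ?_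
  refine Measure.addHaar_affineSubspace _ _ fun htop => ?_
  have h2 : vectorSpan ℝ (s : Set (Vec d)) = ⊤ := by
    rw [← direction_affineSpan, htop, AffineSubspace.direction_top]
  have h3 : range ((↑) : s → Vec d) = (s : Set (Vec d)) := by simp
  rw [h3, h2, finrank_top, finrank_euclideanSpace_fin] at h1
  have := hne.card_pos
  omega

/-- Conformity, used for the zero translate, confines the intersection to the hull of the common
vertices. Distinct elements share at most `d` of their `d + 1` vertices, and that hull lies in a
proper affine subspace. -/
theorem IsPeriodicTriangulation.pairwise_aedisjoint (h : IsPeriodicTriangulation N Th) :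
    (elements Th).Pairwise (AEDisjoint volume) := by
  classical
  rintro _ ⟨s, hs, rfl⟩ _ ⟨t, ht, rfl⟩ hst
  have hne : s ≠ t := fun he => hst (by rw [he])
  have hc := h.conforming s hs t ht 0
  rw [shift_zero, shift_zero, ← Finset.coe_inter] at hc
  refine measure_mono_null hc (volume_convexHull_eq_zero_of_card_le _ ?_)
  have h1 : s ∩ t ⊂ s := by
    refine Finset.inter_subset_left.ssubset_of_ne fun he => hne ?_
    refine Finset.eq_of_subset_of_card_le (Finset.inter_eq_left.1 he) ?_
    rw [h.card_vertices s hs, h.card_vertices t ht]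
  have := Finset.card_lt_card h1
  rw [h.card_vertices s hs] at this
  omega

end CoarseMesh

/-! ### Coordinates of the plane, adapted to one of the two lattice directions -/

/-- The point of the plane with `j`-th coordinate `s` and other coordinate `t`. -/
noncomputable def pt (j : Fin 2) (s t : ℝ) : Vec 2 := WithLp.toLp 2 fun i => if i = j then s else t

/-- The `j`-th basis vector. -/
noncomputable abbrev basisVec {d : ℕ} (j : Fin d) : Vec d := EuclideanSpace.single j (1 : ℝ)

@[simp] theorem pt_same (j : Fin 2) (s t : ℝ) : pt j s t j = s := by simp [pt]

@[simp] theorem pt_other (j : Fin 2) (s t : ℝ) : pt j s t (1 - j) = t := by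
  fin_cases j <;> simp [pt]

theorem pt_eq_iff {j : Fin 2} {x : Vec 2} {s t : ℝ} : x = pt j s t ↔ x j = s ∧ x (1 - j) = t := by
  constructor
  · rintro rfl; simp
  · rintro ⟨rfl, rfl⟩
    ext i
    fin_cases j <;> fin_cases i <;> simp [pt]

theorem pt_eta (j : Fin 2) (x : Vec 2) : pt j (x j) (x (1 - j)) = x :=
  (pt_eq_iff.2 ⟨rfl, rfl⟩).symm

theorem pt_swap (j : Fin 2) (s t : ℝ) : pt (1 - j) t s = pt j s t := by
  ext i
  fin_cases j <;> fin_cases i <;> simp [pt]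

theorem pt_add (j : Fin 2) (s t s' t' : ℝ) : pt j s t + pt j s' t' = pt j (s + s') (t + t') := by
  ext i; by_cases h : i = j <;> simp [pt, h]

theorem pt_smul (j : Fin 2) (c s t : ℝ) : c • pt j s t = pt j (c * s) (c * t) := by
  ext i; by_cases h : i = j <;> simp [pt, h]

theorem pt_eq_add_smul (j : Fin 2) (s t : ℝ) : pt j s t = pt j s 0 + t • basisVec (1 - j) := by
  ext i; fin_cases j <;> fin_cases i <;> simp [pt]

theorem pt_eq_add_smul' (j : Fin 2) (s t : ℝ) : pt j s t = pt j 0 t + s • basisVec j := by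
  ext i; fin_cases j <;> fin_cases i <;> simp [pt]

theorem forall_fin_two_iff (j : Fin 2) {p : Fin 2 → Prop} : (∀ i, p i) ↔ p j ∧ p (1 - j) := by
  rw [Fin.forall_fin_two]
  fin_cases j <;> simp [and_comm]

theorem pt_mem_OmegaBar {j : Fin 2} {s t : ℝ} :
    pt j s t ∈ OmegaBar 2 ↔ s ∈ Icc (-1 : ℝ) 1 ∧ t ∈ Icc (-1 : ℝ) 1 := by
  simp only [OmegaBar, mem_ofPred_eq, forall_fin_two_iff j, pt_same, pt_other, mem_Icc]

theorem pt_mem_Omega {j : Fin 2} {s t : ℝ} :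
    pt j s t ∈ Omega 2 ↔ s ∈ Ioc (-1 : ℝ) 1 ∧ t ∈ Ioc (-1 : ℝ) 1 := by
  simp only [Omega, mem_ofPred_eq, forall_fin_two_iff j, pt_same, pt_other, mem_Ioc]

theorem continuous_pt (j : Fin 2) : Continuous fun p : ℝ × ℝ => pt j p.1 p.2 := by
  refine (PiLp.continuous_toLp 2 _).comp (continuous_pi fun i => ?_)
  by_cases h : i = j <;> simp only [h, if_true, if_false] <;> fun_prop

/-- The coordinates of the plane as a measurable equivalence. -/
noncomputable def ptEquiv (j : Fin 2) : ℝ × ℝ ≃ᵐ Vec 2 where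
  toFun p := pt j p.1 p.2
  invFun x := (x j, x (1 - j))
  left_inv p := by simp
  right_inv x := pt_eta j x
  measurable_toFun := (continuous_pt j).measurable
  measurable_invFun := by
    have h : Continuous fun x : Vec 2 => (x j, x (1 - j)) := by fun_prop
    exact h.measurable

theorem measurePreserving_ptEquiv (j : Fin 2) : MeasurePreserving (ptEquiv j) := by
  have h0 : MeasurePreserving fun p : ℝ × ℝ => pt 0 p.1 p.2 := by
    have := (PiLp.volume_preserving_toLp (Fin 2)).comp ((volume_preserving_finTwoArrow ℝ).symm)
    convert! this using 1
    funext p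
    ext i
    fin_cases i <;> simp [pt, MeasurableEquiv.finTwoArrow]
  fin_cases j
  · exact h0
  · have h1 := h0.comp (Measure.measurePreserving_swap (μ := (volume : Measure ℝ))
      (ν := (volume : Measure ℝ)))
    convert! h1 using 1
    funext p
    exact (pt_swap 1 p.1 p.2).symm

theorem lintegral_eq_pt (j : Fin 2) {F : Vec 2 → ℝ≥0∞} (hF : Measurable F) :
    ∫⁻ x, F x = ∫⁻ s, ∫⁻ t, F (pt j s t) := by
  rw [← (measurePreserving_ptEquiv j).lintegral_comp hF, Measure.volume_eq_prod,
    lintegral_prod (fun p => F (ptEquiv j p)) (hF.comp (ptEquiv j).measurable).aemeasurable]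
  rfl

theorem lintegral_Omega_eq_pt (j : Fin 2) {F : Vec 2 → ℝ≥0∞} (hF : Measurable F) :
    ∫⁻ x in Omega 2, F x =
      ∫⁻ s in Ioc (-1 : ℝ) 1, ∫⁻ t in Ioc (-1 : ℝ) 1, F (pt j s t) := by
  have hΩ : MeasurableSet (Omega 2) := by
    have : Omega 2 = (ptEquiv j).symm ⁻¹' (Ioc (-1 : ℝ) 1 ×ˢ Ioc (-1 : ℝ) 1) := by
      ext x
      rw [← pt_eta j x, pt_mem_Omega]
      simp [ptEquiv]
    rw [this]
    exact (ptEquiv j).symm.measurable (measurableSet_Ioc.prod measurableSet_Ioc)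
  rw [← lintegral_indicator hΩ, lintegral_eq_pt j (hF.indicator hΩ),
    ← lintegral_indicator measurableSet_Ioc]
  refine lintegral_congr fun s => ?_
  by_cases hs : s ∈ Ioc (-1 : ℝ) 1
  · rw [indicator_of_mem hs, ← lintegral_indicator measurableSet_Ioc]
    refine lintegral_congr fun t => ?_
    by_cases ht : t ∈ Ioc (-1 : ℝ) 1
    · rw [indicator_of_mem ht, indicator_of_mem (pt_mem_Omega.2 ⟨hs, ht⟩)]
    · rw [indicator_of_notMem ht, indicator_of_notMem fun h => ht (pt_mem_Omega.1 h).2]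
  · rw [indicator_of_notMem hs]
    refine (lintegral_congr fun t => ?_).trans lintegral_zero
    rw [indicator_of_notMem fun h => hs (pt_mem_Omega.1 h).1]

/-! ### Slices of the elements -/

/-- The slice of `T` with `j`-th coordinate `s`. -/
def slice (j : Fin 2) (T : Set (Vec 2)) (s : ℝ) : Set ℝ := {t | pt j s t ∈ T}

theorem volume_eq_lintegral_slice (j : Fin 2) {T : Set (Vec 2)} (hT : MeasurableSet T) :
    volume T = ∫⁻ s, volume (slice j T s) := by
  have hc : Continuous (Function.uncurry (pt j)) := continuous_pt j
  rw [← lintegral_indicator_one hT, lintegral_eq_pt j (measurable_one.indicator hT)]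
  refine lintegral_congr fun s => ?_
  have hm : MeasurableSet (slice j T s) := hT.preimage
    (hc.comp (by fun_prop : Continuous fun t : ℝ => (s, t))).measurable
  rw [← lintegral_indicator_one hm]
  rfl

theorem isCompact_slice (j : Fin 2) {T : Set (Vec 2)} (hT : IsCompact T) (s : ℝ) :
    IsCompact (slice j T s) := by
  have : slice j T s = (fun x : Vec 2 => x (1 - j)) '' (T ∩ {x | x j = s}) := by
    ext t
    constructor
    · intro ht
      exact ⟨pt j s t, ⟨ht, by simp⟩, by simp⟩
    · rintro ⟨x, ⟨hx, rfl⟩, rfl⟩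
      change pt j _ _ ∈ T
      rwa [pt_eta]
  rw [this]
  refine (hT.inter_right (isClosed_eq (by fun_prop) (by fun_prop))).image (by fun_prop)

theorem mem_slice_combo {j : Fin 2} {T : Set (Vec 2)} (hT : Convex ℝ T) {s₀ s₁ t₀ t₁ α β : ℝ}
    (h0 : t₀ ∈ slice j T s₀) (h1 : t₁ ∈ slice j T s₁) (hα : 0 ≤ α) (hβ : 0 ≤ β)
    (hαβ : α + β = 1) : α * t₀ + β * t₁ ∈ slice j T (α * s₀ + β * s₁) := by
  have := hT h0 h1 hα hβ hαβ
  rwa [pt_smul, pt_smul, pt_add] at this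

theorem convex_slice (j : Fin 2) {T : Set (Vec 2)} (hT : Convex ℝ T) (s : ℝ) :
    Convex ℝ (slice j T s) := by
  intro t₀ h0 t₁ h1 α β hα hβ hαβ
  have := mem_slice_combo hT h0 h1 hα hβ hαβ
  rwa [← add_mul, hαβ, one_mul] at this

/-- The lengths of the non-empty slices of a convex set are concave. -/
theorem volume_slice_concave {j : Fin 2} {T : Set (Vec 2)} (hT : Convex ℝ T) (hTc : IsCompact T)
    {s₀ s₁ α β : ℝ} (h0 : (slice j T s₀).Nonempty) (h1 : (slice j T s₁).Nonempty) (hα : 0 ≤ α)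
    (hβ : 0 ≤ β) (hαβ : α + β = 1) :
    ENNReal.ofReal α * volume (slice j T s₀) + ENNReal.ofReal β * volume (slice j T s₁) ≤
      volume (slice j T (α * s₀ + β * s₁)) := by
  have hI : ∀ s, (slice j T s).Nonempty →
      slice j T s = Icc (sInf (slice j T s)) (sSup (slice j T s)) := fun s hs =>
    eq_Icc_of_connected_compact ⟨hs, (convex_slice j hT s).isPreconnected⟩ (isCompact_slice j hTc s)
  have hmem : ∀ s, (slice j T s).Nonempty → sInf (slice j T s) ∈ slice j T s ∧
      sSup (slice j T s) ∈ slice j T s := fun s hs =>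
    ⟨(isCompact_slice j hTc s).sInf_mem hs, (isCompact_slice j hTc s).sSup_mem hs⟩
  have hle : ∀ s, (slice j T s).Nonempty → sInf (slice j T s) ≤ sSup (slice j T s) := by
    intro s hs
    exact csInf_le_csSup hs (isCompact_slice j hTc s).bddBelow (isCompact_slice j hTc s).bddAbove
  have hvol : ∀ s, (slice j T s).Nonempty →
      volume (slice j T s) = ENNReal.ofReal (sSup (slice j T s) - sInf (slice j T s)) := by
    intro s hs
    conv_lhs => rw [hI s hs]
    exact Real.volume_Icc
  -- The intermediate slice contains the convex combinations of the two lower ends and of the two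
  -- upper ends, hence the interval between them.
  have hlo := mem_slice_combo hT (hmem s₀ h0).1 (hmem s₁ h1).1 hα hβ hαβ
  have hhi := mem_slice_combo hT (hmem s₀ h0).2 (hmem s₁ h1).2 hα hβ hαβ
  have hsub := (convex_slice j hT _).isPreconnected.Icc_subset hlo hhi
  rw [hvol _ h0, hvol _ h1, ← ENNReal.ofReal_mul hα, ← ENNReal.ofReal_mul hβ,
    ← ENNReal.ofReal_add (mul_nonneg hα (sub_nonneg.2 (hle _ h0)))
      (mul_nonneg hβ (sub_nonneg.2 (hle _ h1)))]
  refine le_trans (le_of_eq ?_) (measure_mono hsub)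
  rw [Real.volume_Icc]
  congr 1
  ring

/-- An element with lattice vertices that meets the interior of a lattice strip crosses it. -/
theorem slice_nonempty_of_strip {N : ℕ} (hN : 0 < N) {P : Finset (Vec 2)}
    (hP : ∀ x ∈ P, ∃ z : Fin 2 → ℤ, x = latticePt N z) {j : Fin 2} {a : ℤ} {s s' : ℝ}
    (hs : s ∈ Ioo (eps N * a) (eps N * (a + 1)))
    (hne : (slice j (convexHull ℝ (P : Set (Vec 2))) s).Nonempty)
    (hs' : s' ∈ Icc (eps N * a) (eps N * (a + 1))) :
    (slice j (convexHull ℝ (P : Set (Vec 2))) s').Nonempty := by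
  have he := eps_pos hN
  obtain ⟨t, ht⟩ := hne
  have hlin : IsLinearMap ℝ fun x : Vec 2 => x j := ⟨fun _ _ => rfl, fun _ _ => rfl⟩
  have hcoord : ∀ x ∈ P, ∃ n : ℤ, x j = eps N * n := by
    intro x hx
    obtain ⟨z, rfl⟩ := hP x hx
    exact ⟨z j, by simp [latticePt, intVec]⟩
  -- Vertex coordinates are integer multiples of `ε`. Without a vertex on or below the lower wall,
  -- all vertices would lie on or above the upper wall, and the element would miss the level `s`.
  obtain ⟨v, hv, hvle⟩ : ∃ v ∈ P, v j ≤ eps N * a := by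
    by_contra! hcon
    have hsub : convexHull ℝ (P : Set (Vec 2)) ⊆ {x : Vec 2 | eps N * (a + 1) ≤ x j} := by
      refine convexHull_min (fun x hx => ?_) (convex_halfSpace_ge hlin _)
      obtain ⟨n, hn⟩ := hcoord x hx
      have h1 := hcon x hx
      rw [hn] at h1
      have h2 : a < n := Int.cast_lt.1 (lt_of_mul_lt_mul_left h1 he.le)
      have h3 : (a : ℝ) + 1 ≤ n := by exact_mod_cast h2
      simp only [mem_ofPred_eq, hn]
      gcongr
    have := hsub ht
    simp only [mem_ofPred_eq, pt_same] at this
    exact absurd hs.2 (not_lt.2 this)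
  obtain ⟨w, hw, hwge⟩ : ∃ w ∈ P, eps N * (a + 1) ≤ w j := by
    by_contra! hcon
    have hsub : convexHull ℝ (P : Set (Vec 2)) ⊆ {x : Vec 2 | x j ≤ eps N * a} := by
      refine convexHull_min (fun x hx => ?_) (convex_halfSpace_le hlin _)
      obtain ⟨n, hn⟩ := hcoord x hx
      have h1 := hcon x hx
      rw [hn] at h1
      have h2 : n < a + 1 := by exact_mod_cast lt_of_mul_lt_mul_left h1 he.le
      have h3 : (n : ℝ) ≤ a := by exact_mod_cast Int.lt_add_one_iff.1 h2
      simp only [mem_ofPred_eq, hn]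
      gcongr
    have := hsub ht
    simp only [mem_ofPred_eq, pt_same] at this
    exact absurd hs.1 (not_lt.2 this)
  have hlt : v j < w j := by
    have := hs.1.trans hs.2
    linarith
  have hcx := convex_convexHull ℝ (P : Set (Vec 2))
  have hv' : v (1 - j) ∈ slice j (convexHull ℝ (P : Set (Vec 2))) (v j) := by
    change pt j (v j) (v (1 - j)) ∈ convexHull ℝ (P : Set (Vec 2))
    rw [pt_eta]
    exact subset_convexHull ℝ _ hv
  have hw' : w (1 - j) ∈ slice j (convexHull ℝ (P : Set (Vec 2))) (w j) := by
    change pt j (w j) (w (1 - j)) ∈ convexHull ℝ (P : Set (Vec 2))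
    rw [pt_eta]
    exact subset_convexHull ℝ _ hw
  have hd : 0 < w j - v j := sub_pos.2 hlt
  -- These weights give the point at level `s'` on the segment between the two vertices on either
  -- side of the strip.
  have h := mem_slice_combo hcx hv' hw' (α := (w j - s') / (w j - v j))
    (β := (s' - v j) / (w j - v j)) (div_nonneg (by linarith [hs'.2]) hd.le)
    (div_nonneg (by linarith [hs'.1]) hd.le) (by field_simp; ring)
  have hss : (w j - s') / (w j - v j) * v j + (s' - v j) / (w j - v j) * w j = s' := by
    field_simp; ring
  rw [hss] at h
  exact ⟨_, h⟩

/-! ### Variations along lattice edges -/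

/-- The variation of `f` over the edge of the `b`-th lattice cell of the line with `j`-th
coordinate `s`, relative to the partition by the point with coordinate `c`, divided by `ε`. -/
noncomputable def lineVar (N : ℕ) (j : Fin 2) (f : Vec 2 → ℝ) (s c : ℝ) (b : ℤ) : ℝ :=
  (|f (pt j s c) - f (pt j s (eps N * b))| + |f (pt j s (eps N * (b + 1))) - f (pt j s c)|) / eps N

/-- The first coordinate of the diagonal of the cell `(a, b)` at the second coordinate `t`. -/
noncomputable def diag (N : ℕ) (flip : Bool) (a b : ℤ) (t : ℝ) : ℝ :=
  if flip = true then eps N * a + (eps N * (b + 1) - t) else eps N * a + (t - eps N * b)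

/-- The function that on each atomistic triangle is the variation of `f` over its edge transversal
to the direction `j`. -/
noncomputable def edgeFun (N : ℕ) (flip : Bool) (j : Fin 2) (f : Vec 2 → ℝ) (c : ℤ → ℤ → ℝ)
    (x : Vec 2) : ℝ :=
  if x j ≤ diag N flip ⌊x j / eps N⌋ ⌊x (1 - j) / eps N⌋ (x (1 - j)) then
    lineVar N j f (eps N * ⌊x j / eps N⌋) (c ⌊x j / eps N⌋ ⌊x (1 - j) / eps N⌋)
      ⌊x (1 - j) / eps N⌋
  else lineVar N j f (eps N * ((⌊x j / eps N⌋ + 1 : ℤ) : ℝ))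
    (c (⌊x j / eps N⌋ + 1) ⌊x (1 - j) / eps N⌋) ⌊x (1 - j) / eps N⌋

theorem lineVar_nonneg {N : ℕ} (hN : 0 < N) (j : Fin 2) (f : Vec 2 → ℝ) (s c : ℝ) (b : ℤ) :
    0 ≤ lineVar N j f s c b := by
  have := eps_pos hN
  unfold lineVar
  positivity

theorem edgeFun_nonneg {N : ℕ} (hN : 0 < N) (flip : Bool) (j : Fin 2) (f : Vec 2 → ℝ)
    (c : ℤ → ℤ → ℝ) (x : Vec 2) : 0 ≤ edgeFun N flip j f c x := by
  unfold edgeFun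
  split_ifs <;> exact lineVar_nonneg hN _ _ _ _ _

theorem floor_div_eps {N : ℕ} (hN : 0 < N) {a : ℤ} {s : ℝ}
    (hs : s ∈ Ico (eps N * a) (eps N * (a + 1))) : ⌊s / eps N⌋ = a := by
  have he := eps_pos hN
  rw [Int.floor_eq_iff, le_div_iff₀ he, div_lt_iff₀ he, mul_comm, mul_comm _ (eps N)]
  exact hs

theorem edgeFun_lo {N : ℕ} (hN : 0 < N) {flip : Bool} {j : Fin 2} {f : Vec 2 → ℝ}
    {c : ℤ → ℤ → ℝ} {a b : ℤ} {s t : ℝ} (hs : s ∈ Ico (eps N * a) (eps N * (a + 1)))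
    (ht : t ∈ Ico (eps N * b) (eps N * (b + 1))) (hst : s ≤ diag N flip a b t) :
    edgeFun N flip j f c (pt j s t) = lineVar N j f (eps N * a) (c a b) b := by
  unfold edgeFun
  rw [pt_same, pt_other, floor_div_eps hN hs, floor_div_eps hN ht, if_pos hst]

theorem edgeFun_hi {N : ℕ} (hN : 0 < N) {flip : Bool} {j : Fin 2} {f : Vec 2 → ℝ}
    {c : ℤ → ℤ → ℝ} {a b : ℤ} {s t : ℝ} (hs : s ∈ Ico (eps N * a) (eps N * (a + 1)))
    (ht : t ∈ Ico (eps N * b) (eps N * (b + 1))) (hst : diag N flip a b t < s) :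
    edgeFun N flip j f c (pt j s t) =
      lineVar N j f (eps N * (a + 1)) (c (a + 1) b) b := by
  unfold edgeFun
  rw [pt_same, pt_other, floor_div_eps hN hs, floor_div_eps hN ht, if_neg (not_le.2 hst)]
  push_cast
  rfl

theorem measurable_edgeFun (N : ℕ) (flip : Bool) (j : Fin 2) (f : Vec 2 → ℝ) (c : ℤ → ℤ → ℝ) :
    Measurable (edgeFun N flip j f c) := by
  have h1 : Measurable fun x : Vec 2 => x j := (by fun_prop : Continuous _).measurable
  have h2 : Measurable fun x : Vec 2 => x (1 - j) := (by fun_prop : Continuous _).measurable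
  have h3 : Measurable fun x : Vec 2 => (⌊x j / eps N⌋, ⌊x (1 - j) / eps N⌋) :=
    (h1.div_const _).floor.prodMk (h2.div_const _).floor
  have hZ : ∀ φ : ℤ × ℤ → ℝ, Measurable fun x : Vec 2 =>
      φ (⌊x j / eps N⌋, ⌊x (1 - j) / eps N⌋) := fun φ => (measurable_of_countable φ).comp h3
  refine Measurable.ite (measurableSet_le h1 ?_) ?_ ?_
  · unfold diag
    split_ifs
    · exact ((hZ fun p => eps N * p.1).add ((hZ fun p => eps N * (p.2 + 1)).sub h2))
    · exact ((hZ fun p => eps N * p.1).add (h2.sub (hZ fun p => eps N * p.2)))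
  · exact hZ fun p => lineVar N j f (eps N * p.1) (c p.1 p.2) p.2
  · exact hZ fun p => lineVar N j f (eps N * ((p.1 + 1 : ℤ) : ℝ)) (c (p.1 + 1) p.2) p.2

theorem continuous_lineVar (N : ℕ) (j : Fin 2) {f : Vec 2 → ℝ} (hf : Continuous f) (c : ℝ)
    (b : ℤ) : Continuous fun s => lineVar N j f s c b := by
  have h : ∀ t, Continuous fun s => f (pt j s t) := fun t =>
    hf.comp ((continuous_pt j).comp (by fun_prop : Continuous fun s : ℝ => (s, t)))
  unfold lineVar
  exact ((((h c).sub (h _)).abs).add (((h _).sub (h c)).abs)).div_const _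

section Strips

variable {N : ℕ} {𝒯 : Set (Set (Vec 2))} {f : Vec 2 → ℝ} {L : Set (Vec 2) → Vec 2 →L[ℝ] ℝ}

/-- On such a line the pieces are the slices of the elements. This makes the one-dimensional bounds
integrable in `s`, the slice lengths adding up to areas. -/
theorem HasGradients.line (h𝒯 : IsConvexCover 𝒯) (hf : HasGradients 𝒯 f L) (j : Fin 2) {s : ℝ}
    (hs : s ∈ Icc (-1 : ℝ) 1) :
    IsPiecewiseAffineOn h𝒯.finite.toFinset (fun T => slice j T s)
      (fun T => L T (basisVec (1 - j))) (fun t => f (pt j s t)) (-1) 1 := by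
  have h := hf.isPiecewiseAffineOn h𝒯 (pt j s 0) (basisVec (1 - j)) (A := -1) (B := 1)
    fun t ht => by
      rw [← pt_eq_add_smul]
      exact pt_mem_OmegaBar.2 ⟨hs, ht⟩
  simp only [← pt_eq_add_smul] at h
  exact h

theorem HasGradients.sum_lineVar_rpow_le (hN : 0 < N) (h𝒯 : IsConvexCover 𝒯)
    (hf : HasGradients 𝒯 f L) (j : Fin 2) {s : ℝ} (hs : s ∈ Icc (-1 : ℝ) 1) (c : ℤ → ℝ)
    (hc : ∀ b : ℤ, c b ∈ Icc (eps N * b) (eps N * (b + 1))) {q : ℝ} (hq : 1 ≤ q) :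
    ∑ b ∈ Finset.Ico (-(N : ℤ)) N, ENNReal.ofReal (eps N) *
        ENNReal.ofReal (lineVar N j f s (c b) b) ^ q ≤
      ∑ T ∈ h𝒯.finite.toFinset, ‖L T (basisVec (1 - j))‖ₑ ^ q * volume (slice j T s) :=
  (hf.line h𝒯 j hs).sum_variation_rpow_le hN hq c hc

/-- The counterpart of `HasGradients.sum_lineVar_rpow_le` for `q = ∞`. It applies on the walls
themselves, as no slice lengths are compared. -/
theorem HasGradients.ofReal_lineVar_le (hN : 0 < N) (h𝒯 : IsConvexCover 𝒯)
    (hf : HasGradients 𝒯 f L) (j : Fin 2) {s : ℝ} (hs : s ∈ Icc (-1 : ℝ) 1) {c : ℝ} {b : ℤ}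
    (hb : b ∈ Finset.Ico (-(N : ℤ)) N)
    (hc : c ∈ Icc (eps N * b) (eps N * (b + 1))) {S : ℝ≥0∞}
    (hS : ∀ T ∈ 𝒯, ‖L T (basisVec (1 - j))‖ₑ ≤ S) :
    ENNReal.ofReal (lineVar N j f s c b) ≤ S := by
  have he := eps_pos hN
  rw [Finset.mem_Ico] at hb
  have h1 := eps_mul_mem_Icc hN hb.1 hb.2.le
  have h2 := eps_mul_mem_Icc hN (by lia : -(N : ℤ) ≤ b + 1) hb.2
  push_cast at h2
  have hm := (hf.line h𝒯 j hs).mono h1.1 h2.2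
  have h3 := hm.ofReal_variation_le hc
  unfold lineVar
  rw [ENNReal.ofReal_div_of_pos he]
  refine ENNReal.div_le_of_le_mul (h3.trans ?_)
  calc _ ≤ ∫⁻ x in Ioc (eps N * b) (eps N * (b + 1)), S := by
        refine lintegral_mono_ae ?_
        filter_upwards [hm.ae_deriv] with x ⟨T, hT, _, hx⟩
        rw [hx]
        exact hS T (by simpa using hT)
    _ = S * ENNReal.ofReal (eps N) := by
        rw [setLIntegral_const, Real.volume_Ioc]
        congr 2
        ring

end Strips

/-! ### Stability of edge variations on coarse meshes. -/

section CoarseMesh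

variable {N : ℕ} {Th : Set (Finset (Vec 2))} {f : Vec 2 → ℝ}
  {L : Set (Vec 2) → Vec 2 →L[ℝ] ℝ}

/-- The weighted lengths of the slices dominate the interpolated edge variations at the two sides
of a lattice strip. -/
theorem IsPeriodicTriangulation.strip_le (hN : 0 < N) (h : IsPeriodicTriangulation N Th)
    (hf : HasGradients (elements Th) f L) (j : Fin 2) {a : ℤ} (ha : a ∈ Finset.Ico (-(N : ℤ)) N)
    {α β : ℝ} (hα : 0 < α) (hβ : 0 < β) (hαβ : α + β = 1) (c : ℤ → ℤ → ℝ)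
    (hc : ∀ a b : ℤ, c a b ∈ Icc (eps N * b) (eps N * (b + 1))) {q : ℝ} (hq : 1 ≤ q) :
    ENNReal.ofReal α * ∑ b ∈ Finset.Ico (-(N : ℤ)) N, ENNReal.ofReal (eps N) *
        ENNReal.ofReal (lineVar N j f (eps N * a) (c a b) b) ^ q +
      ENNReal.ofReal β * ∑ b ∈ Finset.Ico (-(N : ℤ)) N, ENNReal.ofReal (eps N) *
        ENNReal.ofReal (lineVar N j f (eps N * (a + 1)) (c (a + 1) b) b) ^ q ≤
      ∑ T ∈ (h.isConvexCover hN).finite.toFinset, ‖L T (basisVec (1 - j))‖ₑ ^ q *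
        volume (slice j T (α * (eps N * a) + β * (eps N * (a + 1)))) := by
  have he := eps_pos hN
  have h𝒯 := h.isConvexCover hN
  set s := α * (eps N * a) + β * (eps N * (a + 1)) with hs
  have hsα : s = eps N * a + β * eps N := by
    rw [hs, show α = 1 - β by linarith]; ring
  have hβ1 : β < 1 := by linarith
  -- The parameter `δ` moves the two walls towards the level `s`. The estimate is proved for `0 < δ
  -- < 1`, strictly inside the strip, and passed to the limit `δ → 0`. On a wall itself, elements
  -- from the other side may have slices of positive length that are not seen at `s`.
  set G : ℝ → ℤ → ℝ → ℝ≥0∞ := fun δ a' s' => ∑ b ∈ Finset.Ico (-(N : ℤ)) N,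
    ENNReal.ofReal (eps N) *
      ENNReal.ofReal (lineVar N j f (s' + δ * (s - s')) (c a' b) b) ^ q with hG
  have hcont : ∀ a' s', Continuous fun δ => G δ a' s' := by
    intro a' s'
    refine continuous_finsetSum _ fun b _ => ?_
    refine (ENNReal.continuous_const_mul ENNReal.ofReal_ne_top).comp
      (ENNReal.continuous_rpow_const.comp (ENNReal.continuous_ofReal.comp ?_))
    exact (continuous_lineVar N j hf.continuous (c a' b) b).comp (by fun_prop)
  have hC : Continuous fun δ => ENNReal.ofReal α * G δ a (eps N * a) +
      ENNReal.ofReal β * G δ (a + 1) (eps N * (a + 1)) :=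
    ((ENNReal.continuous_const_mul ENNReal.ofReal_ne_top).comp (hcont _ _)).add
      ((ENNReal.continuous_const_mul ENNReal.ofReal_ne_top).comp (hcont _ _))
  have hlim := (hC.tendsto 0).mono_left (nhdsWithin_le_nhds (s := Ioi 0))
  simp only [hG, zero_mul, add_zero] at hlim
  refine le_of_tendsto hlim ?_
  filter_upwards [Ioo_mem_nhdsGT (show (0 : ℝ) < 1 by norm_num)] with δ hδ
  set s₀ := eps N * a + δ * (s - eps N * a) with hs₀
  set s₁ := eps N * (a + 1) + δ * (s - eps N * (a + 1)) with hs₁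
  have hs0 : s₀ ∈ Ioo (eps N * a) (eps N * (a + 1)) := by
    rw [hs₀, hsα]
    have h1 : 0 < δ * (β * eps N) := by have := hδ.1; positivity
    have h2 : δ * β < 1 := by nlinarith [hδ.1, hδ.2]
    constructor <;> nlinarith
  have hs1 : s₁ ∈ Ioo (eps N * a) (eps N * (a + 1)) := by
    have h3 : s₁ = eps N * (a + 1) - δ * (α * eps N) := by
      rw [hs₁, hsα, show α = 1 - β by linarith]; ring
    rw [h3]
    have h1 : 0 < δ * (α * eps N) := by have := hδ.1; positivity
    have h2 : δ * α < 1 := by nlinarith [hδ.1, hδ.2]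
    constructor <;> nlinarith
  -- Both walls move by the same proportion of their distance to `s`, so the weights still combine
  -- them to `s`.
  have hss : α * s₀ + β * s₁ = s := by
    rw [hs₀, hs₁]
    linear_combination (1 - δ) * (-hs) + δ * s * hαβ
  rw [Finset.mem_Ico] at ha
  have hrange : ∀ s' ∈ Ioo (eps N * a) (eps N * (a + 1)), s' ∈ Icc (-1 : ℝ) 1 := by
    intro s' hs'
    have h1 := eps_mul_mem_Icc hN ha.1 ha.2.le
    have h2 := eps_mul_mem_Icc hN (by lia : -(N : ℤ) ≤ a + 1) ha.2
    push_cast at h2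
    exact ⟨h1.1.trans hs'.1.le, hs'.2.le.trans h2.2⟩
  have hr0 := hf.sum_lineVar_rpow_le hN h𝒯 j (hrange _ hs0) (c a) (hc a) hq
  have hr1 := hf.sum_lineVar_rpow_le hN h𝒯 j (hrange _ hs1) (c (a + 1)) (hc (a + 1)) hq
  refine (add_le_add (mul_le_mul_right hr0 (ENNReal.ofReal α))
    (mul_le_mul_right hr1 (ENNReal.ofReal β))).trans ?_
  rw [Finset.mul_sum, Finset.mul_sum, ← Finset.sum_add_distrib]
  refine Finset.sum_le_sum fun T hT => ?_
  have hT' : T ∈ elements Th := by simpa using hT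
  have hcv := h𝒯.convex T hT'
  have hcp := h𝒯.compact T hT'
  obtain ⟨P, hP, rfl⟩ := hT'
  -- An element crosses both levels or neither, which is what concavity of the slice lengths
  -- requires.
  by_cases hne : (slice j (convexHull ℝ (P : Set (Vec 2))) s₀).Nonempty
  · have hne1 := slice_nonempty_of_strip hN (h.vertices_mem P hP) hs0 hne
      (Ioo_subset_Icc_self hs1)
    have hv := volume_slice_concave hcv hcp hne hne1 hα.le hβ.le hαβ
    rw [hss] at hv
    calc _ = ‖L (convexHull ℝ (P : Set (Vec 2))) (basisVec (1 - j))‖ₑ ^ q *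
          (ENNReal.ofReal α * volume (slice j (convexHull ℝ (P : Set (Vec 2))) s₀) +
            ENNReal.ofReal β * volume (slice j (convexHull ℝ (P : Set (Vec 2))) s₁)) := by ring
      _ ≤ _ := by gcongr
  · have hne1 : ¬ (slice j (convexHull ℝ (P : Set (Vec 2))) s₁).Nonempty := fun h1 =>
      hne (slice_nonempty_of_strip hN (h.vertices_mem P hP) hs1 h1 (Ioo_subset_Icc_self hs0))
    rw [not_nonempty_iff_eq_empty] at hne hne1
    simp [hne, hne1]

/-- Slices of the atomistic triangles of one cell. -/
theorem lintegral_cell_edgeFun (hN : 0 < N) (flip : Bool) (j : Fin 2) (f : Vec 2 → ℝ)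
    (c : ℤ → ℤ → ℝ) (a b : ℤ) {α β : ℝ} (hα : 0 < α) (hβ : 0 < β) (hαβ : α + β = 1) (q : ℝ) :
    ∫⁻ t in Ioc (eps N * b) (eps N * (b + 1)),
        ENNReal.ofReal (edgeFun N flip j f c
          (pt j (α * (eps N * a) + β * (eps N * (a + 1))) t)) ^ q =
      ENNReal.ofReal α * (ENNReal.ofReal (eps N) *
          ENNReal.ofReal (lineVar N j f (eps N * a) (c a b) b) ^ q) +
        ENNReal.ofReal β * (ENNReal.ofReal (eps N) *
          ENNReal.ofReal (lineVar N j f (eps N * (a + 1)) (c (a + 1) b) b) ^ q) := by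
  have he := eps_pos hN
  have hβ1 : β < 1 := by linarith
  set s := α * (eps N * a) + β * (eps N * (a + 1)) with hs
  have hsα : s = eps N * a + β * eps N := by
    rw [hs, show α = 1 - β by linarith]; ring
  have hsI : s ∈ Ico (eps N * a) (eps N * (a + 1)) := by
    rw [hsα]
    constructor <;> nlinarith
  rw [← restrict_Ioo_eq_restrict_Ioc]
  set X := ENNReal.ofReal (lineVar N j f (eps N * a) (c a b) b) ^ q
  set Y := ENNReal.ofReal (lineVar N j f (eps N * (a + 1)) (c (a + 1) b) b) ^ q
  have hbe : eps N * (b + 1) = eps N * b + eps N := by ring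
  -- `P` and `Q` are the parts of the segment in the lower and the upper triangle. By similarity
  -- their lengths are `α ε` and `β ε` for either diagonal; only their order along the segment
  -- depends on `flip`.
  have key : ∀ (P Q : Set ℝ), MeasurableSet P → MeasurableSet Q → Disjoint P Q →
      P ∪ Q = Ioo (eps N * (b : ℝ)) (eps N * (b + 1)) →
      (∀ t ∈ P, s ≤ diag N flip a b t) → (∀ t ∈ Q, diag N flip a b t < s) →
      volume P = ENNReal.ofReal (α * eps N) → volume Q = ENNReal.ofReal (β * eps N) →
      ∫⁻ t in Ioo (eps N * (b : ℝ)) (eps N * (b + 1)),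
        ENNReal.ofReal (edgeFun N flip j f c (pt j s t)) ^ q =
      ENNReal.ofReal α * (ENNReal.ofReal (eps N) * X) +
        ENNReal.ofReal β * (ENNReal.ofReal (eps N) * Y) := by
    intro P Q hP hQ hd hPQ hlo hhi hvP hvQ
    have hPs : P ⊆ Ico (eps N * (b : ℝ)) (eps N * (b + 1)) :=
      (subset_union_left.trans hPQ.le).trans Ioo_subset_Ico_self
    have hQs : Q ⊆ Ico (eps N * (b : ℝ)) (eps N * (b + 1)) :=
      (subset_union_right.trans hPQ.le).trans Ioo_subset_Ico_self
    rw [← hPQ, lintegral_union hQ hd]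
    congr 1
    · rw [setLIntegral_congr_fun hP (g := fun _ => X) fun t ht => by
        rw [edgeFun_lo hN hsI (hPs ht) (hlo t ht)], setLIntegral_const, hvP,
        ENNReal.ofReal_mul hα.le]
      ring
    · rw [setLIntegral_congr_fun hQ (g := fun _ => Y) fun t ht => by
        rw [edgeFun_hi hN hsI (hQs ht) (hhi t ht)], setLIntegral_const, hvQ,
        ENNReal.ofReal_mul hβ.le]
      ring
  have hαe : α * eps N = eps N - β * eps N := by rw [show α = 1 - β by linarith]; ring
  have hβe : 0 < β * eps N := by positivity
  have hαe0 : 0 < α * eps N := by positivity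
  cases flip
  · refine key (Ico (eps N * b + β * eps N) (eps N * (b + 1)))
      (Ioo (eps N * b) (eps N * b + β * eps N)) measurableSet_Ico measurableSet_Ioo ?_ ?_ ?_ ?_ ?_ ?_
    · exact (disjoint_left.2 fun t ht ht' => absurd ht'.2 (not_lt.2 ht.1))
    · rw [union_comm]
      exact Ioo_union_Ico_eq_Ioo (by linarith) (by linarith)
    · intro t ht
      have := ht.1
      simp only [diag, Bool.false_eq_true, if_false]
      linarith
    · intro t ht
      have := ht.2
      simp only [diag, Bool.false_eq_true, if_false]
      linarith
    · rw [Real.volume_Ico]; congr 1; linarith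
    · rw [Real.volume_Ioo]; congr 1; ring
  · refine key (Ioc (eps N * b) (eps N * b + α * eps N))
      (Ioo (eps N * b + α * eps N) (eps N * (b + 1))) measurableSet_Ioc measurableSet_Ioo ?_ ?_ ?_ ?_ ?_ ?_
    · exact (disjoint_left.2 fun t ht ht' => absurd ht'.1 (not_lt.2 ht.2))
    · exact Ioc_union_Ioo_eq_Ioo (by linarith) (by linarith)
    · intro t ht
      have := ht.2
      simp only [diag, if_true]
      linarith
    · intro t ht
      have := ht.1
      simp only [diag, if_true]
      linarith
    · rw [Real.volume_Ioc]; congr 1; ring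
    · rw [Real.volume_Ioo]; congr 1; linarith

theorem ae_mem_strip (hN : 0 < N) : ∀ᵐ s ∂(volume.restrict (Ioc (-1 : ℝ) 1)),
    ∃ a ∈ Finset.Ico (-(N : ℤ)) N, s ∈ Ioo (eps N * a) (eps N * (a + 1)) := by
  have he := eps_pos hN
  have h0 : ∀ᵐ s : ℝ, s ∉ range fun a : ℤ => eps N * (a : ℝ) :=
    (countable_range _).ae_notMem volume
  rw [ae_restrict_iff' measurableSet_Ioc]
  filter_upwards [h0] with s hs hs1
  have h1 := Int.floor_le (s / eps N)
  have h2 := Int.lt_floor_add_one (s / eps N)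
  rw [le_div_iff₀ he, mul_comm] at h1
  rw [div_lt_iff₀ he, mul_comm] at h2
  have h3 : eps N * (⌊s / eps N⌋ : ℝ) < s := lt_of_le_of_ne h1 fun h => hs ⟨_, h⟩
  refine ⟨⌊s / eps N⌋, ?_, h3, h2⟩
  have hN1 := eps_mul hN
  rw [Finset.mem_Ico]
  constructor
  · have h4 : -(N : ℝ) < (⌊s / eps N⌋ : ℝ) + 1 := by
      by_contra! hcon
      have := mul_le_mul_of_nonneg_left hcon he.le
      linarith [hs1.1]
    have h5 : -(N : ℤ) < ⌊s / eps N⌋ + 1 := by exact_mod_cast h4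
    lia
  · have h4 : (⌊s / eps N⌋ : ℝ) < N := by
      by_contra! hcon
      have := mul_le_mul_of_nonneg_left hcon he.le
      linarith [hs1.2]
    exact_mod_cast h4

theorem Ioc_eq_iUnion_cells (hN : 0 < N) : Ioc (-1 : ℝ) 1 =
    ⋃ b ∈ Finset.Ico (-(N : ℤ)) N, Ioc (eps N * (b : ℝ)) (eps N * (b + 1)) := by
  have he := eps_pos hN
  have hN1 := eps_mul hN
  ext t
  simp only [mem_iUnion, exists_prop, Finset.mem_Ico]
  constructor
  · intro ht
    have h1 := Int.le_ceil (t / eps N)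
    have h2 := Int.ceil_lt_add_one (t / eps N)
    have h1' : t ≤ eps N * (⌈t / eps N⌉ : ℝ) := by rwa [div_le_iff₀ he, mul_comm] at h1
    have h2' : eps N * ((⌈t / eps N⌉ : ℝ) - 1) < t := by
      have : (⌈t / eps N⌉ : ℝ) - 1 < t / eps N := by linarith
      rwa [lt_div_iff₀ he, mul_comm] at this
    refine ⟨⌈t / eps N⌉ - 1, ⟨?_, ?_⟩, ?_⟩
    · have : -(N : ℝ) < (⌈t / eps N⌉ : ℝ) := by
        by_contra! hcon
        have := mul_le_mul_of_nonneg_left hcon he.le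
        linarith [ht.1]
      have h5 : -(N : ℤ) < ⌈t / eps N⌉ := by exact_mod_cast this
      lia
    · have : (⌈t / eps N⌉ : ℝ) - 1 < N := by
        by_contra! hcon
        have := mul_le_mul_of_nonneg_left hcon he.le
        linarith [ht.2]
      exact_mod_cast this
    · push_cast
      exact ⟨h2', by simpa using h1'⟩
  · rintro ⟨b, hb, hbt⟩
    have h1 := eps_mul_mem_Icc hN hb.1 hb.2.le
    have h2 := eps_mul_mem_Icc hN (by lia : -(N : ℤ) ≤ b + 1) hb.2
    push_cast at h2
    exact ⟨h1.1.trans_lt hbt.1, hbt.2.trans h2.2⟩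

theorem pairwiseDisjoint_cells (hN : 0 < N) (S : Set ℤ) :
    S.PairwiseDisjoint fun b : ℤ => Ioc (eps N * (b : ℝ)) (eps N * (b + 1)) := by
  have he := eps_pos hN
  intro i _ j _ hij
  rcases lt_or_gt_of_ne hij with hlt | hlt
  · refine Ioc_disjoint_Ioc_of_le ?_
    have : (i : ℝ) + 1 ≤ j := by exact_mod_cast hlt
    gcongr
  · refine (Ioc_disjoint_Ioc_of_le ?_).symm
    have : (j : ℝ) + 1 ≤ i := by exact_mod_cast hlt
    gcongr

/-- The transversal edge variations are bounded in `L^q` by the derivative. -/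
theorem IsPeriodicTriangulation.eLpNorm_edgeFun_le (hN : 0 < N) (h : IsPeriodicTriangulation N Th)
    (hf : HasGradients (elements Th) f L) (flip : Bool) (j : Fin 2) (c : ℤ → ℤ → ℝ)
    (hc : ∀ a b : ℤ, c a b ∈ Icc (eps N * b) (eps N * (b + 1))) {q : ℝ≥0∞} (hq : 1 ≤ q) :
    eLpNorm (edgeFun N flip j f c) q (volume.restrict (Omega 2)) ≤
      eLpNorm (fun x => fderiv ℝ f x (basisVec (1 - j))) q (volume.restrict (Omega 2)) := by
  have he := eps_pos hN
  have h𝒯 := h.isConvexCover hN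
  have hmeas := measurable_edgeFun N flip j f c
  by_cases hqt : q = ∞
  · subst hqt
    set S := eLpNorm (fun x => fderiv ℝ f x (basisVec (1 - j))) ∞ (volume.restrict (Omega 2))
    have hS : ∀ T ∈ elements Th, ‖L T (basisVec (1 - j))‖ₑ ≤ S := fun T hT =>
      enorm_gradient_le_eLpNorm_top hT (h.subset_OmegaBar hT) (h.interior_nonempty hT) hf _
    rw [eLpNorm_exponent_top]
    refine eLpNormEssSup_le_of_ae_enorm_bound ?_
    -- By Fubini the exceptional set is null, since on almost every line almost every point lies
    -- inside a cell and obeys the pointwise edge bound.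
    have hae : ∀ᵐ x ∂(volume.restrict (Omega 2)), ¬ (S < ‖edgeFun N flip j f c x‖ₑ) := by
      have hF : Measurable fun x => ({x | S < ‖edgeFun N flip j f c x‖ₑ} : Set (Vec 2)).indicator
          (fun _ => (1 : ℝ≥0∞)) x :=
        measurable_one.indicator (measurableSet_lt measurable_const hmeas.enorm)
      have h0 : ∫⁻ x in Omega 2, ({x | S < ‖edgeFun N flip j f c x‖ₑ} : Set (Vec 2)).indicator
          (fun _ => (1 : ℝ≥0∞)) x = 0 := by
        rw [lintegral_Omega_eq_pt j hF]
        refine (lintegral_congr_ae (g := fun _ => 0) ?_).trans lintegral_zero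
        filter_upwards [ae_mem_strip hN] with s ⟨a, ha, hs⟩
        refine (lintegral_congr_ae (g := fun _ => 0) ?_).trans lintegral_zero
        filter_upwards [ae_mem_strip hN] with t ⟨b, hb, ht⟩
        refine indicator_of_notMem ?_ _
        simp only [mem_ofPred_eq, not_lt]
        rw [Real.enorm_of_nonneg (edgeFun_nonneg hN _ _ _ _ _)]
        have ha' := Finset.mem_Ico.1 ha
        rcases le_or_gt s (diag N flip a b t) with hd | hd
        · rw [edgeFun_lo hN (Ioo_subset_Ico_self hs) (Ioo_subset_Ico_self ht) hd]
          exact hf.ofReal_lineVar_le hN h𝒯 j (eps_mul_mem_Icc hN ha'.1 ha'.2.le) hb (hc _ _) hS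
        · rw [edgeFun_hi hN (Ioo_subset_Ico_self hs) (Ioo_subset_Ico_self ht) hd]
          have := eps_mul_mem_Icc hN (by lia : -(N : ℤ) ≤ a + 1) ha'.2
          push_cast at this
          exact hf.ofReal_lineVar_le hN h𝒯 j this hb (hc _ _) hS
      rw [lintegral_eq_zero_iff hF] at h0
      filter_upwards [h0] with x hx hcon
      rw [indicator_of_mem (by exact hcon)] at hx
      simp at hx
    filter_upwards [hae] with x hx using not_lt.1 hx
  · have hq0 : q ≠ 0 := (one_pos.trans_le hq).ne'
    have hqr : 1 ≤ q.toReal := by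
      rw [← ENNReal.toReal_one]
      exact ENNReal.toReal_mono hqt hq
    rw [eLpNorm_eq_lintegral_rpow_enorm_toReal hq0 hqt, eLpNorm_eq_lintegral_rpow_enorm_toReal hq0
      hqt]
    refine ENNReal.rpow_le_rpow ?_ (by positivity)
    refine le_trans ?_ (sum_gradient_rpow_le h𝒯 (fun T hT => h.subset_OmegaBar hT)
      h.pairwise_aedisjoint hf _ _)
    rw [lintegral_Omega_eq_pt j (hmeas.enorm.pow_const _)]
    calc _ ≤ ∫⁻ s in Ioc (-1 : ℝ) 1, ∑ T ∈ h𝒯.finite.toFinset,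
          ‖L T (basisVec (1 - j))‖ₑ ^ q.toReal * volume (slice j T s) := by
          refine lintegral_mono_ae ?_
          filter_upwards [ae_mem_strip hN] with s ⟨a, ha, hs⟩
          -- The weight `β` is the relative position of `s` in its strip, so the combination of the
          -- two walls is `s`.
          have hβ : 0 < (s - eps N * a) / eps N := div_pos (sub_pos.2 hs.1) he
          have hα : 0 < 1 - (s - eps N * a) / eps N := by
            rw [sub_pos, div_lt_one he]
            linarith [hs.2]
          have hαβ : 1 - (s - eps N * a) / eps N + (s - eps N * a) / eps N = 1 := by ring
          have hss : (1 - (s - eps N * a) / eps N) * (eps N * a) +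
              (s - eps N * a) / eps N * (eps N * (a + 1)) = s := by field_simp; ring
          have h1 := h.strip_le hN hf j ha hα hβ hαβ c hc hqr
          rw [hss] at h1
          refine le_trans (le_of_eq ?_) h1
          rw [Ioc_eq_iUnion_cells hN, lintegral_biUnion_finset (pairwiseDisjoint_cells hN _)
            fun _ _ => measurableSet_Ioc, Finset.mul_sum, Finset.mul_sum, ← Finset.sum_add_distrib]
          refine Finset.sum_congr rfl fun b _ => ?_
          rw [← lintegral_cell_edgeFun hN flip j f c a b hα hβ hαβ, hss]
          simp_rw [Real.enorm_of_nonneg (edgeFun_nonneg hN _ _ _ _ _)]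
      _ ≤ ∫⁻ s, ∑ T ∈ h𝒯.finite.toFinset,
          ‖L T (basisVec (1 - j))‖ₑ ^ q.toReal * volume (slice j T s) :=
          setLIntegral_le_lintegral _ _
      _ = _ := by
          have hsm : ∀ T ∈ h𝒯.finite.toFinset, Measurable fun s => volume (slice j T s) := by
            intro T hT
            have hTm := (h𝒯.compact T (by simpa using hT)).isClosed.measurableSet
            exact measurable_measure_prodMk_left ((ptEquiv j).measurable hTm)
          rw [lintegral_finsetSum' _ fun T hT => ((hsm T hT).const_mul _).aemeasurable]
          refine Finset.sum_congr rfl fun T hT => ?_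
          rw [lintegral_const_mul _ (hsm T hT), ← volume_eq_lintegral_slice]
          exact (h𝒯.compact T (by simpa using hT)).isClosed.measurableSet

end CoarseMesh

/-! ### The atomistic mesh -/

section AtomisticMesh

variable {d N : ℕ} {flip : Bool}

theorem mem_atomElement {z : Fin d → ℤ} {π : Equiv.Perm (Fin d)} {x : Vec d} :
    x ∈ atomElement N flip z π ↔
      (∀ i, 0 ≤ x i / eps N - z i ∧ x i / eps N - z i ≤ 1) ∧
        Antitone fun j => cellCoord flip (fun i => x i / eps N - z i) (π j) := Iff.rfl

/-- The interior of an atomistic element. -/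
def atomInterior (N : ℕ) (flip : Bool) (z : Fin d → ℤ) (π : Equiv.Perm (Fin d)) : Set (Vec d) :=
  {x | (∀ i, 0 < x i / eps N - z i ∧ x i / eps N - z i < 1) ∧
    StrictAnti fun j => cellCoord flip (fun i => x i / eps N - z i) (π j)}

theorem cellCoord_combo (flip : Bool) (z : Fin d → ℤ) (x y : Vec d) {α β : ℝ} (h : α + β = 1)
    (i : Fin d) : cellCoord flip (fun i => (α • x + β • y) i / eps N - z i) i =
      α * cellCoord flip (fun i => x i / eps N - z i) i +
        β * cellCoord flip (fun i => y i / eps N - z i) i := by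
  simp only [cellCoord, PiLp.add_apply, PiLp.smul_apply, smul_eq_mul]
  obtain rfl : α = 1 - β := by linarith
  split_ifs <;> ring

theorem continuous_cellCoord (N : ℕ) (flip : Bool) (z : Fin d → ℤ) (i : Fin d) :
    Continuous fun x : Vec d => cellCoord flip (fun i => x i / eps N - z i) i := by
  unfold cellCoord
  split_ifs <;> fun_prop

theorem convex_atomElement (z : Fin d → ℤ) (π : Equiv.Perm (Fin d)) :
    Convex ℝ (atomElement N flip z π) := by
  intro x hx y hy α β hα hβ h
  refine ⟨fun i => ?_, fun i j hij => ?_⟩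
  · have h1 := hx.1 i
    have h2 := hy.1 i
    have h3 : (α • x + β • y) i / eps N - z i =
        α * (x i / eps N - z i) + β * (y i / eps N - z i) := by
      simp only [PiLp.add_apply, PiLp.smul_apply, smul_eq_mul]
      obtain rfl : α = 1 - β := by linarith
      ring
    rw [h3]
    constructor <;> nlinarith
  · have h1 := hx.2 hij
    have h2 := hy.2 hij
    simp only [cellCoord_combo flip z x y h]
    exact add_le_add (mul_le_mul_of_nonneg_left h1 hα) (mul_le_mul_of_nonneg_left h2 hβ)

theorem isClosed_atomElement (z : Fin d → ℤ) (π : Equiv.Perm (Fin d)) :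
    IsClosed (atomElement N flip z π) := by
  refine IsClosed.and ?_ ?_
  · simp only [Set.ofPred_forall]
    refine isClosed_iInter fun i => IsClosed.and ?_ ?_
    · exact isClosed_le (f := fun _ : Vec d => (0 : ℝ)) (g := fun x => x i / eps N - z i)
        (by fun_prop) (by fun_prop)
    · exact isClosed_le (f := fun x : Vec d => x i / eps N - z i) (g := fun _ => (1 : ℝ))
        (by fun_prop) (by fun_prop)
  · exact isClosed_antitone.preimage (continuous_pi fun j => continuous_cellCoord N flip z (π j))

theorem isOpen_atomInterior (z : Fin d → ℤ) (π : Equiv.Perm (Fin d)) :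
    IsOpen (atomInterior N flip z π) := by
  refine IsOpen.and ?_ ?_
  · simp only [Set.ofPred_forall]
    refine isOpen_iInter_of_finite fun i => IsOpen.and ?_ ?_
    · exact isOpen_lt (f := fun _ : Vec d => (0 : ℝ)) (g := fun x => x i / eps N - z i)
        (by fun_prop) (by fun_prop)
    · exact isOpen_lt (f := fun x : Vec d => x i / eps N - z i) (g := fun _ => (1 : ℝ))
        (by fun_prop) (by fun_prop)
  · simp only [StrictAnti, Set.ofPred_forall]
    refine isOpen_iInter_of_finite fun i => isOpen_iInter_of_finite fun j =>
      isOpen_iInter_of_finite fun hij => ?_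
    exact isOpen_lt (continuous_cellCoord N flip z _) (continuous_cellCoord N flip z _)

theorem atomInterior_subset (z : Fin d → ℤ) (π : Equiv.Perm (Fin d)) :
    atomInterior N flip z π ⊆ atomElement N flip z π := fun _ hx =>
  ⟨fun i => ⟨(hx.1 i).1.le, (hx.1 i).2.le⟩, hx.2.antitone⟩

theorem atomInterior_subset_interior (z : Fin d → ℤ) (π : Equiv.Perm (Fin d)) :
    atomInterior N flip z π ⊆ interior (atomElement N flip z π) :=
  interior_maximal (atomInterior_subset z π) (isOpen_atomInterior z π)

theorem atomInterior_nonempty (hN : 0 < N) (z : Fin d → ℤ) (π : Equiv.Perm (Fin d)) :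
    (atomInterior N flip z π).Nonempty := by
  have he := (eps_pos hN).ne'
  -- Strictly decreasing values in `(0, 1)`, to be distributed over the coordinates in the order
  -- prescribed by `π`.
  set γ : Fin d → ℝ := fun j => (d - (j : ℕ)) / (d + 1) with hγ
  have hγ01 : ∀ j, 0 < γ j ∧ γ j < 1 := by
    intro j
    have h1 : ((j : ℕ) : ℝ) < d := by exact_mod_cast j.2
    have h2 : (0 : ℝ) ≤ (j : ℕ) := by positivity
    simp only [hγ]
    constructor
    · exact div_pos (by linarith) (by linarith)
    · rw [div_lt_one (by linarith)]; linarith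
  -- Reflection of a coordinate is an involution, so `cellCoord` applied to `t` returns the
  -- prescribed values.
  set t : Fin d → ℝ := cellCoord flip (fun i => γ (π⁻¹ i)) with ht
  set x : Vec d := WithLp.toLp 2 fun i => eps N * (z i + t i) with hx
  have hxt : (fun i => x i / eps N - z i) = t := by
    funext i
    simp only [hx]
    field_simp
    ring
  have hct : ∀ i, cellCoord flip t i = γ (π⁻¹ i) := by
    intro i
    simp only [ht, cellCoord]
    split_ifs <;> ring
  refine ⟨x, fun i => ?_, fun i j hij => ?_⟩
  · have h1 := congrFun hxt i
    simp only at h1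
    rw [h1]
    have h2 := hγ01 (π⁻¹ i)
    simp only [ht, cellCoord]
    split_ifs
    · constructor <;> linarith [h2.1, h2.2]
    · exact h2
  · simp only
    rw [hxt, hct, hct]
    have hinv : ∀ k, π⁻¹ (π k) = k := fun k => by simp
    simp only [hinv, hγ]
    have : ((i : ℕ) : ℝ) < (j : ℕ) := by exact_mod_cast hij
    gcongr

theorem atomElement_subset_closure (hN : 0 < N) (z : Fin d → ℤ) (π : Equiv.Perm (Fin d)) :
    atomElement N flip z π ⊆ closure (atomInterior N flip z π) := by
  intro x hx
  obtain ⟨y, hy⟩ := atomInterior_nonempty (flip := flip) hN z π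
  have hc : Continuous fun θ : ℝ => (1 - θ) • x + θ • y := by fun_prop
  have hlim := (hc.tendsto 0).mono_left (nhdsWithin_le_nhds (s := Ioi 0))
  simp only [sub_zero, one_smul, zero_smul, add_zero] at hlim
  refine mem_closure_of_tendsto hlim ?_
  filter_upwards [Ioo_mem_nhdsGT (show (0 : ℝ) < 1 by norm_num)] with θ hθ
  have hθ1 : 0 < 1 - θ := sub_pos.2 hθ.2
  have hsum : 1 - θ + θ = 1 := by ring
  refine ⟨fun i => ?_, fun i j hij => ?_⟩
  · have h1 := hx.1 i
    have h2 := hy.1 i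
    have h3 : ((1 - θ) • x + θ • y) i / eps N - z i =
        (1 - θ) * (x i / eps N - z i) + θ * (y i / eps N - z i) := by
      simp only [PiLp.add_apply, PiLp.smul_apply, smul_eq_mul]
      ring
    rw [h3]
    have h4 := mul_pos hθ.1 h2.1
    have h5 := mul_pos hθ.1 (sub_pos.2 h2.2)
    have h6 := mul_nonneg hθ1.le h1.1
    have h7 := mul_nonneg hθ1.le (sub_nonneg.2 h1.2)
    constructor <;> nlinarith
  · have h1 := hx.2 hij.le
    have h2 := hy.2 hij
    simp only [cellCoord_combo flip z x y hsum]
    exact add_lt_add_of_le_of_lt (mul_le_mul_of_nonneg_left h1 hθ1.le)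
      (mul_lt_mul_of_pos_left h2 hθ.1)

/-- Strict inequalities in the cell coordinates determine the cell, and the strict order of the
reflected coordinates determines the permutation. -/
theorem atomElement_unique {z z' : Fin d → ℤ} {π π' : Equiv.Perm (Fin d)} {x : Vec d}
    (hx : x ∈ atomInterior N flip z π) (hx' : x ∈ atomElement N flip z' π') :
    z = z' ∧ π = π' := by
  have hz : z = z' := by
    funext i
    have h1 := hx.1 i
    have h2 := hx'.1 i
    have h3 : (z i : ℝ) < z' i + 1 := by linarith [h1.1, h2.2]
    have h4 : (z' i : ℝ) < z i + 1 := by linarith [h1.2, h2.1]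
    have h5 : z i < z' i + 1 := by exact_mod_cast h3
    have h6 : z' i < z i + 1 := by exact_mod_cast h4
    lia
  subst hz
  refine ⟨rfl, ?_⟩
  have h1 := hx.2
  have h2 := hx'.2
  set g := cellCoord flip (fun i => x i / eps N - z i)
  have hg : Function.Injective g := by
    have h3 := h1.injective
    intro i j hij
    have := @h3 (π⁻¹ i) (π⁻¹ j) (by simpa using hij)
    simpa using this
  have h2' : StrictAnti fun j => g (π' j) :=
    h2.strictAnti_of_injective (hg.comp π'.injective)
  -- Two strictly monotone enumerations of the same range coincide; the dual order makes decreasing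
  -- enumerations increasing.
  have heq : (fun j => OrderDual.toDual (g (π j))) = fun j => OrderDual.toDual (g (π' j)) := by
    refine (StrictMono.range_inj (β := Fin d) (γ := ℝᵒᵈ) h1 h2').1 ?_
    ext r
    constructor
    · rintro ⟨j, rfl⟩
      exact ⟨π'.symm (π j), congrArg g (π'.apply_symm_apply _)⟩
    · rintro ⟨j, rfl⟩
      exact ⟨π.symm (π' j), congrArg g (π.apply_symm_apply _)⟩
  ext j
  exact congrArg _ (hg (OrderDual.toDual.injective (congrFun heq j)))

theorem shift_atomElement (hN : 0 < N) (ξ z : Fin d → ℤ) (π : Equiv.Perm (Fin d)) :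
    shift ξ (atomElement N flip z π) = atomElement N flip (z + (2 * (N : ℤ)) • ξ) π := by
  have hco : ∀ (x : Vec d) i, ((2 : ℝ) • intVec ξ + x) i / eps N -
      (z + (2 * (N : ℤ)) • ξ) i = x i / eps N - z i := by
    intro x i
    have hN' : (N : ℝ) ≠ 0 := by positivity
    simp [intVec, eps]
    ring
  have hmem : ∀ x : Vec d, (2 : ℝ) • intVec ξ + x ∈ atomElement N flip (z + (2 * (N : ℤ)) • ξ) π ↔
      x ∈ atomElement N flip z π := by
    intro x
    simp only [mem_atomElement, hco]
  ext x
  constructor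
  · rintro ⟨x, hx, rfl⟩
    exact (hmem x).2 hx
  · intro hx
    refine ⟨x - (2 : ℝ) • intVec ξ, (hmem _).1 (by simpa using hx), by simp⟩

theorem mem_atomElement_Icc (hN : 0 < N) {z : Fin d → ℤ} {π : Equiv.Perm (Fin d)} {x : Vec d}
    (hx : x ∈ atomElement N flip z π) (i : Fin d) :
    x i ∈ Icc (eps N * z i) (eps N * (z i + 1)) := by
  have he := eps_pos hN
  obtain ⟨h1, h2⟩ := hx.1 i
  rw [sub_nonneg, le_div_iff₀ he] at h1
  rw [sub_le_iff_le_add, div_le_iff₀ he] at h2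
  constructor <;> linarith

/-- The cells of the atomistic mesh in `[-1, 1]^d`. -/
noncomputable def cells (d N : ℕ) : Finset (Fin d → ℤ) :=
  Fintype.piFinset fun _ => Finset.Ico (-(N : ℤ)) N

theorem atomElement_subset_OmegaBar_iff (hN : 0 < N) {z : Fin d → ℤ} {π : Equiv.Perm (Fin d)} :
    atomElement N flip z π ⊆ OmegaBar d ↔ z ∈ cells d N := by
  have he := eps_pos hN
  have hN1 := eps_mul hN
  rw [cells, Fintype.mem_piFinset]
  constructor
  · intro h i
    obtain ⟨x, hx⟩ := atomInterior_nonempty (flip := flip) hN z π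
    obtain ⟨h1, h2⟩ := hx.1 i
    rw [sub_pos, lt_div_iff₀ he] at h1
    rw [sub_lt_iff_lt_add, div_lt_iff₀ he] at h2
    obtain ⟨h3, h4⟩ := h (atomInterior_subset z π hx) i
    rw [Finset.mem_Ico]
    constructor
    · have : -(N : ℝ) < z i + 1 := by
        by_contra! hcon
        have := mul_le_mul_of_nonneg_left hcon he.le
        linarith
      have h5 : -(N : ℤ) < z i + 1 := by exact_mod_cast this
      lia
    · have : (z i : ℝ) < N := by
        by_contra! hcon
        have := mul_le_mul_of_nonneg_left hcon he.le
        linarith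
      exact_mod_cast this
  · intro h x hx i
    obtain ⟨h1, h2⟩ := Finset.mem_Ico.1 (h i)
    have h3 := mem_atomElement_Icc hN hx i
    have h4 := eps_mul_mem_Icc hN h1 h2.le
    have h5 := eps_mul_mem_Icc hN (by lia : -(N : ℤ) ≤ z i + 1) h2
    push_cast at h5
    exact ⟨h4.1.trans h3.1, h3.2.trans h5.2⟩

theorem atomElement_mem_atomMesh (hN : 0 < N) {z : Fin d → ℤ} {π : Equiv.Perm (Fin d)}
    (hz : z ∈ cells d N) : atomElement N flip z π ∈ atomMesh d N flip :=
  ⟨⟨z, π, rfl⟩, (atomElement_subset_OmegaBar_iff hN).2 hz⟩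

theorem exists_mem_cells {T : Set (Vec d)} (hN : 0 < N) (hT : T ∈ atomMesh d N flip) :
    ∃ z ∈ cells d N, ∃ π, T = atomElement N flip z π := by
  obtain ⟨⟨z, π, rfl⟩, h⟩ := hT
  exact ⟨z, (atomElement_subset_OmegaBar_iff hN).1 h, π, rfl⟩

theorem isConvexCover_atomMesh (hN : 0 < N) : IsConvexCover (atomMesh d N flip) where
  finite := by
    refine ((cells d N ×ˢ (Finset.univ : Finset (Equiv.Perm (Fin d)))).image
      fun p => atomElement N flip p.1 p.2).finite_toSet.subset fun T hT => ?_
    obtain ⟨z, hz, π, rfl⟩ := exists_mem_cells hN hT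
    exact Finset.mem_image.2 ⟨(z, π), by simp [hz], rfl⟩
  compact := by
    rintro T ⟨⟨z, π, rfl⟩, hT⟩
    exact (isCompact_OmegaBar d).of_isClosed_subset (isClosed_atomElement z π) hT
  convex := by
    rintro T ⟨⟨z, π, rfl⟩, hT⟩
    exact convex_atomElement z π
  covers := by
    intro x hx
    have he := eps_pos hN
    have hN1 := eps_mul hN
    -- The minimum assigns the points with a coordinate `1` to the last cell of `[-1, 1]^d` instead
    -- of the next one.
    set z : Fin d → ℤ := fun i => min ⌊x i / eps N⌋ (N - 1) with hz
    have hz01 : ∀ i, 0 ≤ x i / eps N - z i ∧ x i / eps N - z i ≤ 1 := by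
      intro i
      have h1 := Int.floor_le (x i / eps N)
      have h2 := Int.lt_floor_add_one (x i / eps N)
      have h3 : x i / eps N ≤ N := by
        rw [div_le_iff₀ he]
        linarith [(hx i).2]
      rcases le_total ⌊x i / eps N⌋ ((N : ℤ) - 1) with h | h
      · simp only [hz, min_eq_left h]
        constructor <;> linarith
      · have h4 : (N : ℝ) - 1 ≤ ⌊x i / eps N⌋ := by exact_mod_cast h
        simp only [hz, min_eq_right h]
        push_cast
        constructor <;> linarith
    have hzc : z ∈ cells d N := by
      refine Fintype.mem_piFinset.2 fun i => Finset.mem_Ico.2 ⟨le_min ?_ (by lia), ?_⟩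
      · rw [Int.le_floor, le_div_iff₀ he]
        push_cast
        linarith [(hx i).1]
      · exact (min_le_right _ _).trans_lt (by lia)
    set g := cellCoord flip (fun i => x i / eps N - z i)
    -- Sorting the negatives increasingly sorts the coordinates decreasingly.
    have hπ := Tuple.monotone_sort (fun i => -g i)
    refine ⟨atomElement N flip z (Tuple.sort fun i => -g i), atomElement_mem_atomMesh hN hzc,
      hz01, fun i j hij => ?_⟩
    exact neg_le_neg_iff.1 (hπ hij)

/-- Elements of the atomistic mesh that are not elements of the coarse mesh lie in the continuum
region. -/
theorem subset_region_or_mem {Th Tc Ti Ta : Set (Finset (Vec d))} (hN : 0 < N)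
    (h : IsPeriodicTriangulation N Th) (hTh : Th = Tc ∪ Ti ∪ Ta)
    (hsub : elements Ta ∪ elements Ti ⊆ atomMesh d N flip) {K : Set (Vec d)}
    (hK : K ∈ atomMesh d N flip) : K ⊆ region Tc ∨ K ∈ elements Th := by
  by_cases hmem : K ∈ elements Ta ∪ elements Ti
  · right
    rw [hTh]
    rcases hmem with hmem | hmem
    · exact image_mono subset_union_right hmem
    · exact image_mono (subset_union_right.trans subset_union_left) hmem
  · left
    have hTcf : Tc.Finite := (h.finite hN).subset (by rw [hTh]; intro s hs; exact Or.inl (Or.inl hs))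
    obtain ⟨⟨z, π, rfl⟩, hKΩ⟩ := hK
    -- An interior point of `K` lies in no interface or atomistic element, as these belong to the
    -- same atomistic mesh and differ from `K`. The continuum region is closed, so it contains `K`
    -- once it contains the interior points.
    refine (atomElement_subset_closure hN z π).trans
      (closure_minimal (fun x hx => ?_) (isClosed_region hTcf))
    have hxΩ := hKΩ (atomInterior_subset z π hx)
    rw [← h.covers] at hxΩ
    obtain ⟨T, ⟨s, hs, rfl⟩, hxT⟩ := hxΩ
    have hcon : ∀ T ∈ elements Ta ∪ elements Ti, x ∉ T := by
      intro T hT hxT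
      obtain ⟨⟨z', π', rfl⟩, -⟩ := hsub hT
      obtain ⟨rfl, rfl⟩ := atomElement_unique hx hxT
      exact hmem hT
    rw [hTh] at hs
    rcases hs with (hs | hs) | hs
    · exact ⟨_, ⟨s, hs, rfl⟩, hxT⟩
    · exact absurd hxT (hcon _ (Or.inr ⟨s, hs, rfl⟩))
    · exact absurd hxT (hcon _ (Or.inl ⟨s, hs, rfl⟩))

end AtomisticMesh

/-! ### The two triangles of a cell -/

/-- The cell index with `j`-th coordinate `a` and other coordinate `b`. -/
def idx (j : Fin 2) (a b : ℤ) : Fin 2 → ℤ := fun i => if i = j then a else b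

@[simp] theorem idx_same (j : Fin 2) (a b : ℤ) : idx j a b j = a := by simp [idx]

@[simp] theorem idx_other (j : Fin 2) (a b : ℤ) : idx j a b (1 - j) = b := by
  fin_cases j <;> simp [idx]

theorem latticePt_idx (N : ℕ) (j : Fin 2) (a b : ℤ) :
    latticePt N (idx j a b) = pt j (eps N * a) (eps N * b) := by
  ext i
  by_cases h : i = j <;> simp [latticePt, intVec, idx, pt, h]

/-- The permutation that gives the triangle adjacent to the lower side in direction `j`. -/
def loPerm (flip : Bool) (j : Fin 2) : Equiv.Perm (Fin 2) :=
  -- The identity stands for `t₁ ≤ t₀`, or `t₁ ≤ 1 - t₀` if reflected. This is the lower triangle in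
  -- all cases except `j = 0` without reflection, where the lower triangle is `t₀ ≤ t₁`.
  if j = 0 ∧ flip = false then Equiv.swap 0 1 else 1

/-- The permutation that gives the triangle adjacent to the upper side in direction `j`. -/
def hiPerm (flip : Bool) (j : Fin 2) : Equiv.Perm (Fin 2) :=
  if j = 0 ∧ flip = false then 1 else Equiv.swap 0 1

theorem univ_perm_fin_two (flip : Bool) (j : Fin 2) :
    (Finset.univ : Finset (Equiv.Perm (Fin 2))) = {loPerm flip j, hiPerm flip j} := by
  revert flip j
  decide

theorem loPerm_ne_hiPerm (flip : Bool) (j : Fin 2) : loPerm flip j ≠ hiPerm flip j := by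
  revert flip j
  decide

theorem antitone_fin_two {g : Fin 2 → ℝ} : Antitone g ↔ g 1 ≤ g 0 := by
  constructor
  · intro h
    exact h (by decide)
  · intro h i j hij
    fin_cases i <;> fin_cases j <;> simp_all

theorem mem_Icc_cell_iff {N : ℕ} (hN : 0 < N) {s : ℝ} {a : ℤ} :
    (0 ≤ s / eps N - a ∧ s / eps N - a ≤ 1) ↔ s ∈ Icc (eps N * a) (eps N * (a + 1)) := by
  have he := eps_pos hN
  rw [sub_nonneg, sub_le_iff_le_add, le_div_iff₀ he, div_le_iff₀ he, mem_Icc, mul_comm (eps N),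
    mul_comm (eps N), add_comm (1 : ℝ)]

theorem pt_mem_loTri {N : ℕ} (hN : 0 < N) {flip : Bool} {j : Fin 2} {a b : ℤ} {s t : ℝ} :
    pt j s t ∈ atomElement N flip (idx j a b) (loPerm flip j) ↔
      s ∈ Icc (eps N * a) (eps N * (a + 1)) ∧ t ∈ Icc (eps N * b) (eps N * (b + 1)) ∧
        s ≤ diag N flip a b t := by
  have he := eps_pos hN
  rw [mem_atomElement, forall_fin_two_iff j, pt_same, pt_other, idx_same, idx_other,
    mem_Icc_cell_iff hN, mem_Icc_cell_iff hN, and_assoc, and_congr_right_iff]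
  intro hs
  refine and_congr_right_iff.2 fun ht => ?_
  rw [antitone_fin_two, ← mul_le_mul_iff_of_pos_left he]
  have hd : ∀ u v : ℝ, eps N * (u / eps N - v) = u - eps N * v := fun u v => by field_simp
  cases flip <;> fin_cases j <;>
    simp [loPerm, cellCoord, diag, pt, idx, hd, mul_sub] <;>
    constructor <;> intro h <;> linarith

theorem pt_mem_hiTri {N : ℕ} (hN : 0 < N) {flip : Bool} {j : Fin 2} {a b : ℤ} {s t : ℝ} :
    pt j s t ∈ atomElement N flip (idx j a b) (hiPerm flip j) ↔
      s ∈ Icc (eps N * a) (eps N * (a + 1)) ∧ t ∈ Icc (eps N * b) (eps N * (b + 1)) ∧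
        diag N flip a b t ≤ s := by
  have he := eps_pos hN
  rw [mem_atomElement, forall_fin_two_iff j, pt_same, pt_other, idx_same, idx_other,
    mem_Icc_cell_iff hN, mem_Icc_cell_iff hN, and_assoc, and_congr_right_iff]
  intro hs
  refine and_congr_right_iff.2 fun ht => ?_
  rw [antitone_fin_two, ← mul_le_mul_iff_of_pos_left he]
  have hd : ∀ u v : ℝ, eps N * (u / eps N - v) = u - eps N * v := fun u v => by field_simp
  cases flip <;> fin_cases j <;>
    simp [hiPerm, cellCoord, diag, pt, idx, hd, mul_sub] <;>
    constructor <;> intro h <;> linarith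

/-! ### Functions with finitely many values -/

/-- Gradients of piecewise affine functions take finitely many values almost everywhere. Integrals
of functions of them are thus finite sums, for arbitrary `φ`, and depend on parameters termwise. -/
theorem integral_comp_of_ae_mem_finset {α β : Type*} [MeasurableSpace α] [MeasurableSpace β]
    [MeasurableSingletonClass β] {μ : Measure α} [IsFiniteMeasure μ] {H : α → β}
    (hH : Measurable H) (s : Finset β) (hs : ∀ᵐ x ∂μ, H x ∈ s) (φ : β → ℝ) :
    Integrable (fun x => φ (H x)) μ ∧
      ∫ x, φ (H x) ∂μ = ∑ h ∈ s, μ.real (H ⁻¹' {h}) * φ h := by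
  have hm : ∀ h, MeasurableSet (H ⁻¹' {h}) := fun h => hH (measurableSet_singleton h)
  have hae : (fun x => φ (H x)) =ᵐ[μ]
      fun x => ∑ h ∈ s, (H ⁻¹' {h}).indicator (fun _ => φ h) x := by
    filter_upwards [hs] with x hx
    rw [Finset.sum_eq_single (H x)]
    · simp
    · intro b _ hb
      exact indicator_of_notMem (fun h => hb (by simpa using h.symm)) _
    · intro h
      exact absurd hx h
  have hint : ∀ h ∈ s, Integrable (fun x => (H ⁻¹' {h}).indicator (fun _ => φ h) x) μ :=
    fun h _ => (integrable_const _).indicator (hm h)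
  refine ⟨(integrable_finsetSum _ hint).congr hae.symm, ?_⟩
  rw [integral_congr_ae hae, integral_finsetSum _ hint]
  exact Finset.sum_congr rfl fun h _ => by
    rw [integral_indicator_const _ (hm h), smul_eq_mul]

/-! ### Gradients of vector-valued piecewise affine functions -/

/-- `v` is continuous, and affine with gradient `L T` on each `T ∈ 𝒯`. -/
structure HasJacobians {d : ℕ} (𝒯 : Set (Set (Vec d))) (v : Vec d → Vec d)
    (L : Set (Vec d) → Vec d →L[ℝ] Vec d) : Prop where
  continuous : Continuous v
  affine : ∀ T ∈ 𝒯, ∃ b, ∀ x ∈ T, v x = L T x + b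

theorem IsP1.exists_hasJacobians {d : ℕ} {𝒯 : Set (Set (Vec d))} {v : Vec d → Vec d}
    (h : IsP1 𝒯 v) : ∃ L, HasJacobians 𝒯 v L := by
  classical
  choose! L hL using h.2
  exact ⟨L, h.1, hL⟩

theorem IsP1.mono {d : ℕ} {𝒯 𝒯' : Set (Set (Vec d))} {v : Vec d → Vec d}
    (h : IsP1 𝒯 v) (hsub : 𝒯' ⊆ 𝒯) : IsP1 𝒯' v := ⟨h.1, fun T hT => h.2 T (hsub hT)⟩

theorem elements_subset_extElements {d : ℕ} (Th : Set (Finset (Vec d))) :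
    elements Th ⊆ extElements Th := fun T hT => ⟨0, T, hT, (shift_zero T).symm⟩

section Jacobians

variable {d : ℕ} {𝒯 : Set (Set (Vec d))} {v : Vec d → Vec d}
  {L : Set (Vec d) → Vec d →L[ℝ] Vec d}

theorem HasJacobians.comp_proj (h : HasJacobians 𝒯 v L) (c : Fin d) :
    HasGradients 𝒯 (fun x => v x c) fun T => (EuclideanSpace.proj c).comp (L T) where
  continuous := by
    have := h.continuous
    fun_prop
  affine T hT := by
    obtain ⟨b, hb⟩ := h.affine T hT
    exact ⟨b c, fun x hx => by simp [hb x hx]⟩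

theorem HasJacobians.hasFDerivAt (h : HasJacobians 𝒯 v L) {T : Set (Vec d)} (hT : T ∈ 𝒯)
    {x : Vec d} (hx : x ∈ interior T) : HasFDerivAt v (L T) x := by
  obtain ⟨b, hb⟩ := h.affine T hT
  have hd : HasFDerivAt (fun z => L T z + b) (L T) x := (L T).hasFDerivAt.add_const b
  refine hd.congr_of_eventuallyEq ?_
  filter_upwards [mem_interior_iff_mem_nhds.1 hx] with z hz using hb z hz

theorem IsConvexCover.ae_hasFDerivAt (h𝒯 : IsConvexCover 𝒯) (h : HasJacobians 𝒯 v L) :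
    ∀ᵐ x ∂(volume.restrict (Omega d)), ∃ T ∈ 𝒯, x ∈ interior T ∧ HasFDerivAt v (L T) x := by
  filter_upwards [h𝒯.ae_exists_mem_interior] with x ⟨T, hT, hx⟩
  exact ⟨T, hT, hx, h.hasFDerivAt hT hx⟩

end Jacobians

theorem isFiniteMeasure_restrict {d : ℕ} {S : Set (Vec d)} (hS : S ⊆ OmegaBar d) :
    IsFiniteMeasure (volume.restrict S) :=
  ⟨by
    rw [Measure.restrict_apply_univ]
    exact (measure_mono hS).trans_lt (isCompact_OmegaBar d).measure_lt_top⟩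

theorem ae_restrict_of_subset_OmegaBar {d : ℕ} {S : Set (Vec d)} (hS : S ⊆ OmegaBar d)
    {p : Vec d → Prop} (h : ∀ᵐ x ∂(volume.restrict (Omega d)), p x) :
    ∀ᵐ x ∂(volume.restrict S), p x := by
  rw [restrict_Omega] at h
  exact ae_restrict_of_ae_restrict_of_subset hS h

/-! ### The first variation of the continuum energy -/

section Continuum

variable {d : ℕ} {R : Finset (Fin d → ℤ)} {V : (R → Vec d) → ℝ}

/-- The linear map `F ↦ (F r)_r`. -/
noncomputable def bondMap (R : Finset (Fin d → ℤ)) : (Vec d →L[ℝ] Vec d) →L[ℝ] (R → Vec d) :=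
  ContinuousLinearMap.pi fun r => ContinuousLinearMap.apply ℝ (Vec d) (intVec (r : Fin d → ℤ))

theorem bondMap_apply (F : Vec d →L[ℝ] Vec d) (r : R) :
    bondMap R F r = F (intVec (r : Fin d → ℤ)) := rfl

theorem cauchyBorn_eq (V : (R → Vec d) → ℝ) : cauchyBorn V = fun F => V (bondMap R F) := rfl

theorem differentiable_cauchyBorn (hV : ContDiff ℝ 2 V) : Differentiable ℝ (cauchyBorn V) := by
  rw [cauchyBorn_eq]
  exact (hV.differentiable (by norm_num)).comp (bondMap R).differentiable

variable {𝒯y 𝒯v : Set (Set (Vec d))} {y v : Vec d → Vec d}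

/-- Pairs are needed because `y` and `v` may be piecewise affine on different meshes; no common
refinement has to be constructed. -/
theorem exists_finset_gradients (h𝒯y : IsConvexCover 𝒯y) (hy : IsP1 𝒯y y)
    (h𝒯v : IsConvexCover 𝒯v) (hv : IsP1 𝒯v v) :
    ∃ s : Finset ((Vec d →L[ℝ] Vec d) × (Vec d →L[ℝ] Vec d)),
      ∀ᵐ x ∂(volume.restrict (Omega d)), (fderiv ℝ y x, fderiv ℝ v x) ∈ s := by
  classical
  obtain ⟨Ly, hLy⟩ := hy.exists_hasJacobians
  obtain ⟨Lv, hLv⟩ := hv.exists_hasJacobians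
  refine ⟨(h𝒯y.finite.toFinset.image Ly) ×ˢ (h𝒯v.finite.toFinset.image Lv), ?_⟩
  filter_upwards [h𝒯y.ae_hasFDerivAt hLy, h𝒯v.ae_hasFDerivAt hLv] with x ⟨T, hT, _, hx⟩ ⟨S, hS, _, hx'⟩
  rw [hx.fderiv, hx'.fderiv, Finset.mem_product]
  exact ⟨Finset.mem_image_of_mem _ (by simpa using hT), Finset.mem_image_of_mem _ (by simpa using hS)⟩

theorem ae_differentiableAt (h𝒯v : IsConvexCover 𝒯v) (hv : IsP1 𝒯v v) :
    ∀ᵐ x ∂(volume.restrict (Omega d)), DifferentiableAt ℝ v x := by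
  obtain ⟨Lv, hLv⟩ := hv.exists_hasJacobians
  filter_upwards [h𝒯v.ae_hasFDerivAt hLv] with x ⟨T, hT, _, hx⟩ using hx.differentiableAt

theorem measurable_gradients (y v : Vec d → Vec d) :
    Measurable fun x => (fderiv ℝ y x, fderiv ℝ v x) :=
  (measurable_fderiv ℝ y).prodMk (measurable_fderiv ℝ v)

/-- Functions of the gradients are integrable. -/
theorem integrable_comp_gradients (h𝒯y : IsConvexCover 𝒯y) (hy : IsP1 𝒯y y)
    (h𝒯v : IsConvexCover 𝒯v) (hv : IsP1 𝒯v v)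
    (φ : (Vec d →L[ℝ] Vec d) × (Vec d →L[ℝ] Vec d) → ℝ) {S : Set (Vec d)} (hS : S ⊆ OmegaBar d) :
    IntegrableOn (fun x => φ (fderiv ℝ y x, fderiv ℝ v x)) S := by
  obtain ⟨s, hs⟩ := exists_finset_gradients h𝒯y hy h𝒯v hv
  have := isFiniteMeasure_restrict hS
  exact (integral_comp_of_ae_mem_finset (measurable_gradients y v) s
    (ae_restrict_of_subset_OmegaBar hS hs) φ).1

/-- The integral is a finite sum of functions `t ↦ W(F + t G)` with fixed weights, so
differentiation under the integral needs no domination argument. -/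
theorem hasDerivAt_integral_cauchyBorn (hV : ContDiff ℝ 2 V) (h𝒯y : IsConvexCover 𝒯y)
    (hy : IsP1 𝒯y y) (h𝒯v : IsConvexCover 𝒯v) (hv : IsP1 𝒯v v) {S : Set (Vec d)}
    (hS : S ⊆ OmegaBar d) :
    HasDerivAt (fun t : ℝ => ∫ x in S, cauchyBorn V (fderiv ℝ (fun x => y x + t • v x) x))
      (∫ x in S, fderiv ℝ (cauchyBorn V) (fderiv ℝ y x) (fderiv ℝ v x)) 0 := by
  obtain ⟨s, hs⟩ := exists_finset_gradients h𝒯y hy h𝒯v hv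
  have := isFiniteMeasure_restrict hS
  have hsS := ae_restrict_of_subset_OmegaBar hS hs
  have hm := measurable_gradients y v
  have h1 : ∀ t : ℝ, ∫ x in S, cauchyBorn V (fderiv ℝ (fun x => y x + t • v x) x) =
      ∑ h ∈ s, (volume.restrict S).real ((fun x => (fderiv ℝ y x, fderiv ℝ v x)) ⁻¹' {h}) *
        cauchyBorn V (h.1 + t • h.2) := by
    intro t
    rw [← (integral_comp_of_ae_mem_finset hm s hsS fun h => cauchyBorn V (h.1 + t • h.2)).2]
    refine integral_congr_ae ?_
    filter_upwards [ae_restrict_of_subset_OmegaBar hS (ae_differentiableAt h𝒯y hy),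
      ae_restrict_of_subset_OmegaBar hS (ae_differentiableAt h𝒯v hv)] with x hx hx'
    have := (hx.hasFDerivAt.add (hx'.hasFDerivAt.const_smul t)).fderiv
    congr 1
  rw [(integral_comp_of_ae_mem_finset hm s hsS fun h => fderiv ℝ (cauchyBorn V) h.1 h.2).2]
  simp_rw [h1]
  refine HasDerivAt.fun_sum fun h _ => HasDerivAt.const_mul _ ?_
  have hline : HasDerivAt (fun t : ℝ => h.1 + t • h.2) h.2 0 := by
    simpa using ((hasDerivAt_id (0 : ℝ)).smul_const h.2).const_add h.1
  have hW : HasFDerivAt (cauchyBorn V) (fderiv ℝ (cauchyBorn V) h.1) (h.1 + (0 : ℝ) • h.2) := by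
    rw [show h.1 + (0 : ℝ) • h.2 = h.1 from
      (congrArg (h.1 + ·) (zero_smul ℝ h.2)).trans (add_zero _)]
    exact ((differentiable_cauchyBorn hV) h.1).hasFDerivAt
  exact hW.comp_hasDerivAt (0 : ℝ) hline

end Continuum

/-! ### The first variations of the energies -/

section Energies

variable {d N : ℕ} {R : Finset (Fin d → ℤ)} {V : (R → Vec d) → ℝ} {Ωc Ωi Ωa : Set (Vec d)}
  {Ei : (interfaceBonds N R Ωi → Vec d) → ℝ}

theorem finDiff_add_smul (N : ℕ) (y v : Vec d → Vec d) (t : ℝ) (z r : Fin d → ℤ) :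
    finDiff N (fun x => y x + t • v x) z r = finDiff N y z r + t • finDiff N v z r := by
  simp only [finDiff]
  module

/-- The sum of the contributions to the energy that depend on the lattice values only. -/
noncomputable def latticeEnergy (N : ℕ) (V : (R → Vec d) → ℝ) (Ωi Ωa : Set (Vec d))
    (Ei : (interfaceBonds N R Ωi → Vec d) → ℝ) (y : Vec d → Vec d) : ℝ :=
  eps N ^ d * ∑ z ∈ atomNodes N R Ωa, V (fun r : R => finDiff N y z r)
    + eps N ^ d * Ei fun b => finDiff N y b.1.1 b.1.2

theorem energyAC_eq (y : Vec d → Vec d) : energyAC N V Ωc Ωi Ωa Ei y =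
    (∫ x in Ωc, cauchyBorn V (fderiv ℝ y x)) + latticeEnergy N V Ωi Ωa Ei y := by
  simp only [energyAC, latticeEnergy, add_assoc]

theorem differentiable_latticeEnergy (hV : ContDiff ℝ 2 V) (hEi : ContDiff ℝ 2 Ei)
    (y v : Vec d → Vec d) :
    Differentiable ℝ fun t : ℝ => latticeEnergy N V Ωi Ωa Ei fun x => y x + t • v x := by
  have hV' := hV.differentiable (by norm_num)
  have hEi' := hEi.differentiable (by norm_num)
  unfold latticeEnergy
  simp only [finDiff_add_smul]
  refine ((Differentiable.fun_sum fun z _ => hV'.comp ?_).const_mul _).add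
    ((hEi'.comp ?_).const_mul _)
  · exact differentiable_pi.2 fun r => by fun_prop
  · exact differentiable_pi.2 fun r => by fun_prop

variable {𝒯y 𝒯v 𝒯u : Set (Set (Vec d))} {y v u : Vec d → Vec d}

/-- The error functional at two displacements with the same lattice values. -/
theorem firstVar_sub_eq (hV : ContDiff ℝ 2 V) (hEi : ContDiff ℝ 2 Ei) (hΩc : Ωc ⊆ OmegaBar d)
    (h𝒯y : IsConvexCover 𝒯y) (hy : IsP1 𝒯y y) (h𝒯v : IsConvexCover 𝒯v) (hv : IsP1 𝒯v v)
    (h𝒯u : IsConvexCover 𝒯u) (hu : IsP1 𝒯u u)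
    (huv : ∀ z : Fin d → ℤ, u (latticePt N z) = v (latticePt N z)) :
    firstVar (energyAC N V Ωc Ωi Ωa Ei) y u - firstVar (energyA N V) y u =
      ((∫ x in Ωc, fderiv ℝ (cauchyBorn V) (fderiv ℝ y x) (fderiv ℝ u x)) -
        ∫ x in Ωc, fderiv ℝ (cauchyBorn V) (fderiv ℝ y x) (fderiv ℝ v x)) +
      (firstVar (energyAC N V Ωc Ωi Ωa Ei) y v - firstVar (energyA N V) y v) := by
  -- The atomistic energy and the lattice part of the coupled energy vary equally in both
  -- directions, so only the continuum integral distinguishes them.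
  have hfd : ∀ z r, finDiff N u z r = finDiff N v z r := fun z r => by simp only [finDiff, huv]
  have hA : firstVar (energyA N V) y u = firstVar (energyA N V) y v := by
    simp only [firstVar, energyA, finDiff_add_smul, hfd]
  have hL : (fun t : ℝ => latticeEnergy N V Ωi Ωa Ei fun x => y x + t • u x) =
      fun t : ℝ => latticeEnergy N V Ωi Ωa Ei fun x => y x + t • v x := by
    simp only [latticeEnergy, finDiff_add_smul, hfd]
  have hAC : ∀ {𝒯w : Set (Set (Vec d))} {w : Vec d → Vec d}, IsConvexCover 𝒯w → IsP1 𝒯w w →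
      firstVar (energyAC N V Ωc Ωi Ωa Ei) y w =
        (∫ x in Ωc, fderiv ℝ (cauchyBorn V) (fderiv ℝ y x) (fderiv ℝ w x)) +
          deriv (fun t : ℝ => latticeEnergy N V Ωi Ωa Ei fun x => y x + t • w x) 0 := by
    intro 𝒯w w h𝒯w hw
    simp only [firstVar, energyAC_eq]
    exact ((hasDerivAt_integral_cauchyBorn hV h𝒯y hy h𝒯w hw hΩc).add
      (differentiable_latticeEnergy hV hEi y w 0).hasDerivAt).deriv
  rw [hA, hAC h𝒯u hu, hAC h𝒯v hv, hL]
  ring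

/-- Rescaling the variable of `deriv` needs no differentiability, so homogeneity holds for every
functional. -/
theorem firstVar_smul (E : (Vec d → Vec d) → ℝ) (y v : Vec d → Vec d) (c : ℝ) :
    firstVar E y (fun x => c • v x) = c * firstVar E y v := by
  have h := deriv_comp_mul_left c (fun t : ℝ => E fun x => y x + t • v x) 0
  simp only [mul_zero, smul_eq_mul] at h
  rw [firstVar, firstVar, ← h]
  congr 1
  funext t
  congr 1
  funext x
  rw [smul_smul, mul_comm]

/-- Both energies see only differences and gradients. This settles the displacements with zero
gradient, which cannot be normalised. -/
theorem firstVar_const_eq_zero (y : Vec d → Vec d) (w : Vec d) :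
    firstVar (energyAC N V Ωc Ωi Ωa Ei) y (fun _ => w) = 0 ∧
      firstVar (energyA N V) y (fun _ => w) = 0 := by
  have h0 : ∀ z r : Fin d → ℤ, finDiff N (fun _ : Vec d => w) z r = 0 := fun z r => by
    simp [finDiff]
  constructor
  · simp only [firstVar, energyAC, finDiff_add_smul, h0, smul_zero, add_zero, fderiv_add_const,
      deriv_const]
  · simp only [firstVar, energyA, finDiff_add_smul, h0, smul_zero, add_zero, deriv_const]

end Energies

/-! ### Lipschitz bound for the stress -/

section Stress

variable {d : ℕ} {R : Finset (Fin d → ℤ)} {V : (R → Vec d) → ℝ}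

/-- The matrix with entry `1` at position `(c, j)`. -/
noncomputable def matrixUnit (c j : Fin d) : Vec d →L[ℝ] Vec d :=
  (EuclideanSpace.proj j : Vec d →L[ℝ] ℝ).smulRight (basisVec c)

theorem eq_sum_matrixUnit (G : Vec d →L[ℝ] Vec d) :
    G = ∑ c, ∑ j, (G (basisVec j) c) • matrixUnit c j := by
  ext x i
  have hx : x = ∑ j, x j • basisVec j := by
    ext k
    simp [Finset.sum_apply, Pi.single_apply]
  conv_lhs => rw [hx]
  simp only [map_sum, map_smul, matrixUnit, _root_.sum_apply,
    _root_.smul_apply, ContinuousLinearMap.smulRight_apply, WithLp.ofLp_sum,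
    Finset.sum_apply, PiLp.smul_apply, PiLp.proj_apply, PiLp.single_apply]
  simp [mul_comm]

theorem norm_matrixUnit_apply_le (c j : Fin d) (x : Vec d) : ‖matrixUnit c j x‖ ≤ ‖x‖ := by
  simp only [matrixUnit, ContinuousLinearMap.smulRight_apply, norm_smul,
    PiLp.norm_single, norm_one, mul_one]
  exact PiLp.norm_apply_le x j

/-- The Cauchy–Schwarz inequality, row by row. -/
theorem norm_apply_le_tensorNorm (F : Vec d →L[ℝ] Vec d) (x : Vec d) :
    ‖F x‖ ≤ tensorNorm 2 F * ‖x‖ := by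
  have h0 : 0 ≤ tensorNorm 2 F := norm_nonneg _
  refine (sq_le_sq₀ (norm_nonneg _) (by positivity)).1 ?_
  rw [mul_pow, EuclideanSpace.norm_sq_eq, EuclideanSpace.norm_sq_eq, tensorNorm]
  have h1 : ‖(WithLp.toLp 2 (fun ij : Fin d × Fin d => F (EuclideanSpace.single ij.2 1) ij.1) :
      PiLp 2 fun _ : Fin d × Fin d => ℝ)‖ ^ 2 = ∑ c, ∑ j, (F (basisVec j) c) ^ 2 := by
    rw [PiLp.norm_sq_eq_of_L2, Fintype.sum_prod_type]
    simp
  rw [h1, Finset.sum_mul]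
  refine Finset.sum_le_sum fun c _ => ?_
  have h2 : F x c = ∑ j, F (basisVec j) c * x j := by
    have hx : x = ∑ j, x j • basisVec j := by
      ext k
      simp [Finset.sum_apply, Pi.single_apply]
    conv_lhs => rw [hx]
    simp [mul_comm]
  rw [h2, Real.norm_eq_abs, sq_abs]
  simp only [Real.norm_eq_abs, sq_abs]
  exact Finset.sum_mul_sq_le_sq_mul_sq _ _ _

theorem fderiv_cauchyBorn_apply (hV : ContDiff ℝ 2 V) (F G : Vec d →L[ℝ] Vec d) :
    fderiv ℝ (cauchyBorn V) F G = fderiv ℝ V (bondMap R F) (bondMap R G) := by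
  rw [cauchyBorn_eq]
  have h := ((hV.differentiable (by norm_num)) (bondMap R F)).hasFDerivAt.comp F
    (bondMap R).hasFDerivAt
  have h' := h.fderiv
  simp only [Function.comp_def] at h'
  rw [h']
  rfl

theorem pi_eq_sum_single (k : R → Vec d) :
    k = ∑ r, ContinuousLinearMap.single ℝ (fun _ : R => Vec d) r (k r) := by
  funext r
  simp [Finset.sum_apply, Pi.single_apply]

theorem fderiv_fderiv_eq_sum (hV : ContDiff ℝ 2 V) (g k h : R → Vec d) :
    fderiv ℝ (fderiv ℝ V) g k h = ∑ r, ∑ s, partial2 V r s g (k r) (h s) := by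
  have hD : Differentiable ℝ (fderiv ℝ V) :=
    (hV.fderiv_right (m := 1) (by norm_num)).differentiable (by norm_num)
  have hp : ∀ (r s : R) (a b : Vec d), partial2 V r s g a b =
      fderiv ℝ (fderiv ℝ V) g (ContinuousLinearMap.single ℝ (fun _ : R => Vec d) r a)
        (ContinuousLinearMap.single ℝ (fun _ : R => Vec d) s b) := by
    intro r s a b
    have h1 := ((hD g).hasFDerivAt.clm_comp
      (hasFDerivAt_const (ContinuousLinearMap.single ℝ (fun _ : R => Vec d) s) g)).fderiv
    simp only [partial2]
    rw [h1]
    simp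
  conv_lhs => rw [pi_eq_sum_single k, pi_eq_sum_single h]
  simp only [map_sum, _root_.sum_apply]
  rw [Finset.sum_comm]
  simp only [hp]

/-- This is where `M^a` enters. The mean value inequality along the segment from `F'` to `F`
involves the second derivative of `V`, which splits into the blocks `∂_{r,s} V`. The increment `(F -
F') r` contributes `|r|` times the Frobenius norm, the matrix unit contributes at most `|s|`. -/
theorem abs_stress_sub_le (hV : ContDiff ℝ 2 V) {M : R → R → ℝ} (hM0 : ∀ r s, 0 ≤ M r s)
    (hM : ∀ g r s, ‖partial2 V r s g‖ ≤ M r s) (F F' : Vec d →L[ℝ] Vec d) (c j : Fin d) :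
    |fderiv ℝ (cauchyBorn V) F (matrixUnit c j) - fderiv ℝ (cauchyBorn V) F' (matrixUnit c j)| ≤
      boundConst M * tensorNorm 2 (F - F') := by
  have hD : Differentiable ℝ (fderiv ℝ V) :=
    (hV.fderiv_right (m := 1) (by norm_num)).differentiable (by norm_num)
  rw [fderiv_cauchyBorn_apply hV, fderiv_cauchyBorn_apply hV]
  set h := bondMap R (matrixUnit c j) with hh
  set k := bondMap R (F - F') with hk
  set φ : ℝ → ℝ := fun τ => fderiv ℝ V (bondMap R F' + τ • k) h with hφ
  have hφd : ∀ τ : ℝ, HasDerivAt φ (fderiv ℝ (fderiv ℝ V) (bondMap R F' + τ • k) k h) τ := by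
    intro τ
    have hline : HasDerivAt (fun τ : ℝ => bondMap R F' + τ • k) k τ := by
      simpa using ((hasDerivAt_id τ).smul_const k).const_add (bondMap R F')
    have h2 := (hD (bondMap R F' + τ • k)).hasFDerivAt.comp_hasDerivAt τ hline
    have h3 := ((ContinuousLinearMap.apply ℝ ℝ h).hasFDerivAt).comp_hasDerivAt τ h2
    exact h3
  have hbound : ∀ τ : ℝ, ‖fderiv ℝ (fderiv ℝ V) (bondMap R F' + τ • k) k h‖ ≤
      boundConst M * tensorNorm 2 (F - F') := by
    intro τ
    rw [fderiv_fderiv_eq_sum hV, boundConst, Finset.sum_mul]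
    refine (norm_sum_le _ _).trans (Finset.sum_le_sum fun r _ => ?_)
    rw [Finset.sum_mul]
    refine (norm_sum_le _ _).trans (Finset.sum_le_sum fun s _ => ?_)
    have h1 : ‖k r‖ ≤ tensorNorm 2 (F - F') * ‖intVec (r : Fin d → ℤ)‖ := by
      rw [hk, bondMap_apply]
      exact norm_apply_le_tensorNorm _ _
    have h2 : ‖h s‖ ≤ ‖intVec (s : Fin d → ℤ)‖ := by
      rw [hh, bondMap_apply]
      exact norm_matrixUnit_apply_le c j _
    have h3 := hM (bondMap R F' + τ • k) r s
    have h4 : 0 ≤ tensorNorm 2 (F - F') := norm_nonneg _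
    have h5 := hM0 r s
    calc _ ≤ ‖partial2 V r s (bondMap R F' + τ • k)‖ * ‖k r‖ * ‖h s‖ :=
          ContinuousLinearMap.le_opNorm₂ _ _ _
      _ ≤ M r s * (tensorNorm 2 (F - F') * ‖intVec (r : Fin d → ℤ)‖) *
          ‖intVec (s : Fin d → ℤ)‖ := by gcongr
      _ = _ := by ring
  have hmv := norm_image_sub_le_of_norm_deriv_le_segment_01'
    (fun τ _ => (hφd τ).hasDerivWithinAt) (fun τ _ => hbound τ)
  have h1 : φ 1 = fderiv ℝ V (bondMap R F) h := by
    simp [hφ, hk]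
  have h0 : φ 0 = fderiv ℝ V (bondMap R F') h := by simp [hφ]
  rw [h1, h0, Real.norm_eq_abs] at hmv
  exact hmv

end Stress

/-! ### The norms of gradients -/

section Norms

variable {d : ℕ} {q : ℝ≥0∞}

theorem abs_entry_le_tensorNorm (hq : 1 ≤ q) (F : Vec d →L[ℝ] Vec d) (c j : Fin d) :
    |F (basisVec j) c| ≤ tensorNorm q F := by
  have : Fact (1 ≤ q) := ⟨hq⟩
  exact PiLp.norm_apply_le (WithLp.toLp q
    (fun ij : Fin d × Fin d => F (EuclideanSpace.single ij.2 1) ij.1) :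
    PiLp q fun _ : Fin d × Fin d => ℝ) (c, j)

theorem tensorNorm_nonneg (hq : 1 ≤ q) (F : Vec d →L[ℝ] Vec d) : 0 ≤ tensorNorm q F := by
  have : Fact (1 ≤ q) := ⟨hq⟩
  exact norm_nonneg _

theorem tensorNorm_smul (hq : 1 ≤ q) (t : ℝ) (F : Vec d →L[ℝ] Vec d) :
    tensorNorm q (t • F) = |t| * tensorNorm q F := by
  have : Fact (1 ≤ q) := ⟨hq⟩
  rw [tensorNorm, tensorNorm, ← Real.norm_eq_abs, ← norm_smul]
  rfl

theorem eq_zero_of_tensorNorm_eq_zero (hq : 1 ≤ q) {F : Vec d →L[ℝ] Vec d}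
    (h : tensorNorm q F = 0) : F = 0 := by
  rw [eq_sum_matrixUnit F]
  refine Finset.sum_eq_zero fun c _ => Finset.sum_eq_zero fun j _ => ?_
  have := abs_entry_le_tensorNorm hq F c j
  rw [h, abs_nonpos_iff] at this
  rw [this]
  exact zero_smul ℝ (matrixUnit c j)

theorem enorm_tensorNorm_rpow (hq : 1 ≤ q) (hqt : q ≠ ∞) (F : Vec d →L[ℝ] Vec d) :
    ‖tensorNorm q F‖ₑ ^ q.toReal = ∑ c, ∑ j, ‖F (basisVec j) c‖ₑ ^ q.toReal := by
  have : Fact (1 ≤ q) := ⟨hq⟩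
  have hq0 : 0 < q.toReal := ENNReal.toReal_pos (one_pos.trans_le hq).ne' hqt
  have h : tensorNorm q F ^ q.toReal = ∑ c, ∑ j, ‖F (basisVec j) c‖ ^ q.toReal := by
    rw [tensorNorm, PiLp.norm_eq_sum hq0, ← Real.rpow_mul (by positivity),
      one_div_mul_cancel hq0.ne', Real.rpow_one, Fintype.sum_prod_type]
  have hr : ∀ x : ℝ, ‖x‖ₑ ^ q.toReal = ENNReal.ofReal (‖x‖ ^ q.toReal) := fun x => by
    rw [← ofReal_norm, ENNReal.ofReal_rpow_of_nonneg (norm_nonneg _) hq0.le]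
  simp only [hr]
  rw [Real.norm_of_nonneg (tensorNorm_nonneg hq F), h,
    ENNReal.ofReal_sum_of_nonneg fun _ _ => by positivity]
  exact Finset.sum_congr rfl fun c _ => ENNReal.ofReal_sum_of_nonneg fun _ _ => by positivity

theorem tensorNorm_top_le {F : Vec d →L[ℝ] Vec d} {S : ℝ≥0∞}
    (h : ∀ c j, ‖F (basisVec j) c‖ₑ ≤ S) : ‖tensorNorm ∞ F‖ₑ ≤ S := by
  by_cases hS : S = ∞
  · simp [hS]
  rw [Real.enorm_of_nonneg (tensorNorm_nonneg le_top F)]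
  refine ENNReal.ofReal_le_of_le_toReal ?_
  rw [tensorNorm, PiLp.norm_eq_ciSup]
  rcases isEmpty_or_nonempty (Fin d × Fin d) with he | he
  · simp
  refine ciSup_le fun ij => ?_
  rw [← ENNReal.ofReal_le_ofReal_iff ENNReal.toReal_nonneg, ENNReal.ofReal_toReal hS,
    ofReal_norm]
  exact h ij.1 ij.2

/-- The partial derivative `∂_j v_c`. -/
noncomputable def pderiv (v : Vec d → Vec d) (c j : Fin d) (x : Vec d) : ℝ :=
  fderiv ℝ (fun x => v x c) x (basisVec j)

theorem pderiv_eq {v : Vec d → Vec d} {x : Vec d} (h : DifferentiableAt ℝ v x) (c j : Fin d) :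
    pderiv v c j x = fderiv ℝ v x (basisVec j) c := by
  have h1 := ((EuclideanSpace.proj c : Vec d →L[ℝ] ℝ).hasFDerivAt.comp x h.hasFDerivAt).fderiv
  have h2 : (fun x => v x c) = (EuclideanSpace.proj c : Vec d →L[ℝ] ℝ) ∘ v := rfl
  rw [pderiv, h2, h1]
  rfl

theorem measurable_pderiv (v : Vec d → Vec d) (c j : Fin d) : Measurable (pderiv v c j) :=
  measurable_fderiv_apply_const ℝ _ _

variable {𝒯 𝒯' : Set (Set (Vec d))} {u v : Vec d → Vec d}

theorem ae_pderiv_eq (h𝒯 : IsConvexCover 𝒯) (hv : IsP1 𝒯 v) :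
    ∀ᵐ x ∂(volume.restrict (Omega d)), ∀ c j, pderiv v c j x = fderiv ℝ v x (basisVec j) c := by
  filter_upwards [ae_differentiableAt h𝒯 hv] with x hx c j using pderiv_eq hx c j

theorem eLpNorm_pderiv_le_gradNorm (h𝒯 : IsConvexCover 𝒯) (hv : IsP1 𝒯 v) (hq : 1 ≤ q)
    (c j : Fin d) : eLpNorm (pderiv v c j) q (volume.restrict (Omega d)) ≤ gradNorm q v := by
  refine eLpNorm_mono_ae ?_
  filter_upwards [ae_pderiv_eq h𝒯 hv] with x hx
  rw [hx, Real.norm_of_nonneg (tensorNorm_nonneg hq _)]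
  exact abs_entry_le_tensorNorm hq _ c j

/-- The matrix norm is the entrywise `ℓ^q`-norm with the exponent of the integral. Hence the norm of
the gradient is assembled from those of the partial derivatives, and entrywise bounds combine with
constant one. -/
theorem gradNorm_le_gradNorm (h𝒯 : IsConvexCover 𝒯) (hv : IsP1 𝒯 v) (h𝒯' : IsConvexCover 𝒯')
    (hu : IsP1 𝒯' u) (hq : 1 ≤ q)
    (h : ∀ c j, eLpNorm (pderiv v c j) q (volume.restrict (Omega d)) ≤
      eLpNorm (pderiv u c j) q (volume.restrict (Omega d))) : gradNorm q v ≤ gradNorm q u := by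
  by_cases hqt : q = ∞
  · subst hqt
    rw [gradNorm, eLpNorm_exponent_top]
    refine eLpNormEssSup_le_of_ae_enorm_bound ?_
    have hae : ∀ᵐ x ∂(volume.restrict (Omega d)), ∀ c j, ‖pderiv v c j x‖ₑ ≤ gradNorm ∞ u := by
      refine ae_all_iff.2 fun c => ae_all_iff.2 fun j => ?_
      filter_upwards [enorm_ae_le_eLpNormEssSup (pderiv v c j) (volume.restrict (Omega d))] with x hx
      refine hx.trans ?_
      rw [← eLpNorm_exponent_top]
      exact (h c j).trans (eLpNorm_pderiv_le_gradNorm h𝒯' hu le_top c j)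
    filter_upwards [hae, ae_pderiv_eq h𝒯 hv] with x hx hx'
    refine tensorNorm_top_le fun c j => ?_
    rw [← hx']
    exact hx c j
  · have hq0 : q ≠ 0 := (one_pos.trans_le hq).ne'
    have hform : ∀ {𝒯 : Set (Set (Vec d))} {w : Vec d → Vec d}, IsConvexCover 𝒯 → IsP1 𝒯 w →
        ∫⁻ x in Omega d, ‖tensorNorm q (fderiv ℝ w x)‖ₑ ^ q.toReal =
          ∑ c, ∑ j, ∫⁻ x in Omega d, ‖pderiv w c j x‖ₑ ^ q.toReal := by
      intro 𝒯 w h𝒯 hw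
      have hm : ∀ c j, Measurable fun x => ‖pderiv w c j x‖ₑ ^ q.toReal := fun c j =>
        (measurable_pderiv w c j).enorm.pow_const _
      simp_rw [← lintegral_finsetSum _ fun j _ => hm _ j]
      rw [← lintegral_finsetSum _ fun c _ => Finset.measurable_fun_sum _ fun j _ => hm c j]
      refine lintegral_congr_ae ?_
      filter_upwards [ae_pderiv_eq h𝒯 hw] with x hx
      rw [enorm_tensorNorm_rpow hq hqt]
      simp only [hx]
    have hqr : 0 < q.toReal := ENNReal.toReal_pos hq0 hqt
    rw [gradNorm, gradNorm, eLpNorm_eq_lintegral_rpow_enorm_toReal hq0 hqt,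
      eLpNorm_eq_lintegral_rpow_enorm_toReal hq0 hqt, hform h𝒯 hv, hform h𝒯' hu]
    refine ENNReal.rpow_le_rpow (Finset.sum_le_sum fun c _ => Finset.sum_le_sum fun j _ => ?_)
      (by positivity)
    have := h c j
    rw [eLpNorm_eq_lintegral_rpow_enorm_toReal hq0 hqt,
      eLpNorm_eq_lintegral_rpow_enorm_toReal hq0 hqt] at this
    exact (ENNReal.rpow_le_rpow_iff (by positivity)).1 this

theorem gradNorm_smul (h𝒯 : IsConvexCover 𝒯) (hv : IsP1 𝒯 v) (hq : 1 ≤ q) (t : ℝ) :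
    gradNorm q (fun x => t • v x) = ENNReal.ofReal |t| * gradNorm q v := by
  have h1 : gradNorm q (fun x => t • v x) =
      eLpNorm (t • fun x => tensorNorm q (fderiv ℝ v x)) q (volume.restrict (Omega d)) := by
    refine eLpNorm_congr_norm_ae ?_
    filter_upwards [ae_differentiableAt h𝒯 hv] with x hx
    have : fderiv ℝ (fun x => t • v x) x = t • fderiv ℝ v x := (hx.hasFDerivAt.const_smul t).fderiv
    rw [this, tensorNorm_smul hq, Pi.smul_apply, smul_eq_mul, norm_mul, norm_mul, Real.norm_eq_abs |t|,
      abs_abs, Real.norm_eq_abs t]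
  rw [h1, eLpNorm_const_smul, Real.enorm_eq_ofReal_abs, gradNorm]

end Norms

/-! ### Displacements without gradient -/

section Constant

variable {d N : ℕ} {flip : Bool} {q : ℝ≥0∞} {v : Vec d → Vec d}

theorem atomMesh_subset : atomMesh d N flip ⊆ atomMeshExt d N flip := fun _ hT => hT.1

theorem exists_add_mem_OmegaBar (x : Vec d) :
    ∃ ξ : Fin d → ℤ, (2 : ℝ) • intVec ξ + x ∈ OmegaBar d := by
  refine ⟨fun i => -round (x i / 2), fun i => ?_⟩
  have h := abs_le.1 (abs_sub_round (x i / 2))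
  simp only [PiLp.add_apply, PiLp.smul_apply, intVec, smul_eq_mul, Int.cast_neg]
  constructor <;> linarith [h.1, h.2]

/-- Every element has positive measure, so its gradient vanishes. Continuity then makes `v` constant
along segments from the origin, and periodicity extends this from `[-1, 1]^d` to the whole space. -/
theorem eq_const_of_gradNorm_eq_zero (hN : 0 < N) (hq : 1 ≤ q)
    (hv : v ∈ displacements (atomMeshExt d N flip)) (h0 : gradNorm q v = 0) :
    v = fun _ => v 0 := by
  have h𝒯 := isConvexCover_atomMesh (d := d) (flip := flip) hN
  obtain ⟨L, hL⟩ := (hv.1.mono atomMesh_subset).exists_hasJacobians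
  have hL0 : ∀ T ∈ atomMesh d N flip, L T = 0 := by
    intro T hT
    obtain ⟨z, hz, π, rfl⟩ := exists_mem_cells hN hT
    have hopen := isOpen_atomInterior (N := N) (flip := flip) z π
    have hsub := (atomInterior_subset (N := N) (flip := flip) z π).trans hT.2
    have hae : ∀ᵐ x ∂(volume.restrict (Omega d)), tensorNorm q (fderiv ℝ v x) = 0 := by
      have hq0 : q ≠ 0 := (one_pos.trans_le hq).ne'
      have hm : AEStronglyMeasurable (fun x => tensorNorm q (fderiv ℝ v x))
          (volume.restrict (Omega d)) := by
        have : Fact (1 ≤ q) := ⟨hq⟩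
        have hc : Continuous fun F : Vec d →L[ℝ] Vec d => tensorNorm q F := by
          unfold tensorNorm
          refine continuous_norm.comp ((PiLp.continuous_toLp q _).comp (continuous_pi fun ij => ?_))
          fun_prop
        exact (hc.measurable.comp (measurable_fderiv ℝ v)).aestronglyMeasurable
      exact (eLpNorm_eq_zero_iff hm hq0).1 h0
    have h1 := ae_restrict_of_subset_OmegaBar hsub hae
    have h2 : ∀ᵐ x ∂(volume.restrict (atomInterior N flip z π)), x ∈ atomInterior N flip z π :=
      ae_restrict_mem hopen.measurableSet
    have : (ae (volume.restrict (atomInterior N flip z π))).NeBot := by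
      rw [ae_neBot, Ne, Measure.restrict_eq_zero]
      exact (hopen.measure_pos _ (atomInterior_nonempty hN z π)).ne'
    obtain ⟨x, hx1, hx2⟩ := (h1.and h2).exists
    rw [(hL.hasFDerivAt hT (atomInterior_subset_interior z π hx2)).fderiv] at hx1
    exact eq_zero_of_tensorNorm_eq_zero hq hx1
  have hΩ : ∀ x ∈ OmegaBar d, v x = v 0 := by
    intro x hx
    have h0Ω : (0 : Vec d) ∈ OmegaBar d := fun i => by simp
    ext c
    have hpa := (hL.comp_proj c).isPiecewiseAffineOn h𝒯 0 x (A := 0) (B := 1) fun s hs => by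
      have := convex_OmegaBar d h0Ω hx (sub_nonneg.2 hs.2) hs.1 (by ring)
      simpa using this
    have h3 := hpa.integral_deriv zero_le_one
    rw [intervalIntegral.integral_of_le zero_le_one, integral_congr_ae (g := fun _ => (0 : ℝ))] at h3
    · simp only [integral_zero, one_smul, zero_smul, zero_add] at h3
      linarith
    · filter_upwards [hpa.ae_deriv] with s ⟨T, hT, _, hs⟩
      rw [hs, hL0 T (by simpa using hT)]
      simp
  funext x
  obtain ⟨ξ, hξ⟩ := exists_add_mem_OmegaBar x
  rw [← hv.2 ξ x, hΩ _ hξ]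

theorem smul_mem_displacements {𝒯 : Set (Set (Vec d))} (hv : v ∈ displacements 𝒯) (t : ℝ) :
    (fun x => t • v x) ∈ displacements 𝒯 := by
  refine ⟨⟨hv.1.1.const_smul t, fun T hT => ?_⟩, fun ξ x => ?_⟩
  · obtain ⟨L, b, h⟩ := hv.1.2 T hT
    exact ⟨t • L, t • b, fun x hx => by simp [h x hx]⟩
  · simp only [hv.2 ξ x]

/-- A homogeneous functional that vanishes on constants is bounded by its negative norm. -/
theorem ofReal_le_negNorm (hN : 0 < N) {p : ℝ≥0∞}
    {Φ : (Vec d → Vec d) → ℝ} (hΦ : ∀ (t : ℝ) v, Φ (fun x => t • v x) = t * Φ v)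
    (hΦ0 : ∀ w, Φ (fun _ => w) = 0) (hv : v ∈ displacements (atomMeshExt d N flip))
    (h1 : gradNorm p.conjExponent v ≤ 1) :
    ENNReal.ofReal (Φ v) ≤ negNorm p (displacements (atomMeshExt d N flip)) Φ := by
  have hq : 1 ≤ p.conjExponent := by simp [ENNReal.conjExponent]
  -- The supremum runs over gradient norm exactly one. If the norm of `v` is zero, `v` is constant
  -- and contributes nothing; otherwise division by `γ ≤ 1` can only increase a positive value.
  by_cases h0 : gradNorm p.conjExponent v = 0
  · rw [eq_const_of_gradNorm_eq_zero hN hq hv h0, hΦ0]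
    simp
  set γ := (gradNorm p.conjExponent v).toReal with hγ
  have hγt : gradNorm p.conjExponent v ≠ ∞ := ne_top_of_le_ne_top ENNReal.one_ne_top h1
  have hγ0 : 0 < γ := ENNReal.toReal_pos h0 hγt
  have hγ1 : γ ≤ 1 := by
    rw [hγ, ← ENNReal.toReal_one]
    exact ENNReal.toReal_mono ENNReal.one_ne_top h1
  have hmem := smul_mem_displacements hv γ⁻¹
  have hnorm : gradNorm p.conjExponent (fun x => γ⁻¹ • v x) = 1 := by
    rw [gradNorm_smul (isConvexCover_atomMesh hN) (hv.1.mono atomMesh_subset) hq,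
      abs_of_pos (inv_pos.2 hγ0), ENNReal.ofReal_inv_of_pos hγ0, hγ, ENNReal.ofReal_toReal hγt,
      ENNReal.inv_mul_cancel h0 hγt]
  have hle : ENNReal.ofReal (Φ fun x => γ⁻¹ • v x) ≤
      negNorm p (displacements (atomMeshExt d N flip)) Φ := by
    unfold negNorm
    exact le_iSup₂_of_le _ hmem (le_iSup_of_le hnorm le_rfl)
  refine le_trans ?_ hle
  rw [hΦ]
  rcases le_total (Φ v) 0 with hneg | hpos
  · rw [ENNReal.ofReal_of_nonpos hneg]
    exact zero_le
  · refine ENNReal.ofReal_le_ofReal ?_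
    have : 1 ≤ γ⁻¹ := (one_le_inv₀ hγ0).2 hγ1
    nlinarith

end Constant

/-! ### Continuity of piecewise affine functions on the atomistic mesh -/

section Continuity

variable {d N : ℕ} {flip : Bool}

theorem exists_mem_atomElement {x : Vec d} {z : Fin d → ℤ}
    (h : ∀ i, 0 ≤ x i / eps N - z i ∧ x i / eps N - z i ≤ 1) :
    ∃ π, x ∈ atomElement N flip z π := by
  set g := cellCoord flip (fun i => x i / eps N - z i)
  have hπ := Tuple.monotone_sort (fun i => -g i)
  exact ⟨Tuple.sort fun i => -g i, h, fun i j hij => neg_le_neg_iff.1 (hπ hij)⟩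

theorem convex_atomInterior (z : Fin d → ℤ) (π : Equiv.Perm (Fin d)) :
    Convex ℝ (atomInterior N flip z π) := by
  refine convex_iff_forall_pos.2 fun x hx y hy α β hα hβ h => ⟨fun i => ?_, fun i j hij => ?_⟩
  · have h1 := hx.1 i
    have h2 := hy.1 i
    have h3 : (α • x + β • y) i / eps N - z i =
        α * (x i / eps N - z i) + β * (y i / eps N - z i) := by
      simp only [PiLp.add_apply, PiLp.smul_apply, smul_eq_mul]
      obtain rfl : α = 1 - β := by linarith
      ring
    rw [h3]
    constructor <;> nlinarith [mul_pos hα h1.1, mul_pos hβ h2.1]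
  · have h1 := hx.2 hij
    have h2 := hy.2 hij
    simp only [cellCoord_combo flip z x y h]
    exact add_lt_add (mul_lt_mul_of_pos_left h1 hα) (mul_lt_mul_of_pos_left h2 hβ)

theorem ae_mem_atomInterior (hN : 0 < N) :
    ∀ᵐ x ∂(volume : Measure (Vec d)), ∀ z ∈ cells d N, ∀ π,
      x ∈ atomElement N flip z π → x ∈ atomInterior N flip z π := by
  refine (ae_ball_iff (cells d N).countable_toSet).2 fun z _ => ae_all_iff.2 fun π => ?_
  have h0 : ∀ᵐ x ∂(volume : Measure (Vec d)), x ∉ frontier (atomInterior N flip z π) :=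
    measure_eq_zero_iff_ae_notMem.1 ((convex_atomInterior z π).addHaar_frontier _)
  filter_upwards [h0] with x hx hxT
  by_contra hi
  refine hx ⟨atomElement_subset_closure hN z π hxT, ?_⟩
  rwa [(isOpen_atomInterior z π).interior_eq]

theorem ae_exists_mem_atomInterior (hN : 0 < N) :
    ∀ᵐ x ∂(volume.restrict (Omega d)), ∃ z ∈ cells d N, ∃ π, x ∈ atomInterior N flip z π := by
  rw [restrict_Omega, ae_restrict_iff' (isClosed_OmegaBar d).measurableSet]
  filter_upwards [ae_mem_atomInterior (flip := flip) hN] with x hx hxΩ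
  obtain ⟨T, hT, hxT⟩ := (isConvexCover_atomMesh (flip := flip) hN).covers hxΩ
  obtain ⟨z, hz, π, rfl⟩ := exists_mem_cells hN hT
  exact ⟨z, hz, π, hx z hz π hxT⟩

theorem locallyFinite_atomElement :
    LocallyFinite fun p : (Fin d → ℤ) × Equiv.Perm (Fin d) => atomElement N flip p.1 p.2 := by
  intro x
  refine ⟨{y : Vec d | ∀ i, y i / eps N ∈ Ioo (x i / eps N - 1) (x i / eps N + 1)}, ?_, ?_⟩
  · have hopen : IsOpen {y : Vec d | ∀ i, y i / eps N ∈ Ioo (x i / eps N - 1) (x i / eps N + 1)} := by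
      simp only [Set.ofPred_forall]
      refine isOpen_iInter_of_finite fun i => ?_
      exact isOpen_Ioo.preimage (by fun_prop : Continuous fun y : Vec d => y i / eps N)
    exact hopen.mem_nhds fun i => ⟨by linarith, by linarith⟩
  · refine (((Fintype.piFinset fun i => Finset.Icc (⌊x i / eps N⌋ - 3) (⌊x i / eps N⌋ + 3)) ×ˢ
      (Finset.univ : Finset (Equiv.Perm (Fin d)))).finite_toSet).subset ?_
    rintro ⟨z, π⟩ ⟨y, hy, hyx⟩
    simp only [Finset.coe_product, Finset.coe_univ, mem_prod, mem_univ, and_true]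
    refine Fintype.mem_piFinset.2 fun i => Finset.mem_Icc.2 ?_
    have h1 := hy.1 i
    have h2 := hyx i
    have h3 := Int.floor_le (x i / eps N)
    have h4 := Int.lt_floor_add_one (x i / eps N)
    have h5 : ((⌊x i / eps N⌋ : ℤ) : ℝ) < z i + 3 := by linarith [h1.2, h2.1]
    have h6 : (z i : ℝ) < (⌊x i / eps N⌋ : ℤ) + 3 := by linarith [h1.1, h2.2]
    have h7 : ⌊x i / eps N⌋ < z i + 3 := by exact_mod_cast h5
    have h8 : z i < ⌊x i / eps N⌋ + 3 := by exact_mod_cast h6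
    constructor <;> lia

/-- Continuity comes for free: the elements are a locally finite closed cover, and the function is
affine on each. -/
theorem isP1_of_affine {v : Vec d → Vec d}
    (h : ∀ (z : Fin d → ℤ) (π : Equiv.Perm (Fin d)), ∃ (L : Vec d →L[ℝ] Vec d) (b : Vec d),
      ∀ x ∈ atomElement N flip z π, v x = L x + b) : IsP1 (atomMeshExt d N flip) v := by
  refine ⟨?_, ?_⟩
  · refine (locallyFinite_atomElement (N := N) (flip := flip)).continuous ?_
      (fun p => isClosed_atomElement p.1 p.2) fun p => ?_
    · refine eq_univ_of_forall fun x => ?_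
      obtain ⟨π, hπ⟩ := exists_mem_atomElement (flip := flip) (x := x)
        (z := fun i => ⌊x i / eps N⌋) fun i =>
          ⟨sub_nonneg.2 (Int.floor_le _), (Int.fract_lt_one (x i / eps N)).le⟩
      exact mem_iUnion.2 ⟨(_, π), hπ⟩
    · obtain ⟨L, b, hL⟩ := h p.1 p.2
      exact (L.continuous.add continuous_const).continuousOn.congr hL
  · rintro T ⟨z, π, rfl⟩
    exact h z π

theorem floor_add_div (hN : 0 < N) (ξ : Fin d → ℤ) (x : Vec d) (i : Fin d) :
    ((2 : ℝ) • intVec ξ + x) i / eps N = x i / eps N + ((2 * N * ξ i : ℤ) : ℝ) := by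
  have hN' : (N : ℝ) ≠ 0 := by positivity
  simp [intVec, eps]
  ring

theorem latticePt_div (hN : 0 < N) (z : Fin d → ℤ) (i : Fin d) : latticePt N z i / eps N = z i := by
  have := (eps_pos hN).ne'
  simp [latticePt, intVec]
  field_simp

theorem latticePt_shift (hN : 0 < N) (ξ z : Fin d → ℤ) :
    latticePt N (fun i => z i + 2 * N * ξ i) = (2 : ℝ) • intVec ξ + latticePt N z := by
  ext i
  have hN' : (N : ℝ) ≠ 0 := by positivity
  simp [latticePt, intVec, eps]
  field_simp
  ring

/-- A point of a closed cell may lie on its upper face, where the floor already belongs to the next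
cell. The interpolants below are defined through floors and must be compared there. -/
theorem floor_cases {s : ℝ} {a : ℤ} (h : 0 ≤ s - a ∧ s - a ≤ 1) :
    ⌊s⌋ = a ∨ (⌊s⌋ = a + 1 ∧ s = a + 1) := by
  rcases h.2.lt_or_eq with h1 | h1
  · left
    rw [Int.floor_eq_iff]
    constructor <;> linarith
  · right
    have h2 : s = ((a + 1 : ℤ) : ℝ) := by push_cast; linarith
    refine ⟨?_, by push_cast at h2; exact h2⟩
    rw [h2, Int.floor_intCast]

end Continuity

/-! ### Interpolation in one dimension -/

section DimOne

variable {N : ℕ} {flip : Bool}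

theorem exists_interpolant_one (hN : 0 < N) {u : Vec 1 → Vec 1} (hu : IsPeriodic u) :
    ∃ v ∈ displacements (atomMeshExt 1 N flip),
      ∀ z : Fin 1 → ℤ, u (latticePt N z) = v (latticePt N z) := by
  set g : ℤ → Vec 1 := fun a => u (latticePt N fun _ => a) with hg
  set v : Vec 1 → Vec 1 := fun x => g ⌊x 0 / eps N⌋ +
    (x 0 / eps N - ⌊x 0 / eps N⌋) • (g (⌊x 0 / eps N⌋ + 1) - g ⌊x 0 / eps N⌋) with hv
  have hform : ∀ (x : Vec 1) (a : ℤ), 0 ≤ x 0 / eps N - a ∧ x 0 / eps N - a ≤ 1 →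
      v x = g a + (x 0 / eps N - a) • (g (a + 1) - g a) := by
    intro x a h
    simp only [hv]
    rcases floor_cases h with h1 | ⟨h1, h2⟩
    · rw [h1]
    · rw [h1, h2]
      push_cast
      module
  refine ⟨v, ⟨isP1_of_affine fun z π => ?_, fun ξ x => ?_⟩, fun z => ?_⟩
  · refine ⟨(eps N)⁻¹ • (EuclideanSpace.proj 0 : Vec 1 →L[ℝ] ℝ).smulRight (g (z 0 + 1) - g (z 0)),
      g (z 0) - (z 0 : ℝ) • (g (z 0 + 1) - g (z 0)), fun x hx => ?_⟩
    rw [hform x (z 0) (hx.1 0)]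
    simp only [_root_.smul_apply, ContinuousLinearMap.smulRight_apply, PiLp.proj_apply, smul_smul,
      div_eq_mul_inv, mul_comm (x.ofLp 0)]
    module
  · have hper : ∀ a : ℤ, g (a + 2 * N * ξ 0) = g a := by
      intro a
      simp only [hg]
      rw [← hu ξ (latticePt N fun _ => a), ← latticePt_shift hN]
      congr 2
      funext i
      rw [Subsingleton.elim i 0]
    simp only [hv]
    rw [floor_add_div hN, Int.floor_add_intCast, hper,
      show ⌊x 0 / eps N⌋ + 2 * N * ξ 0 + 1 = ⌊x 0 / eps N⌋ + 1 + 2 * N * ξ 0 by ring, hper]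
    push_cast
    congr 2
    ring
  · rw [hform _ (z 0) (by rw [latticePt_div hN]; simp), latticePt_div hN]
    simp only [hg, sub_self, zero_smul, add_zero]
    congr 2
    funext i
    rw [Subsingleton.elim i 0]

end DimOne

/-! ### Interpolation in two dimensions -/

section DimTwo

variable {N : ℕ} {flip : Bool}

/-- The correction of the affine function with prescribed values at three corners of a cell. -/
noncomputable def cellCorrection (flip : Bool) (s t : ℝ) : ℝ :=
  if flip = true then max 0 (s + t - 1) else min s t

theorem exists_interpolant_two (hN : 0 < N) {u : Vec 2 → Vec 2} (hu : IsPeriodic u) :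
    ∃ v ∈ displacements (atomMeshExt 2 N flip),
      ∀ z : Fin 2 → ℤ, u (latticePt N z) = v (latticePt N z) := by
  have he := eps_pos hN
  set g : ℤ → ℤ → Vec 2 := fun a b => u (latticePt N (idx 0 a b)) with hg
  -- The affine interpolant of three corners, plus a multiple of a function that vanishes at these
  -- corners, equals one at the fourth and is affine on each of the two triangles.
  set A : ℤ → ℤ → ℝ → ℝ → Vec 2 := fun a b s t => g a b + s • (g (a + 1) b - g a b) +
    t • (g a (b + 1) - g a b) +
    cellCorrection flip s t • (g (a + 1) (b + 1) - g (a + 1) b - g a (b + 1) + g a b) with hA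
  set v : Vec 2 → Vec 2 := fun x => A ⌊x 0 / eps N⌋ ⌊x 1 / eps N⌋
    (x 0 / eps N - ⌊x 0 / eps N⌋) (x 1 / eps N - ⌊x 1 / eps N⌋) with hv
  -- On a side of the cell only the two values at its ends matter, so the formulas of neighbouring
  -- cells agree there.
  have hA1 : ∀ a b t, 0 ≤ t → t ≤ 1 → A (a + 1) b 0 t = A a b 1 t := by
    intro a b t h0 h1
    have hc0 : cellCorrection flip 0 t = 0 := by
      unfold cellCorrection
      split_ifs
      · exact max_eq_left (by linarith)
      · exact min_eq_left h0
    have hc1 : cellCorrection flip 1 t = t := by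
      unfold cellCorrection
      split_ifs
      · rw [add_sub_cancel_left]; exact max_eq_right h0
      · exact min_eq_right h1
    simp only [hA, hc0, hc1]
    module
  have hA2 : ∀ a b s, 0 ≤ s → s ≤ 1 → A a (b + 1) s 0 = A a b s 1 := by
    intro a b s h0 h1
    have hc0 : cellCorrection flip s 0 = 0 := by
      unfold cellCorrection
      split_ifs
      · exact max_eq_left (by linarith)
      · exact min_eq_right h0
    have hc1 : cellCorrection flip s 1 = s := by
      unfold cellCorrection
      split_ifs
      · rw [add_sub_cancel_right]; exact max_eq_right h0
      · exact min_eq_left h1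
    simp only [hA, hc0, hc1]
    module
  have hform : ∀ (x : Vec 2) (a b : ℤ), 0 ≤ x 0 / eps N - a ∧ x 0 / eps N - a ≤ 1 →
      0 ≤ x 1 / eps N - b ∧ x 1 / eps N - b ≤ 1 →
      v x = A a b (x 0 / eps N - a) (x 1 / eps N - b) := by
    intro x a b ha hb
    simp only [hv]
    rcases floor_cases ha with h1 | ⟨h1, h2⟩ <;> rcases floor_cases hb with h3 | ⟨h3, h4⟩
    · rw [h1, h3]
    · rw [h1, h3, h4]
      push_cast
      rw [sub_self, add_sub_cancel_left]
      exact hA2 a b _ ha.1 ha.2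
    · rw [h1, h3, h2]
      push_cast
      rw [sub_self, add_sub_cancel_left]
      exact hA1 a b _ hb.1 hb.2
    · rw [h1, h3, h2, h4]
      push_cast
      rw [sub_self, sub_self, add_sub_cancel_left, add_sub_cancel_left,
        hA1 a (b + 1) 0 le_rfl zero_le_one, hA2 a b 1 zero_le_one le_rfl]
  have haff : ∀ (a b : ℤ) (T : Set (Vec 2)), (∀ x ∈ T, v x = A a b (x 0 / eps N - a)
      (x 1 / eps N - b)) → ∀ κ₀ κ₁ κ₂ : ℝ, (∀ x ∈ T, cellCorrection flip (x 0 / eps N - a)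
      (x 1 / eps N - b) = κ₀ + κ₁ * (x 0 / eps N) + κ₂ * (x 1 / eps N)) →
      ∃ (L : Vec 2 →L[ℝ] Vec 2) (b : Vec 2), ∀ x ∈ T, v x = L x + b := by
    intro a b T hT κ₀ κ₁ κ₂ hκ
    set D := g (a + 1) (b + 1) - g (a + 1) b - g a (b + 1) + g a b with hD
    refine ⟨(eps N)⁻¹ • (EuclideanSpace.proj 0 : Vec 2 →L[ℝ] ℝ).smulRight
        (g (a + 1) b - g a b + κ₁ • D) +
        (eps N)⁻¹ • (EuclideanSpace.proj 1 : Vec 2 →L[ℝ] ℝ).smulRight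
        (g a (b + 1) - g a b + κ₂ • D),
      g a b - (a : ℝ) • (g (a + 1) b - g a b) - (b : ℝ) • (g a (b + 1) - g a b) + κ₀ • D,
      fun x hx => ?_⟩
    rw [hT x hx]
    simp only [hA]
    rw [hκ x hx, ← hD]
    simp only [_root_.add_apply, _root_.smul_apply, ContinuousLinearMap.smulRight_apply,
      PiLp.proj_apply, smul_smul, div_eq_mul_inv, mul_comm (x.ofLp 0), mul_comm (x.ofLp 1)]
    module
  refine ⟨v, ⟨isP1_of_affine fun z π => ?_, fun ξ x => ?_⟩, fun z => ?_⟩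
  · have hcell : ∀ x ∈ atomElement N flip z π, v x = A (z 0) (z 1) (x 0 / eps N - z 0)
        (x 1 / eps N - z 1) := fun x hx => hform x _ _ (hx.1 0) (hx.1 1)
    have hπ : π = 1 ∨ π = Equiv.swap 0 1 :=
      (by decide : ∀ π : Equiv.Perm (Fin 2), π = 1 ∨ π = Equiv.swap 0 1) π
    have hc : ∀ x ∈ atomElement N flip z π,
        (π = 1 → cellCoord flip (fun i => x i / eps N - z i) 1 ≤
          cellCoord flip (fun i => x i / eps N - z i) 0) ∧
        (π = Equiv.swap 0 1 → cellCoord flip (fun i => x i / eps N - z i) 0 ≤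
          cellCoord flip (fun i => x i / eps N - z i) 1) := by
      intro x hx
      have h := antitone_fin_two.1 hx.2
      constructor <;> rintro rfl <;> simpa using h
    cases flip
    · rcases hπ with h | h
      · refine haff (z 0) (z 1) _ hcell (-z 1) 0 1 fun x hx => ?_
        have := (hc x hx).1 h
        simp [cellCoord] at this
        simp only [cellCorrection, Bool.false_eq_true, if_false]
        rw [min_eq_right (by linarith)]
        ring
      · refine haff (z 0) (z 1) _ hcell (-z 0) 1 0 fun x hx => ?_
        have := (hc x hx).2 h
        simp [cellCoord] at this
        simp only [cellCorrection, Bool.false_eq_true, if_false]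
        rw [min_eq_left (by linarith)]
        ring
    · rcases hπ with h | h
      · refine haff (z 0) (z 1) _ hcell 0 0 0 fun x hx => ?_
        have := (hc x hx).1 h
        simp [cellCoord] at this
        simp only [cellCorrection, if_true]
        rw [max_eq_left (by linarith)]
        ring
      · refine haff (z 0) (z 1) _ hcell (-z 0 - z 1 - 1) 1 1 fun x hx => ?_
        have := (hc x hx).2 h
        simp [cellCoord] at this
        simp only [cellCorrection, if_true]
        rw [max_eq_right (by linarith)]
        ring
  · have hper : ∀ a b : ℤ, g (a + 2 * N * ξ 0) (b + 2 * N * ξ 1) = g a b := by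
      intro a b
      simp only [hg]
      rw [← hu ξ (latticePt N (idx 0 a b)), ← latticePt_shift hN]
      congr 2
      funext i
      fin_cases i <;> simp [idx]
    simp only [hv, hA]
    have e0 : ⌊x 0 / eps N⌋ + 2 * N * ξ 0 + 1 = ⌊x 0 / eps N⌋ + 1 + 2 * N * ξ 0 := by ring
    have e1 : ⌊x 1 / eps N⌋ + 2 * N * ξ 1 + 1 = ⌊x 1 / eps N⌋ + 1 + 2 * N * ξ 1 := by ring
    rw [floor_add_div hN, floor_add_div hN, Int.floor_add_intCast, Int.floor_add_intCast, e0, e1,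
      hper, hper, hper, hper]
    push_cast
    simp only [add_sub_add_right_eq_sub]
  · have hz : z = idx 0 (z 0) (z 1) := by
      funext i
      fin_cases i <;> simp [idx]
    rw [hform _ (z 0) (z 1) (by rw [latticePt_div hN]; simp) (by rw [latticePt_div hN]; simp),
      latticePt_div hN, latticePt_div hN]
    have hc : cellCorrection flip 0 0 = 0 := by
      unfold cellCorrection
      split_ifs <;> norm_num
    simp only [hA, sub_self, zero_smul, add_zero, hc, hg]
    rw [← hz]

end DimTwo

/-! ### Stability of the interpolation in one dimension -/

theorem cell_bounds {N : ℕ} (hN : 0 < N) {b : ℤ} (hb : b ∈ Finset.Ico (-(N : ℤ)) N) :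
    -1 ≤ eps N * b ∧ eps N * b < eps N * (b + 1) ∧ eps N * (b + 1) ≤ 1 := by
  rw [Finset.mem_Ico] at hb
  have h1 := eps_mul_mem_Icc hN hb.1 hb.2.le
  have h2 := eps_mul_mem_Icc hN (by lia : -(N : ℤ) ≤ b + 1) hb.2
  have he := eps_pos hN
  push_cast at h2
  exact ⟨h1.1, by nlinarith, h2.2⟩

/-- Difference quotients over the lattice cells are bounded in `L^q` by the derivative. -/
theorem IsPiecewiseAffineOn.eLpNorm_quotient_le {ι : Type*} {s : Finset ι} {I : ι → Set ℝ}
    {m : ι → ℝ} {u : ℝ → ℝ} (h : IsPiecewiseAffineOn s I m u (-1) 1) {N : ℕ} (hN : 0 < N)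
    {q : ℝ≥0∞} (hq : 1 ≤ q) {w : ℝ → ℝ}
    (hw : ∀ b ∈ Finset.Ico (-(N : ℤ)) N, ∀ x ∈ Ioo (eps N * (b : ℝ)) (eps N * (b + 1)),
      w x = (u (eps N * (b + 1)) - u (eps N * b)) / eps N) :
    eLpNorm w q (volume.restrict (Ioc (-1) 1)) ≤
      eLpNorm (deriv u) q (volume.restrict (Ioc (-1) 1)) := by
  have he := eps_pos hN
  -- The difference quotient is the variation with the partition point at the left end of the cell.
  have hw' : ∀ b ∈ Finset.Ico (-(N : ℤ)) N, ∀ x ∈ Ioo (eps N * (b : ℝ)) (eps N * (b + 1)),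
      ‖w x‖ₑ = ENNReal.ofReal ((|u (eps N * b) - u (eps N * b)| +
        |u (eps N * (b + 1)) - u (eps N * b)|) / eps N) := by
    intro b hb x hx
    rw [hw b hb x hx, Real.enorm_eq_ofReal_abs, abs_div, abs_of_pos he]
    simp
  by_cases hqt : q = ∞
  · subst hqt
    rw [eLpNorm_exponent_top, eLpNorm_exponent_top]
    set S := eLpNormEssSup (deriv u) (volume.restrict (Ioc (-1) 1))
    refine eLpNormEssSup_le_of_ae_enorm_bound ?_
    filter_upwards [ae_mem_strip hN] with x ⟨b, hb, hx⟩
    obtain ⟨h1, h2, h3⟩ := cell_bounds hN hb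
    rw [hw' b hb x hx, ENNReal.ofReal_div_of_pos he]
    refine ENNReal.div_le_of_le_mul
      (((h.mono h1 h3).ofReal_variation_le (left_mem_Icc.2 h2.le)).trans ?_)
    calc _ ≤ ∫⁻ x in Ioc (eps N * b) (eps N * (b + 1)), S :=
          lintegral_mono_ae (ae_restrict_of_ae_restrict_of_subset (Ioc_subset_Ioc h1 h3)
            (enorm_ae_le_eLpNormEssSup _ _))
      _ = S * ENNReal.ofReal (eps N) := by
          rw [setLIntegral_const, Real.volume_Ioc]
          congr 2
          ring
  · have hq0 : q ≠ 0 := (one_pos.trans_le hq).ne'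
    have hqr : 1 ≤ q.toReal := by
      rw [← ENNReal.toReal_one]
      exact ENNReal.toReal_mono hqt hq
    rw [eLpNorm_eq_lintegral_rpow_enorm_toReal hq0 hqt,
      eLpNorm_eq_lintegral_rpow_enorm_toReal hq0 hqt, Ioc_eq_iUnion_cells hN,
      lintegral_biUnion_finset (pairwiseDisjoint_cells hN _) fun _ _ => measurableSet_Ioc,
      lintegral_biUnion_finset (pairwiseDisjoint_cells hN _) fun _ _ => measurableSet_Ioc]
    refine ENNReal.rpow_le_rpow (Finset.sum_le_sum fun b hb => ?_) (by positivity)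
    obtain ⟨h1, h2, h3⟩ := cell_bounds hN hb
    have hv := (h.mono h1 h3).ofReal_variation_rpow_le h2 (left_mem_Icc.2 h2.le) hqr
    rw [show eps N * (b + 1) - eps N * b = eps N by ring] at hv
    refine le_trans (le_of_eq ?_) hv
    rw [← restrict_Ioo_eq_restrict_Ioc, setLIntegral_congr_fun measurableSet_Ioo fun x hx => by
      rw [hw' b hb x hx], setLIntegral_const, Real.volume_Ioo,
      show eps N * (b + 1) - eps N * b = eps N by ring, mul_comm]

section DimOne

variable {N : ℕ} {flip : Bool}

/-- The identification of the line with `ℝ^1`. -/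
noncomputable def linePt (s : ℝ) : Vec 1 := s • basisVec 0

theorem linePt_apply (s : ℝ) (i : Fin 1) : linePt s i = s := by
  rw [Subsingleton.elim i 0]
  simp [linePt]

theorem measurePreserving_linePt : MeasurePreserving linePt := by
  have := (PiLp.volume_preserving_toLp (Fin 1)).comp
    ((volume_preserving_funUnique (Fin 1) ℝ).symm)
  convert! this using 1
  funext s
  ext i
  rw [linePt_apply]
  simp [MeasurableEquiv.funUnique]

theorem linePt_preimage_Omega : linePt ⁻¹' Omega 1 = Ioc (-1) 1 := by
  ext s
  simp [Omega, linePt_apply]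

theorem measurableSet_Omega (d : ℕ) : MeasurableSet (Omega d) := by
  have h : Omega d = ⋂ i, {x : Vec d | -1 < x i ∧ x i ≤ 1} := by ext; simp [Omega]
  rw [h]
  refine MeasurableSet.iInter fun i => ?_
  have hm : Measurable fun x : Vec d => x i := (by fun_prop : Continuous _).measurable
  exact hm measurableSet_Ioc

theorem measurePreserving_linePt_restrict :
    MeasurePreserving linePt (volume.restrict (Ioc (-1) 1)) (volume.restrict (Omega 1)) := by
  rw [← linePt_preimage_Omega]
  exact measurePreserving_linePt.restrict_preimage (measurableSet_Omega 1)

theorem deriv_linePt {u : Vec 1 → Vec 1} {s : ℝ} (hu : DifferentiableAt ℝ u (linePt s))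
    (c : Fin 1) : deriv (fun s => u (linePt s) c) s = pderiv u c 0 (linePt s) := by
  have hl : HasDerivAt linePt (basisVec 0) s := by
    have h0 := (hasDerivAt_id s).smul_const (basisVec (0 : Fin 1))
    rw [one_smul] at h0
    exact h0
  have h1 := hu.hasFDerivAt.comp_hasDerivAt s hl
  have h2 := (EuclideanSpace.proj c : Vec 1 →L[ℝ] ℝ).hasFDerivAt.comp_hasDerivAt s h1
  rw [pderiv_eq hu]
  exact h2.deriv

variable {𝒯 : Set (Set (Vec 1))} {u v : Vec 1 → Vec 1}

theorem ae_deriv_linePt (h𝒯 : IsConvexCover 𝒯) (hu : IsP1 𝒯 u) (c : Fin 1) :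
    ∀ᵐ s ∂(volume.restrict (Ioc (-1 : ℝ) 1)),
      deriv (fun s => u (linePt s) c) s = pderiv u c 0 (linePt s) := by
  filter_upwards [measurePreserving_linePt_restrict.quasiMeasurePreserving.ae
    (ae_differentiableAt h𝒯 hu)] with s hs using deriv_linePt hs c

theorem exists_line_isPiecewiseAffineOn (h𝒯 : IsConvexCover 𝒯) (hu : IsP1 𝒯 u) (c : Fin 1) :
    ∃ (I : Set (Vec 1) → Set ℝ) (m : Set (Vec 1) → ℝ),
      IsPiecewiseAffineOn h𝒯.finite.toFinset I m (fun s => u (linePt s) c) (-1) 1 := by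
  obtain ⟨L, hL⟩ := hu.exists_hasJacobians
  have h := (hL.comp_proj c).isPiecewiseAffineOn h𝒯 0 (basisVec 0) (A := -1) (B := 1)
    fun s hs i => by
      rw [zero_add]
      change -1 ≤ linePt s i ∧ linePt s i ≤ 1
      rw [linePt_apply]
      exact hs
  simp only [zero_add] at h
  exact ⟨_, _, h⟩

theorem latticePt_one (b : ℤ) : latticePt N (fun _ : Fin 1 => b) = linePt (eps N * b) := by
  ext i
  rw [linePt_apply]
  simp [latticePt, intVec]

theorem linePt_mem_atomInterior (hN : 0 < N) {b : ℤ} {s : ℝ}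
    (hs : s ∈ Ioo (eps N * (b : ℝ)) (eps N * (b + 1))) :
    linePt s ∈ atomInterior N flip (fun _ => b) 1 := by
  have he := eps_pos hN
  refine ⟨fun i => ?_, fun i j hij => absurd hij (by rw [Subsingleton.elim i j]; simp)⟩
  rw [linePt_apply, sub_pos, lt_div_iff₀ he, sub_lt_iff_lt_add, div_lt_iff₀ he]
  constructor <;> linarith [hs.1, hs.2]

theorem linePt_mem_atomElement (hN : 0 < N) {b : ℤ} {s : ℝ}
    (hs : s ∈ Icc (eps N * (b : ℝ)) (eps N * (b + 1))) :
    linePt s ∈ atomElement N flip (fun _ => b) 1 := by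
  have he := eps_pos hN
  refine ⟨fun i => ?_, fun i j _ => by rw [Subsingleton.elim i j]⟩
  rw [linePt_apply, sub_nonneg, le_div_iff₀ he, sub_le_iff_le_add, div_le_iff₀ he]
  constructor <;> linarith [hs.1, hs.2]

theorem cells_one {b : ℤ} (hb : b ∈ Finset.Ico (-(N : ℤ)) N) : (fun _ => b) ∈ cells 1 N :=
  Fintype.mem_piFinset.2 fun _ => hb

/-- On each cell `v'` is the mean of `u'`, so this is Hölder's inequality cell by cell. -/
theorem gradNorm_interpolant_le_one (hN : 0 < N) (h𝒯 : IsConvexCover 𝒯) (hu : IsP1 𝒯 u)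
    (hv : IsP1 (atomMeshExt 1 N flip) v)
    (huv : ∀ z : Fin 1 → ℤ, u (latticePt N z) = v (latticePt N z)) {q : ℝ≥0∞} (hq : 1 ≤ q) :
    gradNorm q v ≤ gradNorm q u := by
  have he := eps_pos hN
  have h𝒜 := isConvexCover_atomMesh (d := 1) (flip := flip) hN
  have hv' := hv.mono atomMesh_subset
  refine gradNorm_le_gradNorm h𝒜 hv' h𝒯 hu hq fun c j => ?_
  rw [Subsingleton.elim j 0]
  have htr : ∀ w : Vec 1 → Vec 1, eLpNorm (pderiv w c 0) q (volume.restrict (Omega 1)) =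
      eLpNorm (fun s => pderiv w c 0 (linePt s)) q (volume.restrict (Ioc (-1) 1)) := fun w =>
    (eLpNorm_comp_measurePreserving (measurable_pderiv w c 0).aestronglyMeasurable
      measurePreserving_linePt_restrict).symm
  obtain ⟨I, m, hline⟩ := exists_line_isPiecewiseAffineOn h𝒯 hu c
  obtain ⟨L, hL⟩ := hv'.exists_hasJacobians
  rw [htr v, htr u, ← eLpNorm_congr_ae (ae_deriv_linePt h𝒯 hu c)]
  refine hline.eLpNorm_quotient_le hN hq fun b hb x hx => ?_
  have hT := atomElement_mem_atomMesh (flip := flip) (π := 1) hN (cells_one hb)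
  have hd := hL.hasFDerivAt hT (atomInterior_subset_interior _ _ (linePt_mem_atomInterior hN hx))
  rw [pderiv_eq hd.differentiableAt, hd.fderiv]
  obtain ⟨w, hw⟩ := hL.affine _ hT
  have hlt : eps N * (b : ℝ) ≤ eps N * (b + 1) := (cell_bounds hN hb).2.1.le
  have h1 := hw _ (linePt_mem_atomElement (flip := flip) hN (left_mem_Icc.2 hlt))
  have h2 := hw _ (linePt_mem_atomElement (flip := flip) hN (right_mem_Icc.2 hlt))
  have e1 := huv fun _ => b
  have e2 := huv fun _ => b + 1
  rw [latticePt_one] at e1 e2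
  push_cast at e2
  rw [e1, e2, h1, h2, eq_div_iff he.ne']
  simp only [PiLp.add_apply, add_sub_add_right_eq_sub, linePt, map_smul, PiLp.smul_apply,
    smul_eq_mul]
  ring

end DimOne

/-! ### Stability of the interpolation in two dimensions -/

section DimTwo

variable {N : ℕ} {flip : Bool}

theorem eq_idx (j : Fin 2) (z : Fin 2 → ℤ) : z = idx j (z j) (z (1 - j)) := by
  funext i
  fin_cases j <;> fin_cases i <;> simp [idx]

theorem idx_mem_cells {j : Fin 2} {a b : ℤ} : idx j a b ∈ cells 2 N ↔
    a ∈ Finset.Ico (-(N : ℤ)) N ∧ b ∈ Finset.Ico (-(N : ℤ)) N := by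
  rw [cells, Fintype.mem_piFinset, forall_fin_two_iff j, idx_same, idx_other]

theorem lo_or_hi (flip : Bool) (j : Fin 2) (π : Equiv.Perm (Fin 2)) :
    π = loPerm flip j ∨ π = hiPerm flip j := by
  have := Finset.mem_univ π
  rw [univ_perm_fin_two flip j] at this
  simpa using this

theorem atomInterior_Ioo (hN : 0 < N) {d : ℕ} {z : Fin d → ℤ} {π : Equiv.Perm (Fin d)}
    {x : Vec d} (hx : x ∈ atomInterior N flip z π) (i : Fin d) :
    x i ∈ Ioo (eps N * z i) (eps N * (z i + 1)) := by
  have he := eps_pos hN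
  obtain ⟨h1, h2⟩ := hx.1 i
  rw [sub_pos, lt_div_iff₀ he] at h1
  rw [sub_lt_iff_lt_add, div_lt_iff₀ he] at h2
  constructor <;> linarith

theorem edgeFun_of_mem_lo (hN : 0 < N) {j : Fin 2} {f : Vec 2 → ℝ} {c : ℤ → ℤ → ℝ} {a b : ℤ}
    {x : Vec 2} (hx : x ∈ atomInterior N flip (idx j a b) (loPerm flip j)) :
    edgeFun N flip j f c x = lineVar N j f (eps N * a) (c a b) b := by
  have h1 := atomInterior_Ioo hN hx j
  have h2 := atomInterior_Ioo hN hx (1 - j)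
  have h3 := atomInterior_subset _ _ hx
  rw [idx_same] at h1
  rw [idx_other] at h2
  rw [← pt_eta j x, pt_mem_loTri hN] at h3
  rw [← pt_eta j x]
  exact edgeFun_lo hN (Ioo_subset_Ico_self h1) (Ioo_subset_Ico_self h2) h3.2.2

theorem edgeFun_of_mem_hi (hN : 0 < N) {j : Fin 2} {f : Vec 2 → ℝ} {c : ℤ → ℤ → ℝ} {a b : ℤ}
    {x : Vec 2} (hx : x ∈ atomInterior N flip (idx j a b) (hiPerm flip j)) :
    edgeFun N flip j f c x = lineVar N j f (eps N * (a + 1)) (c (a + 1) b) b := by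
  have h1 := atomInterior_Ioo hN hx j
  have h2 := atomInterior_Ioo hN hx (1 - j)
  rw [idx_same] at h1
  rw [idx_other] at h2
  have h3 : ¬ x j ≤ diag N flip a b (x (1 - j)) := by
    intro hle
    have h4 : x ∈ atomElement N flip (idx j a b) (loPerm flip j) := by
      rw [← pt_eta j x, pt_mem_loTri hN]
      exact ⟨Ioo_subset_Icc_self h1, Ioo_subset_Icc_self h2, hle⟩
    exact loPerm_ne_hiPerm flip j (atomElement_unique hx h4).2.symm
  rw [← pt_eta j x]
  exact edgeFun_hi hN (Ioo_subset_Ico_self h1) (Ioo_subset_Ico_self h2) (not_le.1 h3)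

theorem diag_mem {N : ℕ} {flip : Bool} {a b : ℤ} {t : ℝ}
    (ht : t ∈ Icc (eps N * (b : ℝ)) (eps N * (b + 1))) :
    diag N flip a b t ∈ Icc (eps N * (a : ℝ)) (eps N * (a + 1)) := by
  have h1 := ht.1
  have h2 := ht.2
  unfold diag
  split_ifs <;> constructor <;> linarith

/-- The side of the lower triangle at the lower side of the cell. -/
theorem pt_left_mem_lo (hN : 0 < N) {j : Fin 2} {a b : ℤ} {t : ℝ}
    (ht : t ∈ Icc (eps N * (b : ℝ)) (eps N * (b + 1))) :
    pt j (eps N * a) t ∈ atomElement N flip (idx j a b) (loPerm flip j) := by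
  have he := eps_pos hN
  exact (pt_mem_loTri hN).2 ⟨⟨le_rfl, by linarith⟩, ht, (diag_mem ht).1⟩

theorem pt_right_mem_hi (hN : 0 < N) {j : Fin 2} {a b : ℤ} {t : ℝ}
    (ht : t ∈ Icc (eps N * (b : ℝ)) (eps N * (b + 1))) :
    pt j (eps N * (a + 1)) t ∈ atomElement N flip (idx j a b) (hiPerm flip j) := by
  have he := eps_pos hN
  exact (pt_mem_hiTri hN).2 ⟨⟨by linarith, le_rfl⟩, ht, (diag_mem ht).2⟩

theorem pt_sub_other (j : Fin 2) (s t t' : ℝ) :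
    pt j s t = pt j s t' + (t - t') • basisVec (1 - j) := by
  rw [pt_eq_add_smul j s t, pt_eq_add_smul j s t']
  module

variable {v : Vec 2 → Vec 2}

/-- The transversal derivative is the difference quotient over the corresponding edge. -/
theorem abs_apply_le_lineVar (hN : 0 < N) {f : Vec 2 → ℝ} {c₀ : Fin 2} {j : Fin 2}
    {T : Set (Vec 2)} {L : Vec 2 →L[ℝ] Vec 2} {w : Vec 2}
    (hT : ∀ x ∈ T, v x = L x + w) {s c : ℝ} {b : ℤ}
    (h1 : pt j s (eps N * b) ∈ T) (h2 : pt j s (eps N * (b + 1)) ∈ T)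
    (e1 : f (pt j s (eps N * b)) = v (pt j s (eps N * b)) c₀)
    (e2 : f (pt j s (eps N * (b + 1))) = v (pt j s (eps N * (b + 1))) c₀) :
    |L (basisVec (1 - j)) c₀| ≤ lineVar N j f s c b := by
  have he := eps_pos hN
  have h3 : f (pt j s (eps N * (b + 1))) - f (pt j s (eps N * b)) =
      eps N * L (basisVec (1 - j)) c₀ := by
    rw [e1, e2, hT _ h1, hT _ h2, pt_sub_other j s (eps N * (b + 1)) (eps N * b)]
    simp only [map_add, map_smul, PiLp.add_apply, PiLp.smul_apply, smul_eq_mul]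
    ring
  rw [lineVar, le_div_iff₀ he, mul_comm, ← abs_of_pos he, ← abs_mul, abs_of_pos he, ← h3]
  calc _ = |(f (pt j s c) - f (pt j s (eps N * b))) +
        (f (pt j s (eps N * (b + 1))) - f (pt j s c))| := by congr 1; ring
    _ ≤ _ := abs_add_le _ _

/-- The lower triangle has a whole side on the wall `x_j = ε a` and the upper one on `x_j = ε (a +
1)`. The constant derivative of `v` is the difference quotient of `u` over that side, for any choice
of the partition points `c`. -/
theorem ae_abs_pderiv_le_edgeFun (hN : 0 < N) (hv : IsP1 (atomMeshExt 2 N flip) v)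
    {u : Vec 2 → Vec 2} (huv : ∀ z : Fin 2 → ℤ, u (latticePt N z) = v (latticePt N z))
    (c₀ j : Fin 2) (c : ℤ → ℤ → ℝ) : ∀ᵐ x ∂(volume.restrict (Omega 2)),
      |pderiv v c₀ (1 - j) x| ≤ edgeFun N flip j (fun x => u x c₀) c x := by
  have he := eps_pos hN
  obtain ⟨L, hL⟩ := (hv.mono atomMesh_subset).exists_hasJacobians
  filter_upwards [ae_exists_mem_atomInterior (flip := flip) hN] with x ⟨z, hz, π, hx⟩
  have hT := atomElement_mem_atomMesh (flip := flip) (π := π) hN hz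
  have hd := hL.hasFDerivAt hT (atomInterior_subset_interior _ _ hx)
  rw [pderiv_eq hd.differentiableAt, hd.fderiv]
  obtain ⟨w, hw⟩ := hL.affine _ hT
  obtain ⟨a, b, rfl⟩ : ∃ a b, z = idx j a b := ⟨_, _, eq_idx j z⟩
  have hval : ∀ a b : ℤ, u (pt j (eps N * a) (eps N * b)) c₀ =
      v (pt j (eps N * a) (eps N * b)) c₀ := fun a b => by
    rw [← latticePt_idx, huv]
  have hb0 : eps N * (b : ℝ) ∈ Icc (eps N * (b : ℝ)) (eps N * (b + 1)) :=
    ⟨le_rfl, by linarith⟩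
  have hb1 : eps N * ((b : ℝ) + 1) ∈ Icc (eps N * (b : ℝ)) (eps N * (b + 1)) :=
    ⟨by linarith, le_rfl⟩
  rcases lo_or_hi flip j π with rfl | rfl
  · rw [edgeFun_of_mem_lo hN hx]
    refine abs_apply_le_lineVar hN hw (pt_left_mem_lo hN hb0) (pt_left_mem_lo hN hb1)
      (hval a b) ?_
    have := hval a (b + 1)
    push_cast at this
    exact this
  · rw [edgeFun_of_mem_hi hN hx]
    refine abs_apply_le_lineVar hN hw (pt_right_mem_hi hN hb0) (pt_right_mem_hi hN hb1) ?_ ?_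
    · have := hval (a + 1) b
      push_cast at this
      exact this
    · have := hval (a + 1) (b + 1)
      push_cast at this
      exact this

/-- The constant is one whatever the shape of the coarse triangles, by `eLpNorm_edgeFun_le`. The
partition points are irrelevant here and are put at the lower ends of the edges. -/
theorem gradNorm_interpolant_le_two (hN : 0 < N) {Th : Set (Finset (Vec 2))}
    (h : IsPeriodicTriangulation N Th) {u : Vec 2 → Vec 2} (hu : IsP1 (elements Th) u)
    (hv : IsP1 (atomMeshExt 2 N flip) v)
    (huv : ∀ z : Fin 2 → ℤ, u (latticePt N z) = v (latticePt N z)) {q : ℝ≥0∞} (hq : 1 ≤ q) :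
    gradNorm q v ≤ gradNorm q u := by
  have he := eps_pos hN
  obtain ⟨L, hL⟩ := hu.exists_hasJacobians
  refine gradNorm_le_gradNorm (isConvexCover_atomMesh (flip := flip) hN) (hv.mono atomMesh_subset)
    (h.isConvexCover hN) hu hq fun c₀ i => ?_
  obtain ⟨j, rfl⟩ : ∃ j : Fin 2, i = 1 - j := ⟨1 - i, by fin_cases i <;> rfl⟩
  refine le_trans (eLpNorm_mono_ae ?_) (h.eLpNorm_edgeFun_le hN (hL.comp_proj c₀) flip j
    (fun _ b => eps N * b) (fun a b => ⟨le_rfl, by linarith⟩) hq)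
  filter_upwards [ae_abs_pderiv_le_edgeFun (flip := flip) hN hv huv c₀ j
    (fun _ b => eps N * b)] with x hx
  rwa [Real.norm_eq_abs, Real.norm_of_nonneg (edgeFun_nonneg hN _ _ _ _ _)]

end DimTwo

/-! ### Decomposition of the coupling error over the atomistic elements -/

variable {d N : ℕ} {flip : Bool}

/-- On a common element both functions are affine and agree at the vertices, which are lattice
points, hence on their convex hull. -/
theorem eq_on_of_mem_elements {Th : Set (Finset (Vec d))} (h : IsPeriodicTriangulation N Th)
    {u v : Vec d → Vec d} (hu : IsP1 (elements Th) u) (hv : IsP1 (atomMesh d N flip) v)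
    (huv : ∀ z : Fin d → ℤ, u (latticePt N z) = v (latticePt N z)) {K : Set (Vec d)}
    (hK : K ∈ elements Th) (hK' : K ∈ atomMesh d N flip) : ∀ x ∈ K, u x = v x := by
  obtain ⟨L, b, hL⟩ := hu.2 K hK
  obtain ⟨L', b', hL'⟩ := hv.2 K hK'
  obtain ⟨s, hs, rfl⟩ := hK
  have hconv : Convex ℝ {x : Vec d | (L - L') x = b' - b} := by
    intro x hx y hy α β _ _ hαβ
    simp only [mem_ofPred_eq, map_add, map_smul] at hx hy ⊢
    rw [hx, hy, ← add_smul, hαβ, one_smul]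
  have hsub : convexHull ℝ (s : Set (Vec d)) ⊆ {x : Vec d | (L - L') x = b' - b} := by
    refine convexHull_min (fun x hx => ?_) hconv
    obtain ⟨z, rfl⟩ := h.vertices_mem s hs x hx
    have h1 := hL _ (subset_convexHull ℝ _ hx)
    have h2 := hL' _ (subset_convexHull ℝ _ hx)
    rw [huv z, h2] at h1
    simp only [mem_ofPred_eq, _root_.sub_apply]
    rw [sub_eq_sub_iff_add_eq_add, ← h1, add_comm]
  intro x hx
  have h1 := hsub hx
  simp only [mem_ofPred_eq, _root_.sub_apply] at h1
  rw [hL x hx, hL' x hx, add_comm (L' x), ← sub_eq_sub_iff_add_eq_add, h1]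

/-- The dichotomy behind the localisation to the continuum part: either the element is available for
the oscillation, or `u - v` vanishes on it. -/
theorem IsPeriodicTriangulation.subset_region_or_eq {Th Tc Ti Ta : Set (Finset (Vec d))}
    (hN : 0 < N) (h : IsPeriodicTriangulation N Th) (hTh : Th = Tc ∪ Ti ∪ Ta)
    (hsub : elements Ta ∪ elements Ti ⊆ atomMesh d N flip)
    {u v : Vec d → Vec d} (hu : IsP1 (elements Th) u) (hv : IsP1 (atomMesh d N flip) v)
    (huv : ∀ z : Fin d → ℤ, u (latticePt N z) = v (latticePt N z)) {K : Set (Vec d)}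
    (hK : K ∈ atomMesh d N flip) : K ⊆ region Tc ∨ ∀ x ∈ K, u x = v x :=
  (subset_region_or_mem hN h hTh hsub hK).imp_right fun hK' =>
    eq_on_of_mem_elements h hu hv huv hK' hK

theorem exists_shift_mem_cells (hN : 0 < N) (z : Fin d → ℤ) :
    ∃ ξ : Fin d → ℤ, z + (2 * (N : ℤ)) • ξ ∈ cells d N := by
  refine ⟨fun i => -((z i + N) / (2 * N)), ?_⟩
  rw [cells, Fintype.mem_piFinset]
  intro i
  have hN' : (0 : ℤ) < 2 * N := by omega
  have h1 := Int.emod_nonneg (z i + N) hN'.ne'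
  have h2 := Int.emod_lt_of_pos (z i + N) hN'
  have h3 := Int.mul_ediv_add_emod (z i + N) (2 * N)
  simp only [Pi.add_apply, Pi.smul_apply, smul_eq_mul, Finset.mem_Ico, mul_neg]
  constructor <;> linarith

theorem subset_perExt_of_shift_subset {ξ : Fin d → ℤ} {K S : Set (Vec d)} (h : shift ξ K ⊆ S) :
    K ⊆ perExt S := by
  intro x hx
  refine mem_iUnion.2 ⟨-ξ, (2 : ℝ) • intVec ξ + x, h ⟨x, hx, rfl⟩, ?_⟩
  ext i
  simp [intVec]

/-- Neighbours of an element of `[-1, 1]^d` may lie outside; a translation by a period brings them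
back to where the dichotomy is known. -/
theorem subset_perExt_or_eq (hN : 0 < N) {S : Set (Vec d)} {u v : Vec d → Vec d}
    (hup : IsPeriodic u) (hvp : IsPeriodic v)
    (hdich : ∀ K ∈ atomMesh d N flip, K ⊆ S ∨ ∀ x ∈ K, u x = v x) (z : Fin d → ℤ)
    (π : Equiv.Perm (Fin d)) :
    atomElement N flip z π ⊆ perExt S ∨ ∀ x ∈ atomElement N flip z π, u x = v x := by
  obtain ⟨ξ, hξ⟩ := exists_shift_mem_cells hN z
  have hK := atomElement_mem_atomMesh (flip := flip) (π := π) hN hξ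
  rw [← shift_atomElement hN] at hK
  refine (hdich _ hK).imp subset_perExt_of_shift_subset fun h x hx => ?_
  rw [← hup ξ x, ← hvp ξ x]
  exact h _ ⟨x, hx, rfl⟩

theorem atomElement_ae_eq_atomInterior (hN : 0 < N) {z : Fin d → ℤ} (hz : z ∈ cells d N)
    (π : Equiv.Perm (Fin d)) :
    atomElement N flip z π =ᵐ[volume] atomInterior N flip z π := by
  filter_upwards [ae_mem_atomInterior (flip := flip) (d := d) hN] with x hx
  exact propext ⟨fun h => hx z hz π h, fun h => atomInterior_subset z π h⟩

theorem integral_OmegaBar_eq_sum (hN : 0 < N) {φ : Vec d → ℝ}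
    (hφ : IntegrableOn φ (OmegaBar d)) :
    ∫ x in OmegaBar d, φ x = ∑ z ∈ cells d N, ∑ π, ∫ x in atomInterior N flip z π, φ x := by
  have hae : (OmegaBar d : Set (Vec d)) =ᵐ[volume]
      ⋃ p ∈ cells d N ×ˢ (Finset.univ : Finset (Equiv.Perm (Fin d))),
        atomInterior N flip p.1 p.2 := by
    have h1 := (ae_restrict_iff' (isClosed_OmegaBar d).measurableSet).1
      (restrict_Omega d ▸ ae_exists_mem_atomInterior (flip := flip) (d := d) hN)
    filter_upwards [h1] with x hx
    refine propext ⟨fun h => ?_, fun h => ?_⟩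
    · obtain ⟨z, hz, π, hzπ⟩ := hx h
      exact mem_iUnion₂.2 ⟨(z, π), by simp [hz], hzπ⟩
    · obtain ⟨⟨z, π⟩, hz, hzπ⟩ := mem_iUnion₂.1 h
      simp only [Finset.mem_product, Finset.mem_univ, and_true] at hz
      exact (atomElement_subset_OmegaBar_iff hN).2 hz (atomInterior_subset z π hzπ)
  rw [setIntegral_congr_set hae, integral_biUnion_finset, Finset.sum_product]
  · exact fun p _ => (isOpen_atomInterior p.1 p.2).measurableSet
  · intro p _ p' _ hne
    refine disjoint_left.2 fun x hx hx' => hne ?_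
    obtain ⟨h1, h2⟩ := atomElement_unique hx (atomInterior_subset _ _ hx')
    exact Prod.ext h1 h2
  · intro p hp
    simp only [Finset.mem_product, Finset.mem_univ, and_true] at hp
    exact hφ.mono_set ((atomInterior_subset _ _).trans
      ((atomElement_subset_OmegaBar_iff hN).2 hp))

theorem integrableOn_pderiv {𝒯 : Set (Set (Vec d))} (h𝒯 : IsConvexCover 𝒯) {v : Vec d → Vec d}
    (hv : IsP1 𝒯 v) (c j : Fin d) {S : Set (Vec d)} (hS : S ⊆ OmegaBar d) :
    IntegrableOn (pderiv v c j) S := by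
  refine (integrable_comp_gradients h𝒯 hv h𝒯 hv (fun F => F.2 (basisVec j) c) hS).congr ?_
  filter_upwards [ae_restrict_of_subset_OmegaBar hS (ae_pderiv_eq h𝒯 hv)] with x hx
  exact (hx c j).symm

theorem HasJacobians.fderiv_eq {𝒯 : Set (Set (Vec d))} {y : Vec d → Vec d}
    {F : Set (Vec d) → Vec d →L[ℝ] Vec d} (hy : HasJacobians 𝒯 y F) {z : Fin d → ℤ}
    {π : Equiv.Perm (Fin d)} (hK : atomElement N flip z π ∈ 𝒯) {x : Vec d}
    (hx : x ∈ atomInterior N flip z π) : fderiv ℝ y x = F (atomElement N flip z π) :=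
  (hy.hasFDerivAt hK (atomInterior_subset_interior z π hx)).fderiv

/-- Outside `S` the gradients of `u` and `v` agree almost everywhere, so the domain of integration
may be enlarged to `[-1, 1]^d` and cut into atomistic elements. There `∇y` is constant, and `∇u -
∇v` is expanded in matrix units. -/
theorem integral_sub_integral_eq_sum (hN : 0 < N) {𝒯 : Set (Set (Vec d))} (h𝒯 : IsConvexCover 𝒯)
    {y u v : Vec d → Vec d} {F : Set (Vec d) → Vec d →L[ℝ] Vec d}
    (hyP : IsP1 (atomMesh d N flip) y) (hy : HasJacobians (atomMesh d N flip) y F)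
    (hu : IsP1 𝒯 u) (hv : IsP1 (atomMesh d N flip) v) {S : Set (Vec d)} (hS : S ⊆ OmegaBar d)
    (hdich : ∀ K ∈ atomMesh d N flip, K ⊆ S ∨ ∀ x ∈ K, u x = v x)
    (Λ : (Vec d →L[ℝ] Vec d) → (Vec d →L[ℝ] Vec d) →L[ℝ] ℝ) :
    (∫ x in S, Λ (fderiv ℝ y x) (fderiv ℝ u x)) - ∫ x in S, Λ (fderiv ℝ y x) (fderiv ℝ v x) =
      ∑ z ∈ cells d N, ∑ π, ∑ c, ∑ j, Λ (F (atomElement N flip z π)) (matrixUnit c j) *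
        ∫ x in atomElement N flip z π, (pderiv u c j x - pderiv v c j x) := by
  have hA := isConvexCover_atomMesh (d := d) (flip := flip) hN
  have hint : ∀ {S : Set (Vec d)}, S ⊆ OmegaBar d →
      IntegrableOn (fun x => Λ (fderiv ℝ y x) (fderiv ℝ u x)) S ∧
      IntegrableOn (fun x => Λ (fderiv ℝ y x) (fderiv ℝ v x)) S := fun hS =>
    ⟨integrable_comp_gradients hA hyP h𝒯 hu (fun F => Λ F.1 F.2) hS,
      integrable_comp_gradients hA hyP hA hv (fun F => Λ F.1 F.2) hS⟩
  rw [← integral_sub (hint hS).1 (hint hS).2]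
  have hext : ∫ x in S, (Λ (fderiv ℝ y x) (fderiv ℝ u x) - Λ (fderiv ℝ y x) (fderiv ℝ v x)) =
      ∫ x in OmegaBar d,
        (Λ (fderiv ℝ y x) (fderiv ℝ u x) - Λ (fderiv ℝ y x) (fderiv ℝ v x)) := by
    refine (setIntegral_eq_of_subset_of_ae_sdiff_eq_zero
      (isClosed_OmegaBar d).measurableSet.nullMeasurableSet hS ?_).symm
    have h1 := (ae_restrict_iff' (isClosed_OmegaBar d).measurableSet).1
      (restrict_Omega d ▸ ae_exists_mem_atomInterior (flip := flip) (d := d) hN)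
    filter_upwards [h1] with x hx hxS
    obtain ⟨z, hz, π, hzπ⟩ := hx hxS.1
    have heq : ∀ x ∈ atomElement N flip z π, u x = v x :=
      (hdich _ (atomElement_mem_atomMesh hN hz)).resolve_left fun h =>
        hxS.2 (h (atomInterior_subset z π hzπ))
    have hev : u =ᶠ[nhds x] v := by
      filter_upwards [(isOpen_atomInterior z π).mem_nhds hzπ] with x' hx'
      exact heq x' (atomInterior_subset z π hx')
    rw [hev.fderiv_eq, sub_self]
  rw [hext, integral_OmegaBar_eq_sum (flip := flip) hN
    (φ := fun x => Λ (fderiv ℝ y x) (fderiv ℝ u x) - Λ (fderiv ℝ y x) (fderiv ℝ v x))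
    ((hint subset_rfl).1.sub (hint subset_rfl).2)]
  refine Finset.sum_congr rfl fun z hz => Finset.sum_congr rfl fun π _ => ?_
  have hsub : atomInterior N flip z π ⊆ OmegaBar d :=
    (atomInterior_subset z π).trans ((atomElement_subset_OmegaBar_iff hN).2 hz)
  have hI : ∀ c j, IntegrableOn (fun x => pderiv u c j x - pderiv v c j x)
      (atomInterior N flip z π) := fun c j =>
    (integrableOn_pderiv h𝒯 hu c j hsub).sub (integrableOn_pderiv hA hv c j hsub)
  simp_rw [setIntegral_congr_set (atomElement_ae_eq_atomInterior (flip := flip) hN hz π),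
    ← integral_const_mul]
  have h2 : ∀ c, (∑ j, ∫ x in atomInterior N flip z π,
      Λ (F (atomElement N flip z π)) (matrixUnit c j) * (pderiv u c j x - pderiv v c j x)) =
      ∫ x in atomInterior N flip z π, ∑ j,
        Λ (F (atomElement N flip z π)) (matrixUnit c j) * (pderiv u c j x - pderiv v c j x) :=
    fun c => (integral_finsetSum _ fun j _ => (hI c j).const_mul _).symm
  simp_rw [h2]
  rw [← integral_finsetSum _ fun c _ => integrable_finsetSum _ fun j _ => (hI c j).const_mul _]
  refine setIntegral_congr_ae (isOpen_atomInterior z π).measurableSet ?_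
  have h3 := (ae_restrict_iff' (isOpen_atomInterior z π).measurableSet).1
    (ae_restrict_of_subset_OmegaBar hsub ((ae_pderiv_eq h𝒯 hu).and (ae_pderiv_eq hA hv)))
  filter_upwards [h3] with x hx hxK
  obtain ⟨hxu, hxv⟩ := hx hxK
  rw [hy.fderiv_eq (atomElement_mem_atomMesh hN hz) hxK, ← map_sub,
    eq_sum_matrixUnit (fderiv ℝ u x - fderiv ℝ v x)]
  simp only [map_sum, map_smul, smul_eq_mul, _root_.sub_apply, PiLp.sub_apply, hxu, hxv]
  exact Finset.sum_congr rfl fun c _ => Finset.sum_congr rfl fun j _ => mul_comm _ _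

/-! ### One dimension: the coupling error vanishes -/

theorem measurableEmbedding_linePt : MeasurableEmbedding linePt := by
  have hc : Continuous linePt := by
    unfold linePt
    fun_prop
  refine hc.measurableEmbedding fun s t h => ?_
  rw [← linePt_apply s 0, h, linePt_apply]

theorem integral_pderiv_one (hN : 0 < N) {𝒯 : Set (Set (Vec 1))} (h𝒯 : IsConvexCover 𝒯)
    {u : Vec 1 → Vec 1} (hu : IsP1 𝒯 u) {b : ℤ} (hb : b ∈ Finset.Ico (-(N : ℤ)) N) (c : Fin 1) :
    ∫ x in atomElement N flip (fun _ => b) 1, pderiv u c 0 x =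
      u (latticePt N fun _ => b + 1) c - u (latticePt N fun _ => b) c := by
  obtain ⟨h1, h2, h3⟩ := cell_bounds hN hb
  have hpre : linePt ⁻¹' atomInterior N flip (fun _ => b) 1 =
      Ioo (eps N * (b : ℝ)) (eps N * (b + 1)) := by
    ext s
    exact ⟨fun hs => by simpa [linePt_apply] using atomInterior_Ioo hN hs 0,
      fun hs => linePt_mem_atomInterior hN hs⟩
  rw [setIntegral_congr_set (atomElement_ae_eq_atomInterior (flip := flip) hN (cells_one hb) 1),
    ← measurePreserving_linePt.setIntegral_preimage_emb measurableEmbedding_linePt, hpre,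
    ← integral_Ioc_eq_integral_Ioo]
  obtain ⟨I, m, hI⟩ := exists_line_isPiecewiseAffineOn h𝒯 hu c
  have h4 := (hI.mono h1 h3).integral_deriv h2.le
  rw [intervalIntegral.integral_of_le h2.le] at h4
  rw [latticePt_one, latticePt_one, Int.cast_add, Int.cast_one, ← h4]
  refine setIntegral_congr_ae measurableSet_Ioc ?_
  filter_upwards [(ae_restrict_iff' measurableSet_Ioc).1 (ae_deriv_linePt h𝒯 hu c)] with s hs hs'
  exact (hs ⟨h1.trans_lt hs'.1, hs'.2.trans h3⟩).symm

/-- The integral of `u' - v'` over a cell is a difference of values at lattice points, where `u =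
v`, and the stress is constant on the cell. -/
theorem integral_sub_integral_eq_zero_one (hN : 0 < N) {𝒯 : Set (Set (Vec 1))}
    (h𝒯 : IsConvexCover 𝒯) {y u v : Vec 1 → Vec 1} (hy : IsP1 (atomMesh 1 N flip) y)
    (hu : IsP1 𝒯 u) (hv : IsP1 (atomMesh 1 N flip) v)
    (huv : ∀ z : Fin 1 → ℤ, u (latticePt N z) = v (latticePt N z))
    {S : Set (Vec 1)} (hS : S ⊆ OmegaBar 1)
    (hdich : ∀ K ∈ atomMesh 1 N flip, K ⊆ S ∨ ∀ x ∈ K, u x = v x)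
    (Λ : (Vec 1 →L[ℝ] Vec 1) → (Vec 1 →L[ℝ] Vec 1) →L[ℝ] ℝ) :
    (∫ x in S, Λ (fderiv ℝ y x) (fderiv ℝ u x)) -
      ∫ x in S, Λ (fderiv ℝ y x) (fderiv ℝ v x) = 0 := by
  obtain ⟨F, hF⟩ := hy.exists_hasJacobians
  have hA := isConvexCover_atomMesh (d := 1) (flip := flip) hN
  rw [integral_sub_integral_eq_sum hN h𝒯 hy hF hu hv hS hdich Λ]
  refine Finset.sum_eq_zero fun z hz => Finset.sum_eq_zero fun π _ =>
    Finset.sum_eq_zero fun c _ => Finset.sum_eq_zero fun j _ => ?_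
  have hsub := (atomElement_subset_OmegaBar_iff (flip := flip) (π := π) hN).2 hz
  obtain rfl : π = 1 := Subsingleton.elim _ _
  obtain rfl : j = 0 := Subsingleton.elim _ _
  obtain ⟨b, rfl⟩ : ∃ b : ℤ, z = fun _ => b := ⟨z 0, by ext i; rw [Subsingleton.elim i 0]⟩
  have hb : b ∈ Finset.Ico (-(N : ℤ)) N := (Fintype.mem_piFinset.1 hz) 0
  rw [integral_sub (integrableOn_pderiv h𝒯 hu c 0 hsub) (integrableOn_pderiv hA hv c 0 hsub),
    integral_pderiv_one hN h𝒯 hu hb, integral_pderiv_one hN hA hv hb, huv, huv, sub_self,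
    mul_zero]

/-! ### Green's formula on the atomistic triangles -/

section Green

variable {N : ℕ} {flip : Bool}

theorem integral_eq_integral_pt (j : Fin 2) {K : Set (Vec 2)} (hK : MeasurableSet K) {A B : ℝ}
    {α β : ℝ → ℝ} (hmem : ∀ s t, pt j s t ∈ K ↔ t ∈ Icc A B ∧ s ∈ Icc (α t) (β t))
    {g : Vec 2 → ℝ} (hg : IntegrableOn g K) :
    ∫ x in K, g x = ∫ t in Icc A B, ∫ s in Icc (α t) (β t), g (pt j s t) := by
  have hmp := measurePreserving_ptEquiv (1 - j)
  have hint : Integrable (fun p : ℝ × ℝ => K.indicator g (ptEquiv (1 - j) p)) :=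
    (hmp.integrable_comp_emb (ptEquiv (1 - j)).measurableEmbedding).2
      ((integrable_indicator_iff hK).2 hg)
  rw [← integral_indicator hK, ← hmp.integral_comp' (g := K.indicator g),
    Measure.volume_eq_prod, integral_prod _ hint, ← integral_indicator measurableSet_Icc]
  refine integral_congr_ae (ae_of_all _ fun t => ?_)
  have hpt : ∀ s, K.indicator g (ptEquiv (1 - j) (t, s)) = K.indicator g (pt j s t) := fun s => by
    rw [← pt_swap j s t]
    rfl
  simp only [hpt]
  by_cases ht : t ∈ Icc A B
  · rw [indicator_of_mem ht, ← integral_indicator measurableSet_Icc]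
    refine integral_congr_ae (ae_of_all _ fun s => ?_)
    by_cases hs : s ∈ Icc (α t) (β t)
    · rw [indicator_of_mem hs]
      exact indicator_of_mem ((hmem s t).2 ⟨ht, hs⟩) g
    · rw [indicator_of_notMem hs]
      exact indicator_of_notMem (fun h => hs ((hmem s t).1 h).2) g
  · rw [indicator_of_notMem ht]
    refine integral_eq_zero_of_ae (ae_of_all _ fun s => ?_)
    exact indicator_of_notMem (fun h => ht ((hmem s t).1 h).1) _

theorem deriv_pt {u : Vec 2 → Vec 2} {j : Fin 2} {s t : ℝ}
    (hu : DifferentiableAt ℝ u (pt j s t)) (c : Fin 2) :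
    deriv (fun s => u (pt j s t) c) s = pderiv u c j (pt j s t) := by
  have h1 : HasDerivAt (fun s => pt j s t) (basisVec j) s := by
    have h := ((hasDerivAt_id s).smul_const (basisVec j)).const_add (pt j 0 t)
    rw [one_smul] at h
    exact h.congr_of_eventuallyEq (Filter.Eventually.of_forall fun s => pt_eq_add_smul' j s t)
  have h2 : DifferentiableAt ℝ (fun x => u x c) (pt j s t) :=
    (EuclideanSpace.proj c : Vec 2 →L[ℝ] ℝ).differentiableAt.comp _ hu
  exact (h2.hasFDerivAt.comp_hasDerivAt s h1).deriv

/-- Green's formula by Fubini along the lines in the direction `j`. Sides parallel to `e_j` do not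
contribute, and on almost every line the function is differentiable almost everywhere. -/
theorem integral_pderiv_two {𝒯 : Set (Set (Vec 2))} (h𝒯 : IsConvexCover 𝒯) {u : Vec 2 → Vec 2}
    (hu : IsP1 𝒯 u) (c j : Fin 2) {K : Set (Vec 2)} (hK : MeasurableSet K)
    (hsub : K ⊆ OmegaBar 2) {A B : ℝ} {α β : ℝ → ℝ}
    (hmem : ∀ s t, pt j s t ∈ K ↔ t ∈ Icc A B ∧ s ∈ Icc (α t) (β t))
    (hαβ : ∀ t ∈ Icc A B, α t ≤ β t) :
    ∫ x in K, pderiv u c j x =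
      ∫ t in Icc A B, (u (pt j (β t) t) c - u (pt j (α t) t) c) := by
  rw [integral_eq_integral_pt j hK hmem (integrableOn_pderiv h𝒯 hu c j hsub)]
  obtain ⟨L, hL⟩ := hu.exists_hasJacobians
  have h1 := (ae_restrict_iff' (isClosed_OmegaBar 2).measurableSet).1
    (restrict_Omega 2 ▸ ae_differentiableAt h𝒯 hu)
  have h2 := (measurePreserving_ptEquiv (1 - j)).quasiMeasurePreserving.ae h1
  rw [Measure.volume_eq_prod] at h2
  refine setIntegral_congr_ae measurableSet_Icc ?_
  filter_upwards [Measure.ae_ae_of_ae_prod h2] with t ht htAB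
  have hα := (pt_mem_OmegaBar.1 (hsub ((hmem (α t) t).2 ⟨htAB, left_mem_Icc.2 (hαβ t htAB)⟩)))
  have hβ := (pt_mem_OmegaBar.1 (hsub ((hmem (β t) t).2 ⟨htAB, right_mem_Icc.2 (hαβ t htAB)⟩)))
  have hline := ((hL.comp_proj c).line h𝒯 (1 - j) hα.2).mono hα.1.1 hβ.1.2
  have h3 := hline.integral_deriv (hαβ t htAB)
  simp only [pt_swap] at h3
  rw [← h3, intervalIntegral.integral_of_le (hαβ t htAB), ← integral_Icc_eq_integral_Ioc]
  refine setIntegral_congr_ae measurableSet_Icc ?_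
  filter_upwards [ht] with s hs hsαβ
  have h4 : pt j s t ∈ OmegaBar 2 :=
    pt_mem_OmegaBar.2 ⟨⟨hα.1.1.trans hsαβ.1, hsαβ.2.trans hβ.1.2⟩, hα.2⟩
  have h5 : DifferentiableAt ℝ u (pt j s t) := by
    have := hs (by change pt (1 - j) t s ∈ _; rwa [pt_swap])
    change DifferentiableAt ℝ u (pt (1 - j) t s) at this
    rwa [pt_swap] at this
  exact (deriv_pt h5 c).symm

theorem continuous_diag (N : ℕ) (flip : Bool) (a b : ℤ) : Continuous (diag N flip a b) := by
  unfold diag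
  split_ifs <;> fun_prop

/-- The integral of `w` over the left edge of the cell `(a, b)`, in terms of the transversal
coordinate. -/
noncomputable def wallIntegral (N : ℕ) (j : Fin 2) (w : Vec 2 → ℝ) (a b : ℤ) : ℝ :=
  ∫ t in Icc (eps N * (b : ℝ)) (eps N * (b + 1)), w (pt j (eps N * a) t)

/-- The integral of `w` over the diagonal of the cell `(a, b)`, in terms of the transversal
coordinate. -/
noncomputable def diagIntegral (N : ℕ) (flip : Bool) (j : Fin 2) (w : Vec 2 → ℝ) (a b : ℤ) : ℝ :=
  ∫ t in Icc (eps N * (b : ℝ)) (eps N * (b + 1)), w (pt j (diag N flip a b t) t)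

variable {𝒯 : Set (Set (Vec 2))} {u v : Vec 2 → Vec 2}

theorem integral_lo (hN : 0 < N) (h𝒯 : IsConvexCover 𝒯) (hu : IsP1 𝒯 u)
    (hv : IsP1 (atomMesh 2 N flip) v) (c j : Fin 2) {a b : ℤ} (hab : idx j a b ∈ cells 2 N) :
    ∫ x in atomElement N flip (idx j a b) (loPerm flip j), (pderiv u c j x - pderiv v c j x) =
      diagIntegral N flip j (fun x => u x c - v x c) a b -
        wallIntegral N j (fun x => u x c - v x c) a b := by
  have hA := isConvexCover_atomMesh (d := 2) (flip := flip) hN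
  have hsub := (atomElement_subset_OmegaBar_iff (flip := flip) (π := loPerm flip j) hN).2 hab
  have hmem : ∀ s t, pt j s t ∈ atomElement N flip (idx j a b) (loPerm flip j) ↔
      t ∈ Icc (eps N * (b : ℝ)) (eps N * (b + 1)) ∧
        s ∈ Icc (eps N * (a : ℝ)) (diag N flip a b t) := fun s t => by
    rw [pt_mem_loTri hN]
    exact ⟨fun h => ⟨h.2.1, h.1.1, h.2.2⟩,
      fun h => ⟨⟨h.2.1, h.2.2.trans (diag_mem h.1).2⟩, h.1, h.2.2⟩⟩
  have hm := (isClosed_atomElement (N := N) (flip := flip) (idx j a b)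
    (loPerm flip j)).measurableSet
  have hpt := continuous_pt j
  have hd := continuous_diag N flip a b
  have hcu := hu.1
  have hcv := hv.1
  rw [integral_sub (integrableOn_pderiv h𝒯 hu c j hsub) (integrableOn_pderiv hA hv c j hsub),
    integral_pderiv_two h𝒯 hu c j hm hsub hmem fun t ht => (diag_mem ht).1,
    integral_pderiv_two hA hv c j hm hsub hmem fun t ht => (diag_mem ht).1, diagIntegral,
    wallIntegral, ← integral_sub, ← integral_sub]
  · exact integral_congr_ae (ae_of_all _ fun t => by ring)
  all_goals exact Continuous.integrableOn_Icc (by fun_prop)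

theorem integral_hi (hN : 0 < N) (h𝒯 : IsConvexCover 𝒯) (hu : IsP1 𝒯 u)
    (hv : IsP1 (atomMesh 2 N flip) v) (c j : Fin 2) {a b : ℤ} (hab : idx j a b ∈ cells 2 N) :
    ∫ x in atomElement N flip (idx j a b) (hiPerm flip j), (pderiv u c j x - pderiv v c j x) =
      wallIntegral N j (fun x => u x c - v x c) (a + 1) b -
        diagIntegral N flip j (fun x => u x c - v x c) a b := by
  have hA := isConvexCover_atomMesh (d := 2) (flip := flip) hN
  have hsub := (atomElement_subset_OmegaBar_iff (flip := flip) (π := hiPerm flip j) hN).2 hab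
  have hmem : ∀ s t, pt j s t ∈ atomElement N flip (idx j a b) (hiPerm flip j) ↔
      t ∈ Icc (eps N * (b : ℝ)) (eps N * (b + 1)) ∧
        s ∈ Icc (diag N flip a b t) (eps N * ((a + 1 : ℤ) : ℝ)) := fun s t => by
    rw [pt_mem_hiTri hN, Int.cast_add, Int.cast_one]
    exact ⟨fun h => ⟨h.2.1, h.2.2, h.1.2⟩,
      fun h => ⟨⟨(diag_mem h.1).1.trans h.2.1, h.2.2⟩, h.1, h.2.1⟩⟩
  have hle : ∀ t ∈ Icc (eps N * (b : ℝ)) (eps N * (b + 1)),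
      diag N flip a b t ≤ eps N * ((a + 1 : ℤ) : ℝ) := fun t ht => by
    rw [Int.cast_add, Int.cast_one]
    exact (diag_mem ht).2
  have hm := (isClosed_atomElement (N := N) (flip := flip) (idx j a b)
    (hiPerm flip j)).measurableSet
  have hpt := continuous_pt j
  have hd := continuous_diag N flip a b
  have hcu := hu.1
  have hcv := hv.1
  rw [integral_sub (integrableOn_pderiv h𝒯 hu c j hsub) (integrableOn_pderiv hA hv c j hsub),
    integral_pderiv_two h𝒯 hu c j hm hsub hmem hle,
    integral_pderiv_two hA hv c j hm hsub hmem hle, diagIntegral,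
    wallIntegral, ← integral_sub, ← integral_sub]
  · exact integral_congr_ae (ae_of_all _ fun t => by ring)
  all_goals exact Continuous.integrableOn_Icc (by fun_prop)

end Green

/-! ### Summation by parts -/

theorem sum_Ico_add_one_of_periodic {N : ℕ} {f : ℤ → ℝ} (hf : f N = f (-(N : ℤ))) :
    ∑ a ∈ Finset.Ico (-(N : ℤ)) N, f (a + 1) = ∑ a ∈ Finset.Ico (-(N : ℤ)) N, f a := by
  have h1 : -(N : ℤ) ≤ N := by omega
  have key : ∀ n : ℕ, ∑ a ∈ Finset.Ico (-(N : ℤ)) (-(N : ℤ) + n), (f (a + 1) - f a) =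
      f (-(N : ℤ) + n) - f (-(N : ℤ)) := by
    intro n
    induction n with
    | zero => simp
    | succ n ih =>
      have h2 : Finset.Ico (-(N : ℤ)) (-(N : ℤ) + (n + 1 : ℕ)) =
          insert (-(N : ℤ) + n) (Finset.Ico (-(N : ℤ)) (-(N : ℤ) + n)) := by
        ext a
        simp only [Finset.mem_insert, Finset.mem_Ico]
        omega
      rw [h2, Finset.sum_insert (by simp), ih]
      push_cast
      rw [add_assoc]
      ring
  have h3 := key (2 * N)
  have h4 : -(N : ℤ) + (2 * N : ℕ) = N := by push_cast; ring
  rw [h4, hf, sub_self, Finset.sum_sub_distrib, sub_eq_zero] at h3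
  exact h3

/-- A wall belongs to the upper triangle of one cell and to the lower triangle of the next.
Collecting the factors of each wall and each diagonal leaves stress jumps, and by periodicity the
ends of the row cancel. -/
theorem sum_by_parts {N : ℕ} (Slo Shi D P : ℤ → ℝ) (hP : P N = P (-(N : ℤ)))
    (hS : Shi (N - 1) = Shi (-(N : ℤ) - 1)) :
    ∑ a ∈ Finset.Ico (-(N : ℤ)) N, (Slo a * (D a - P a) + Shi a * (P (a + 1) - D a)) =
      ∑ a ∈ Finset.Ico (-(N : ℤ)) N, ((Slo a - Shi a) * D a + (Shi (a - 1) - Slo a) * P a) := by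
  have h := sum_Ico_add_one_of_periodic (N := N) (f := fun a => Shi (a - 1) * P a)
    (by simp only [hP, hS])
  simp only [add_sub_cancel_right] at h
  rw [← sub_eq_zero, ← Finset.sum_sub_distrib]
  rw [← sub_eq_zero, ← Finset.sum_sub_distrib] at h
  rw [← h]
  exact Finset.sum_congr rfl fun a _ => by ring

theorem sum_cells_two {β : Type*} [AddCommMonoid β] {N : ℕ} (j : Fin 2) (f : (Fin 2 → ℤ) → β) :
    ∑ z ∈ cells 2 N, f z = ∑ b ∈ Finset.Ico (-(N : ℤ)) N, ∑ a ∈ Finset.Ico (-(N : ℤ)) N,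
      f (idx j a b) := by
  rw [← Finset.sum_product' (f := fun b a => f (idx j a b))]
  refine Finset.sum_nbij' (fun z => (z (1 - j), z j)) (fun p => idx j p.2 p.1) ?_ ?_ ?_ ?_ ?_
  · intro z hz
    rw [eq_idx j z, idx_mem_cells] at hz
    simpa [and_comm] using hz
  · intro p hp
    rw [idx_mem_cells]
    simpa [and_comm] using hp
  · exact fun z _ => (eq_idx j z).symm
  · intro p _
    simp
  · intro z _
    rw [← eq_idx j z]

/-! ### Oscillation of the deformation gradient -/

section Oscillation

variable {d N : ℕ} {flip : Bool} {y : Vec d → Vec d} {F : Set (Vec d) → Vec d →L[ℝ] Vec d}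

/-- The deformation itself is not periodic, but its linear part changes it only by a constant under
a period, so its gradient is. -/
theorem fderiv_shift {𝒯 : Set (Set (Vec d))} (hy : y ∈ deformations 𝒯) (ξ : Fin d → ℤ)
    (x : Vec d) : fderiv ℝ y ((2 : ℝ) • intVec ξ + x) = fderiv ℝ y x := by
  obtain ⟨_, A, hA⟩ := hy
  have h : (fun x => y ((2 : ℝ) • intVec ξ + x)) = fun x => y x + A ((2 : ℝ) • intVec ξ) := by
    funext x
    have := hA ξ x
    simp only [map_add] at this
    rw [sub_eq_iff_eq_add] at this
    rw [this]
    abel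
  rw [← fderiv_comp_add_left, h, fderiv_add_const]

theorem gradient_shift (hN : 0 < N) (hy : y ∈ deformations (atomMeshExt d N flip))
    (hF : HasJacobians (atomMeshExt d N flip) y F) (ξ z : Fin d → ℤ) (π : Equiv.Perm (Fin d)) :
    F (atomElement N flip (z + (2 * (N : ℤ)) • ξ) π) = F (atomElement N flip z π) := by
  obtain ⟨x, hx⟩ := atomInterior_nonempty (flip := flip) hN z π
  have hx' : (2 : ℝ) • intVec ξ + x ∈ interior (atomElement N flip (z + (2 * (N : ℤ)) • ξ) π) := by
    rw [← shift_atomElement hN]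
    exact (isOpenMap_add_left ((2 : ℝ) • intVec ξ)).image_interior_subset _
      ⟨x, atomInterior_subset_interior z π hx, rfl⟩
  rw [← hF.fderiv_eq ⟨z, π, rfl⟩ hx, ← fderiv_shift hy ξ x]
  exact (hF.hasFDerivAt ⟨_, π, rfl⟩ hx').fderiv.symm

/-- The product of the two open elements has positive measure in the product of the patch with
itself, so the essential supremum sees the jump between the two constant gradients. -/
theorem ofReal_tensorNorm_le_osc (hN : 0 < N) (hF : HasJacobians (atomMeshExt d N flip) y F)
    {S T : Set (Vec d)} {z z' : Fin d → ℤ} {π π' : Equiv.Perm (Fin d)}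
    (hS : atomElement N flip z π ⊆ perExt S) (hS' : atomElement N flip z' π' ⊆ perExt S)
    (hT : (T ∩ atomElement N flip z π).Nonempty) (hT' : (T ∩ atomElement N flip z' π').Nonempty) :
    ENNReal.ofReal (tensorNorm 2 (F (atomElement N flip z π) - F (atomElement N flip z' π')) /
      eps N) ≤ osc N y (patch N flip S T) := by
  have hpos : ∀ (z : Fin d → ℤ) (π : Equiv.Perm (Fin d)), atomElement N flip z π ⊆ perExt S →
      (T ∩ atomElement N flip z π).Nonempty →
      volume.restrict (patch N flip S T) (atomInterior N flip z π) ≠ 0 := by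
    intro z π hS hT
    have hsub : atomInterior N flip z π ⊆ patch N flip S T :=
      (atomInterior_subset z π).trans (subset_inter hS fun x hx =>
        mem_sUnion.2 ⟨_, ⟨⟨z, π, rfl⟩, hT⟩, hx⟩)
    rw [Measure.restrict_apply (isOpen_atomInterior z π).measurableSet,
      inter_eq_self_of_subset_left hsub]
    exact ((isOpen_atomInterior z π).measure_pos _ (atomInterior_nonempty hN z π)).ne'
  by_contra hlt
  have hae := ENNReal.ae_le_essSup (μ := (volume.restrict (patch N flip S T)).prod
    (volume.restrict (patch N flip S T))) (fun q : Vec d × Vec d =>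
      ENNReal.ofReal (tensorNorm 2 (fderiv ℝ y q.1 - fderiv ℝ y q.2) / eps N))
  rw [ae_iff] at hae
  have hnull : (volume.restrict (patch N flip S T)).prod (volume.restrict (patch N flip S T))
      (atomInterior N flip z π ×ˢ atomInterior N flip z' π') = 0 := by
    refine measure_mono_null ?_ hae
    intro q hq
    rw [mem_ofPred_eq, hF.fderiv_eq ⟨z, π, rfl⟩ hq.1, hF.fderiv_eq ⟨z', π', rfl⟩ hq.2]
    exact hlt
  rw [Measure.prod_prod, mul_eq_zero] at hnull
  exact hnull.elim (hpos z π hS hT) (hpos z' π' hS' hT')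

end Oscillation

/-! ### The contribution of one cell -/

section Cell

variable {N : ℕ} {flip : Bool} {j : Fin 2} {w : Vec 2 → ℝ} {a b : ℤ}

theorem pt_diag_mem (hN : 0 < N) {t : ℝ} (ht : t ∈ Icc (eps N * (b : ℝ)) (eps N * (b + 1))) :
    pt j (diag N flip a b t) t ∈ atomElement N flip (idx j a b) (loPerm flip j) ∧
      pt j (diag N flip a b t) t ∈ atomElement N flip (idx j a b) (hiPerm flip j) :=
  ⟨(pt_mem_loTri hN).2 ⟨diag_mem ht, ht, le_rfl⟩, (pt_mem_hiTri hN).2 ⟨diag_mem ht, ht, le_rfl⟩⟩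

theorem diagIntegral_eq_zero (hN : 0 < N)
    (h : (∀ x ∈ atomElement N flip (idx j a b) (loPerm flip j), w x = 0) ∨
      ∀ x ∈ atomElement N flip (idx j a b) (hiPerm flip j), w x = 0) :
    diagIntegral N flip j w a b = 0 := by
  refine setIntegral_eq_zero_of_forall_eq_zero fun t ht => ?_
  obtain ⟨h1, h2⟩ := pt_diag_mem (flip := flip) (j := j) (a := a) hN ht
  exact h.elim (fun h => h _ h1) fun h => h _ h2

theorem wallIntegral_eq_zero (hN : 0 < N)
    (h : (∀ x ∈ atomElement N flip (idx j a b) (loPerm flip j), w x = 0) ∨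
      ∀ x ∈ atomElement N flip (idx j (a - 1) b) (hiPerm flip j), w x = 0) :
    wallIntegral N j w a b = 0 := by
  refine setIntegral_eq_zero_of_forall_eq_zero fun t ht => ?_
  refine h.elim (fun h => h _ (pt_left_mem_lo hN ht)) fun h => h _ ?_
  have := pt_right_mem_hi (flip := flip) (j := j) (a := a - 1) hN ht
  push_cast at this
  rwa [sub_add_cancel] at this

/-- The jumps across the wall and the diagonal are both charged to the lower triangle, which borders
on both; hence the factor `2`. If this triangle is not in `S`, then `w` vanishes on it and so do
both integrals, which allows `δ = 0`. If a neighbour is not in the periodic extension of `S`, then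
`w` vanishes on the common side and its jump need not be bounded. This is why the patch can be
restricted to `Ω_c^#`. -/
theorem exists_cell_bound (hN : 0 < N) {y : Vec 2 → Vec 2}
    {F : Set (Vec 2) → Vec 2 →L[ℝ] Vec 2} (hF : HasJacobians (atomMeshExt 2 N flip) y F)
    {σ : (Vec 2 →L[ℝ] Vec 2) → ℝ} {M : ℝ} (hM : 0 ≤ M)
    (hσ : ∀ G G', |σ G - σ G'| ≤ M * tensorNorm 2 (G - G')) {S : Set (Vec 2)}
    (hlo : atomElement N flip (idx j a b) (loPerm flip j) ⊆ S ∨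
      ∀ x ∈ atomElement N flip (idx j a b) (loPerm flip j), w x = 0)
    (hhi : ∀ a b, atomElement N flip (idx j a b) (hiPerm flip j) ⊆ perExt S ∨
      ∀ x ∈ atomElement N flip (idx j a b) (hiPerm flip j), w x = 0) :
    ∃ δ : ℝ, 0 ≤ δ ∧
      (¬ atomElement N flip (idx j a b) (loPerm flip j) ⊆ S → δ = 0) ∧
      ENNReal.ofReal δ ≤ ENNReal.ofReal (2 * M * eps N) *
        osc N y (patch N flip S (atomElement N flip (idx j a b) (loPerm flip j))) ∧
      (σ (F (atomElement N flip (idx j a b) (loPerm flip j))) -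
          σ (F (atomElement N flip (idx j a b) (hiPerm flip j)))) * diagIntegral N flip j w a b +
        (σ (F (atomElement N flip (idx j (a - 1) b) (hiPerm flip j))) -
          σ (F (atomElement N flip (idx j a b) (loPerm flip j)))) * wallIntegral N j w a b ≤
      δ * (|wallIntegral N j w a b| +
        |diagIntegral N flip j w a b - wallIntegral N j w a b|) := by
  have he := eps_pos hN
  set lo := atomElement N flip (idx j a b) (loPerm flip j) with hlo_def
  set hi := atomElement N flip (idx j a b) (hiPerm flip j) with hhi_def
  set hi' := atomElement N flip (idx j (a - 1) b) (hiPerm flip j) with hhi'_def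
  set D := diagIntegral N flip j w a b
  set P := wallIntegral N j w a b
  by_cases hS : lo ⊆ S
  swap
  · have h0 := hlo.resolve_left hS
    have hD : D = 0 := diagIntegral_eq_zero hN (Or.inl h0)
    have hP : P = 0 := wallIntegral_eq_zero hN (Or.inl h0)
    exact ⟨0, le_rfl, fun _ => rfl, by simp, by simp [hD, hP]⟩
  have hlt : eps N * (b : ℝ) ≤ eps N * (b + 1) := by linarith
  have hSp : lo ⊆ perExt S := subset_perExt_of_shift_subset (ξ := 0) (by rwa [shift_zero])
  have hne : (lo ∩ lo).Nonempty := by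
    rw [inter_self]
    exact ⟨_, pt_left_mem_lo hN (left_mem_Icc.2 hlt)⟩
  have hne1 : (lo ∩ hi).Nonempty := ⟨_, pt_diag_mem hN (left_mem_Icc.2 hlt)⟩
  have hne2 : (lo ∩ hi').Nonempty := by
    refine ⟨_, pt_left_mem_lo hN (left_mem_Icc.2 hlt), ?_⟩
    have := pt_right_mem_hi (flip := flip) (j := j) (a := a - 1) hN (left_mem_Icc.2 hlt)
    push_cast at this
    rwa [sub_add_cancel] at this
  have hosc : ∀ {G G' : Vec 2 →L[ℝ] Vec 2},
      ENNReal.ofReal (tensorNorm 2 (G - G') / eps N) ≤ osc N y (patch N flip S lo) →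
      ENNReal.ofReal |σ G - σ G'| ≤
        ENNReal.ofReal (M * eps N) * osc N y (patch N flip S lo) := by
    intro G G' h
    refine (ENNReal.ofReal_le_ofReal (hσ G G')).trans ?_
    have h1 : M * tensorNorm 2 (G - G') = (M * eps N) * (tensorNorm 2 (G - G') / eps N) := by
      field_simp
    rw [h1, ENNReal.ofReal_mul (by positivity)]
    exact mul_le_mul_right h _
  have key : ∀ (X s : ℝ), (X = 0 ∨ ENNReal.ofReal |s| ≤
      ENNReal.ofReal (M * eps N) * osc N y (patch N flip S lo)) →
      ∃ δ, 0 ≤ δ ∧ ENNReal.ofReal δ ≤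
        ENNReal.ofReal (M * eps N) * osc N y (patch N flip S lo) ∧ s * X ≤ δ * |X| := by
    rintro X s (rfl | h)
    · exact ⟨0, le_rfl, by simp, by simp⟩
    · exact ⟨|s|, abs_nonneg s, h, (le_abs_self _).trans (abs_mul s X).le⟩
  obtain ⟨δ₁, h10, h11, h12⟩ := key D (σ (F lo) - σ (F hi)) (by
    rcases hhi a b with h | h
    · exact Or.inr (hosc (ofReal_tensorNorm_le_osc hN hF hSp h hne hne1))
    · exact Or.inl (diagIntegral_eq_zero hN (Or.inr h)))
  obtain ⟨δ₂, h20, h21, h22⟩ := key P (σ (F hi') - σ (F lo)) (by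
    rcases hhi (a - 1) b with h | h
    · exact Or.inr (hosc (ofReal_tensorNorm_le_osc hN hF h hSp hne2 hne))
    · exact Or.inl (wallIntegral_eq_zero hN (Or.inr h)))
  refine ⟨δ₁ + δ₂, by positivity, fun h => absurd hS h, ?_, ?_⟩
  · rw [ENNReal.ofReal_add h10 h20, show 2 * M * eps N = M * eps N + M * eps N by ring,
      ENNReal.ofReal_add (by positivity) (by positivity), add_mul]
    exact add_le_add h11 h21
  -- The diagonal integral has no lattice edge of its own to be compared with. Its difference to the
  -- wall integral is, by Green's formula, an integral over the lower triangle.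
  · have h3 : |D| ≤ |P| + |D - P| := by
      calc |D| = |P + (D - P)| := by rw [add_sub_cancel]
        _ ≤ _ := abs_add_le _ _
    have h4 := mul_le_mul_of_nonneg_left h3 h10
    have h5 : δ₂ * |P| ≤ δ₂ * (|P| + |D - P|) :=
      mul_le_mul_of_nonneg_left (le_add_of_nonneg_right (abs_nonneg _)) h20
    linarith

theorem volume_real_lo (hN : 0 < N) (flip : Bool) (j : Fin 2) (a b : ℤ) :
    volume.real (atomElement N flip (idx j a b) (loPerm flip j)) = eps N ^ 2 / 2 := by
  have he := eps_pos hN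
  have hm := (isClosed_atomElement (N := N) (flip := flip) (idx j a b)
    (loPerm flip j)).measurableSet
  have hlt : eps N * (b : ℝ) ≤ eps N * (b + 1) := by linarith
  have hfin : volume (atomElement N flip (idx j a b) (loPerm flip j)) ≠ ∞ := by
    have hb : Bornology.IsBounded (atomElement N flip (idx j a b) (loPerm flip j)) := by
      have h1 : Bornology.IsBounded ((fun p : ℝ × ℝ => pt j p.1 p.2) ''
          (Icc (eps N * (a : ℝ)) (eps N * (a + 1)) ×ˢ Icc (eps N * (b : ℝ)) (eps N * (b + 1)))) :=
        ((isCompact_Icc.prod isCompact_Icc).image (continuous_pt j)).isBounded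
      refine h1.subset fun x hx => ?_
      rw [← pt_eta j x, pt_mem_loTri hN] at hx
      exact ⟨(x j, x (1 - j)), ⟨hx.1, hx.2.1⟩, pt_eta j x⟩
    exact hb.measure_lt_top.ne
  have hmem : ∀ s t, pt j s t ∈ atomElement N flip (idx j a b) (loPerm flip j) ↔
      t ∈ Icc (eps N * (b : ℝ)) (eps N * (b + 1)) ∧
        s ∈ Icc (eps N * (a : ℝ)) (diag N flip a b t) := fun s t => by
    rw [pt_mem_loTri hN]
    exact ⟨fun h => ⟨h.2.1, h.1.1, h.2.2⟩,
      fun h => ⟨⟨h.2.1, h.2.2.trans (diag_mem h.1).2⟩, h.1, h.2.2⟩⟩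
  have h1 := integral_eq_integral_pt j hm hmem (g := fun _ => 1)
    (integrableOn_const hfin)
  have h2 : ∀ t ∈ Icc (eps N * (b : ℝ)) (eps N * (b + 1)),
      ∫ s in Icc (eps N * (a : ℝ)) (diag N flip a b t), (1 : ℝ) =
        diag N flip a b t - eps N * a := fun t ht => by
    simp [(diag_mem (flip := flip) (a := a) ht).1]
  rw [setIntegral_congr_fun measurableSet_Icc h2, integral_Icc_eq_integral_Ioc,
    ← intervalIntegral.integral_of_le hlt] at h1
  have h3 : ∫ _ in atomElement N flip (idx j a b) (loPerm flip j), (1 : ℝ) =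
      volume.real (atomElement N flip (idx j a b) (loPerm flip j)) := by simp
  rw [← h3, h1]
  unfold diag
  split_ifs
  · simp only [add_sub_cancel_left]
    rw [intervalIntegral.integral_sub (by simp) (by simp)]
    simp only [intervalIntegral.integral_const, integral_id, smul_eq_mul]
    ring
  · simp only [add_sub_cancel_left]
    rw [intervalIntegral.integral_sub (by simp) (by simp)]
    simp only [intervalIntegral.integral_const, integral_id, smul_eq_mul]
    ring

/-- On a lattice edge `v` interpolates the end values of `u` linearly. So `u - v` at `t` combines
the two increments of `u` on either side of `t`, with factors of modulus at most one. -/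
theorem abs_sub_le_lineVar (hN : 0 < N) {u v : Vec 2 → Vec 2} (hv : IsP1 (atomMeshExt 2 N flip) v)
    (huv : ∀ z : Fin 2 → ℤ, u (latticePt N z) = v (latticePt N z)) (c₀ : Fin 2) {t : ℝ}
    (ht : t ∈ Icc (eps N * (b : ℝ)) (eps N * (b + 1))) :
    |u (pt j (eps N * a) t) c₀ - v (pt j (eps N * a) t) c₀| ≤
      eps N * lineVar N j (fun x => u x c₀) (eps N * a) t b := by
  have he := eps_pos hN
  have hlt : eps N * (b : ℝ) ≤ eps N * (b + 1) := by linarith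
  obtain ⟨L, w, hL⟩ := hv.2 (atomElement N flip (idx j a b) (loPerm flip j)) ⟨_, _, rfl⟩
  have e0 := huv (idx j a b)
  have e1 := huv (idx j a (b + 1))
  rw [latticePt_idx] at e0 e1
  push_cast at e1
  have m0 := hL _ (pt_left_mem_lo hN (left_mem_Icc.2 hlt))
  have m1 := hL _ (pt_left_mem_lo hN (right_mem_Icc.2 hlt))
  have mt := hL _ (pt_left_mem_lo hN ht)
  set θ := (t - eps N * b) / eps N with hθ
  have hθ0 : 0 ≤ θ := div_nonneg (by linarith [ht.1]) he.le
  have hθ1 : θ ≤ 1 := by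
    rw [hθ, div_le_one he]
    linarith [ht.2]
  have hcomb : pt j (eps N * a) t = (1 - θ) • pt j (eps N * a) (eps N * b) +
      θ • pt j (eps N * a) (eps N * (b + 1)) := by
    rw [pt_smul, pt_smul, pt_add]
    congr 1
    · ring
    · rw [hθ]
      field_simp
      ring
  have hvt : v (pt j (eps N * a) t) c₀ = (1 - θ) * u (pt j (eps N * a) (eps N * b)) c₀ +
      θ * u (pt j (eps N * a) (eps N * (b + 1))) c₀ := by
    rw [e0, e1, mt, m0, m1]
    conv_lhs => rw [hcomb]
    simp only [map_add, map_smul, PiLp.add_apply, PiLp.smul_apply, smul_eq_mul]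
    ring
  rw [lineVar, mul_div_cancel₀ _ he.ne', hvt]
  set f0 := u (pt j (eps N * a) (eps N * b)) c₀
  set f1 := u (pt j (eps N * a) (eps N * (b + 1))) c₀
  set ft := u (pt j (eps N * a) t) c₀
  have h1 : ft - ((1 - θ) * f0 + θ * f1) = (1 - θ) * (ft - f0) - θ * (f1 - ft) := by ring
  rw [h1]
  refine (abs_sub _ _).trans ?_
  rw [abs_mul, abs_mul, abs_of_nonneg hθ0, abs_of_nonneg (sub_nonneg.2 hθ1)]
  have h2 : (1 - θ) * |ft - f0| ≤ 1 * |ft - f0| :=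
    mul_le_mul_of_nonneg_right (by linarith) (abs_nonneg _)
  have h3 : θ * |f1 - ft| ≤ 1 * |f1 - ft| := mul_le_mul_of_nonneg_right hθ1 (abs_nonneg _)
  linarith

/-- With `c` at the maximum of `|u - v|` on the edge, one partition point per edge serves the whole
integral. -/
theorem exists_abs_wallIntegral_le (hN : 0 < N) {u v : Vec 2 → Vec 2} (hu : Continuous u)
    (hv : IsP1 (atomMeshExt 2 N flip) v)
    (huv : ∀ z : Fin 2 → ℤ, u (latticePt N z) = v (latticePt N z)) (c₀ : Fin 2) :
    ∃ c ∈ Icc (eps N * (b : ℝ)) (eps N * (b + 1)),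
      |wallIntegral N j (fun x => u x c₀ - v x c₀) a b| ≤
        eps N ^ 2 * lineVar N j (fun x => u x c₀) (eps N * a) c b := by
  have he := eps_pos hN
  have hlt : eps N * (b : ℝ) ≤ eps N * (b + 1) := by linarith
  have hpt := continuous_pt j
  have hcv := hv.1
  obtain ⟨c, hc, hmax⟩ := isCompact_Icc.exists_isMaxOn (nonempty_Icc.2 hlt)
    (f := fun t => |u (pt j (eps N * a) t) c₀ - v (pt j (eps N * a) t) c₀|)
    (Continuous.continuousOn (by fun_prop))
  refine ⟨c, hc, ?_⟩
  have h1 := norm_setIntegral_le_of_norm_le_const (μ := volume)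
    (s := Icc (eps N * (b : ℝ)) (eps N * (b + 1)))
    (f := fun t => u (pt j (eps N * a) t) c₀ - v (pt j (eps N * a) t) c₀)
    (by simp) (fun t ht => hmax ht)
  have h2 : volume.real (Icc (eps N * (b : ℝ)) (eps N * (b + 1))) = eps N := by
    rw [Real.volume_real_Icc_of_le hlt]
    ring
  rw [h2, Real.norm_eq_abs] at h1
  refine h1.trans ?_
  have h3 := mul_le_mul_of_nonneg_right
    (abs_sub_le_lineVar (j := j) (a := a) hN hv huv c₀ hc) he.le
  calc _ ≤ _ := h3
    _ = _ := by ring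

end Cell

/-! ### Hölder's inequality for step functions -/

theorem sum_indicator_of_mem {α ι β : Type*} [AddCommMonoid β] {s : Finset ι}
    {E : ι → Set α} (hd : (s : Set ι).PairwiseDisjoint E)
    (f : ι → β) {x : α} {i : ι} (hi : i ∈ s) (hx : x ∈ E i) :
    ∑ i ∈ s, (E i).indicator (fun _ => f i) x = f i := by
  rw [Finset.sum_eq_single_of_mem i hi fun k hk hki => ?_, indicator_of_mem hx]
  exact indicator_of_notMem (fun h => (disjoint_left.1 (hd hk hi hki)) h hx) _

section StepFunction

variable {α ι : Type*} [MeasurableSpace α] {μ : Measure α} {s : Finset ι} {E : ι → Set α}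
  {δ : ι → ℝ}

/-- The function with value `δ i` on `E i`. -/
noncomputable def stepFun (s : Finset ι) (E : ι → Set α) (δ : ι → ℝ) (x : α) : ℝ :=
  ∑ i ∈ s, (E i).indicator (fun _ => δ i) x

theorem measurable_stepFun (hm : ∀ i ∈ s, MeasurableSet (E i)) : Measurable (stepFun s E δ) :=
  Finset.measurable_fun_sum _ fun i hi => measurable_const.indicator (hm i hi)

theorem sum_mul_lintegral_le (hd : (s : Set ι).PairwiseDisjoint E)
    (hm : ∀ i ∈ s, MeasurableSet (E i)) (hδ : ∀ i ∈ s, 0 ≤ δ i) {B : α → ℝ}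
    (hB : AEStronglyMeasurable B μ) (p q : ℝ≥0∞) [ENNReal.HolderConjugate p q] :
    ∑ i ∈ s, ENNReal.ofReal (δ i) * ∫⁻ x in E i, ‖B x‖ₑ ∂μ ≤
      eLpNorm (stepFun s E δ) p μ * eLpNorm B q μ := by
  refine le_trans ?_ (eLpNorm_smul_le_mul_eLpNorm (r := 1) hB
    (measurable_stepFun hm).aestronglyMeasurable)
  rw [eLpNorm_one_eq_lintegral_enorm]
  refine le_trans ?_ (setLIntegral_le_lintegral (⋃ i ∈ s, E i) _)
  rw [lintegral_biUnion_finset hd hm]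
  refine Finset.sum_le_sum fun i hi => ?_
  rw [← lintegral_const_mul' _ _ ENNReal.ofReal_ne_top]
  refine le_of_eq (setLIntegral_congr_fun (hm i hi) fun x hx => ?_)
  have h : stepFun s E δ x = δ i := sum_indicator_of_mem hd _ hi hx
  simp only [Pi.smul_apply', h, smul_eq_mul, enorm_mul, Real.enorm_of_nonneg (hδ i hi)]

theorem eLpNorm_stepFun_top_le (hd : (s : Set ι).PairwiseDisjoint E) (hδ : ∀ i ∈ s, 0 ≤ δ i)
    {G : ℝ≥0∞} (hG : ∀ i ∈ s, ENNReal.ofReal (δ i) ≤ G) : eLpNorm (stepFun s E δ) ∞ μ ≤ G := by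
  rw [eLpNorm_exponent_top]
  refine eLpNormEssSup_le_of_ae_enorm_bound (ae_of_all _ fun x => ?_)
  by_cases hx : ∃ i ∈ s, x ∈ E i
  · obtain ⟨i, hi, hxi⟩ := hx
    rw [stepFun, sum_indicator_of_mem hd _ hi hxi, Real.enorm_of_nonneg (hδ i hi)]
    exact hG i hi
  · push Not at hx
    rw [stepFun, Finset.sum_eq_zero fun i hi => indicator_of_notMem (hx i hi) _]
    simp

theorem eLpNorm_stepFun (hd : (s : Set ι).PairwiseDisjoint E)
    (hm : ∀ i ∈ s, MeasurableSet (E i)) (hδ : ∀ i ∈ s, 0 ≤ δ i) {p : ℝ≥0∞} (hp : p ≠ 0)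
    (hpt : p ≠ ∞) :
    eLpNorm (stepFun s E δ) p μ =
      (∑ i ∈ s, ENNReal.ofReal (δ i) ^ p.toReal * μ (E i)) ^ (1 / p.toReal) := by
  have hp0 := ENNReal.toReal_pos hp hpt
  rw [eLpNorm_eq_lintegral_rpow_enorm_toReal hp hpt]
  congr 1
  have h : ∀ x, ‖stepFun s E δ x‖ₑ ^ p.toReal =
      ∑ i ∈ s, (E i).indicator (fun _ => ENNReal.ofReal (δ i) ^ p.toReal) x := by
    intro x
    by_cases hx : ∃ i ∈ s, x ∈ E i
    · obtain ⟨i, hi, hxi⟩ := hx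
      rw [stepFun, sum_indicator_of_mem hd _ hi hxi, sum_indicator_of_mem hd _ hi hxi,
        Real.enorm_of_nonneg (hδ i hi)]
    · push Not at hx
      rw [stepFun, Finset.sum_eq_zero fun i hi => indicator_of_notMem (hx i hi) _,
        Finset.sum_eq_zero fun i hi => indicator_of_notMem (hx i hi) _, enorm_zero,
        ENNReal.zero_rpow_of_pos hp0]
  simp_rw [h]
  rw [lintegral_finsetSum' _ fun i hi => (measurable_const.indicator (hm i hi)).aemeasurable]
  exact Finset.sum_congr rfl fun i hi => lintegral_indicator_const (hm i hi) _

end StepFunction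

/-! ### The coupling error in two dimensions -/

section Two

variable {N : ℕ} {flip : Bool}

theorem atomElement_injective (hN : 0 < N) (π : Equiv.Perm (Fin 2)) :
    Function.Injective fun z : Fin 2 → ℤ => atomElement N flip z π := by
  intro z z' h
  obtain ⟨x, hx⟩ := atomInterior_nonempty (flip := flip) hN z π
  have h' : x ∈ atomElement N flip z' π := by
    change atomElement N flip z π = atomElement N flip z' π at h
    rw [← h]
    exact atomInterior_subset z π hx
  exact (atomElement_unique hx h').1

theorem pairwiseDisjoint_atomInterior (π : Equiv.Perm (Fin 2)) (s : Set (Fin 2 → ℤ)) :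
    s.PairwiseDisjoint fun z => atomInterior N flip z π := fun _ _ _ _ hne =>
  disjoint_left.2 fun _ hx hx' => hne (atomElement_unique hx (atomInterior_subset _ _ hx')).1

/-- Cells with `δ ≠ 0` correspond injectively to elements of the continuum region, so the sum over
them is part of the sum of oscillations. -/
theorem eLpNorm_stepFun_le_oscSum (hN : 0 < N) {y : Vec 2 → Vec 2} {S : Set (Vec 2)}
    (π : Equiv.Perm (Fin 2)) {δ : (Fin 2 → ℤ) → ℝ} {G p : ℝ≥0∞} (hp : 1 ≤ p)
    (hδ : ∀ z ∈ cells 2 N, 0 ≤ δ z)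
    (hδ0 : ∀ z ∈ cells 2 N, ¬ atomElement N flip z π ⊆ S → δ z = 0)
    (hδG : ∀ z ∈ cells 2 N, ENNReal.ofReal (δ z) ≤
      G * osc N y (patch N flip S (atomElement N flip z π))) :
    eLpNorm (stepFun (cells 2 N) (fun z => atomInterior N flip z π) δ) p
      (volume.restrict (Omega 2)) ≤ G * oscSum N flip p S y := by
  classical
  have hmem : ∀ z ∈ cells 2 N, atomElement N flip z π ⊆ S →
      atomElement N flip z π ∈ atomMeshIn N flip S := fun z hz h =>
    ⟨atomElement_mem_atomMesh hN hz, h⟩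
  by_cases hpt : p = ∞
  · subst hpt
    rw [oscSum, if_pos rfl]
    refine eLpNorm_stepFun_top_le (pairwiseDisjoint_atomInterior π _) hδ fun z hz => ?_
    by_cases hS : atomElement N flip z π ⊆ S
    · refine (hδG z hz).trans (mul_le_mul_right ?_ G)
      exact le_iSup₂_of_le (f := fun T (_ : T ∈ atomMeshIn N flip S) =>
        osc N y (patch N flip S T)) _ (hmem z hz hS) le_rfl
    · rw [hδ0 z hz hS, ENNReal.ofReal_zero]
      exact zero_le
  have hp0 : p ≠ 0 := (zero_lt_one.trans_le hp).ne'
  have hpr := ENNReal.toReal_pos hp0 hpt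
  rw [oscSum, if_neg hpt, eLpNorm_stepFun (pairwiseDisjoint_atomInterior π _)
    (fun z _ => (isOpen_atomInterior z π).measurableSet) hδ hp0 hpt]
  set t := (cells 2 N).filter fun z => atomElement N flip z π ⊆ S with ht
  have ht1 : ∀ z : t, (z : Fin 2 → ℤ) ∈ cells 2 N ∧ atomElement N flip z π ⊆ S := fun z =>
    Finset.mem_filter.1 z.2
  have hsum : ∑ z ∈ cells 2 N, ENNReal.ofReal (δ z) ^ p.toReal *
      volume.restrict (Omega 2) (atomInterior N flip z π) ≤
      G ^ p.toReal * ∑' T : atomMeshIn N flip S,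
        volume (T : Set (Vec 2)) * osc N y (patch N flip S T) ^ p.toReal := by
    calc _ = ∑ z ∈ t, ENNReal.ofReal (δ z) ^ p.toReal *
          volume.restrict (Omega 2) (atomInterior N flip z π) := by
            rw [ht, Finset.sum_filter]
            refine Finset.sum_congr rfl fun z hz => ?_
            split_ifs with hS
            · rfl
            · rw [hδ0 z hz hS, ENNReal.ofReal_zero, ENNReal.zero_rpow_of_pos hpr, zero_mul]
      _ ≤ ∑ z ∈ t, G ^ p.toReal * (volume (atomElement N flip z π) *
            osc N y (patch N flip S (atomElement N flip z π)) ^ p.toReal) := by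
            refine Finset.sum_le_sum fun z hz => ?_
            rw [mul_comm (volume _), ← mul_assoc, ← ENNReal.mul_rpow_of_nonneg _ _ hpr.le]
            exact mul_le_mul' (ENNReal.rpow_le_rpow (hδG z (ht1 ⟨z, hz⟩).1) hpr.le)
              ((Measure.restrict_apply_le _ _).trans (measure_mono (atomInterior_subset z π)))
      _ ≤ _ := by
            rw [← Finset.mul_sum, ← Finset.tsum_subtype]
            refine mul_le_mul_right ?_ _
            exact ENNReal.tsum_comp_le_tsum_of_injective
              (f := fun z : t => (⟨atomElement N flip z π, hmem z (ht1 z).1 (ht1 z).2⟩ :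
                atomMeshIn N flip S))
              (fun z z' h => Subtype.ext (atomElement_injective hN π (congrArg Subtype.val h)))
              fun T => volume (T : Set (Vec 2)) * osc N y (patch N flip S T) ^ p.toReal
  refine (ENNReal.rpow_le_rpow hsum (by positivity)).trans (le_of_eq ?_)
  rw [ENNReal.mul_rpow_of_nonneg _ _ (by positivity), ← ENNReal.rpow_mul,
    mul_one_div_cancel hpr.ne', ENNReal.rpow_one]

theorem wallIntegral_periodic (hN : 0 < N) {j : Fin 2} {u v : Vec 2 → Vec 2} (hu : IsPeriodic u)
    (hv : IsPeriodic v) (c : Fin 2) (b : ℤ) :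
    wallIntegral N j (fun x => u x c - v x c) N b =
      wallIntegral N j (fun x => u x c - v x c) (-(N : ℤ)) b := by
  have hpt : ∀ t, pt j (eps N * ((N : ℤ) : ℝ)) t =
      (2 : ℝ) • intVec (idx j 1 0) + pt j (eps N * ((-(N : ℤ) : ℤ) : ℝ)) t := by
    intro t
    have h1 : (intVec (idx j 1 0) : Vec 2) = pt j 1 0 := by
      ext i
      by_cases h : i = j <;> simp [intVec, idx, pt, h]
    rw [h1, pt_smul, pt_add]
    have := eps_mul hN
    congr 1
    · push_cast
      linarith
    · ring
  unfold wallIntegral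
  simp_rw [hpt, hu (idx j 1 0), hv (idx j 1 0)]

/-- The lower triangle has area `ε² / 2`, so the factor `2` reproduces the bound `ε²` times the edge
variation for the wall. The remaining difference is the integral of `∂_j (u - v)` over this
triangle. -/
theorem ofReal_cell_le_lintegral (hN : 0 < N) {𝒯 : Set (Set (Vec 2))} (h𝒯 : IsConvexCover 𝒯)
    {u v : Vec 2 → Vec 2} (hu : IsP1 𝒯 u) (hv : IsP1 (atomMesh 2 N flip) v) (c₀ j : Fin 2)
    {c : ℤ → ℤ → ℝ} {a b : ℤ} (hab : idx j a b ∈ cells 2 N)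
    (hc : |wallIntegral N j (fun x => u x c₀ - v x c₀) a b| ≤
        eps N ^ 2 * lineVar N j (fun x => u x c₀) (eps N * a) (c a b) b) :
    ENNReal.ofReal (|wallIntegral N j (fun x => u x c₀ - v x c₀) a b| +
        |diagIntegral N flip j (fun x => u x c₀ - v x c₀) a b -
          wallIntegral N j (fun x => u x c₀ - v x c₀) a b|) ≤
      ∫⁻ x in atomInterior N flip (idx j a b) (loPerm flip j),
        ‖2 * edgeFun N flip j (fun x => u x c₀) c x + |pderiv u c₀ j x - pderiv v c₀ j x|‖ₑ
          ∂(volume.restrict (Omega 2)) := by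
  have he := eps_pos hN
  have hm := (isOpen_atomInterior (N := N) (flip := flip) (idx j a b) (loPerm flip j)).measurableSet
  have hsub : atomInterior N flip (idx j a b) (loPerm flip j) ⊆ OmegaBar 2 :=
    (atomInterior_subset _ _).trans ((atomElement_subset_OmegaBar_iff hN).2 hab)
  have hl := lineVar_nonneg hN j (fun x => u x c₀) (eps N * a) (c a b) b
  rw [restrict_Omega, Measure.restrict_restrict hm, inter_eq_self_of_subset_left hsub]
  have hsplit : ∫⁻ x in atomInterior N flip (idx j a b) (loPerm flip j),
      ‖2 * edgeFun N flip j (fun x => u x c₀) c x + |pderiv u c₀ j x - pderiv v c₀ j x|‖ₑ =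
      ENNReal.ofReal (2 * lineVar N j (fun x => u x c₀) (eps N * a) (c a b) b) *
        volume (atomInterior N flip (idx j a b) (loPerm flip j)) +
      ∫⁻ x in atomInterior N flip (idx j a b) (loPerm flip j),
        ‖pderiv u c₀ j x - pderiv v c₀ j x‖ₑ := by
    rw [← setLIntegral_const, ← lintegral_add_left measurable_const]
    refine setLIntegral_congr_fun hm fun x hx => ?_
    simp only [edgeFun_of_mem_lo hN hx]
    rw [Real.enorm_of_nonneg (by positivity), ENNReal.ofReal_add (by positivity) (abs_nonneg _),
      ← Real.enorm_eq_ofReal_abs]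
  rw [hsplit, ENNReal.ofReal_add (abs_nonneg _) (abs_nonneg _)]
  refine add_le_add ?_ ?_
  · have hvol : volume (atomInterior N flip (idx j a b) (loPerm flip j)) =
        ENNReal.ofReal (eps N ^ 2 / 2) := by
      have hfin : volume (atomElement N flip (idx j a b) (loPerm flip j)) ≠ ∞ :=
        ((measure_mono ((atomElement_subset_OmegaBar_iff hN).2 hab)).trans_lt
          (isCompact_OmegaBar 2).measure_lt_top).ne
      rw [← measure_congr (atomElement_ae_eq_atomInterior hN hab _),
        ← volume_real_lo hN flip j a b, measureReal_def, ENNReal.ofReal_toReal hfin]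
    rw [hvol, ← ENNReal.ofReal_mul (by positivity)]
    refine ENNReal.ofReal_le_ofReal (hc.trans (le_of_eq ?_))
    ring
  · rw [← integral_lo hN h𝒯 hu hv c₀ j hab, ← Real.enorm_eq_ofReal_abs,
      setIntegral_congr_set (atomElement_ae_eq_atomInterior hN hab _)]
    exact enorm_integral_le_lintegral_enorm _

theorem sum_cells_le_sum_cell_bounds (hN : 0 < N) {𝒯 : Set (Set (Vec 2))} (h𝒯 : IsConvexCover 𝒯)
    {u v : Vec 2 → Vec 2} (hu : IsP1 𝒯 u) (hv : IsP1 (atomMesh 2 N flip) v)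
    (hup : IsPeriodic u) (hvp : IsPeriodic v) (c₀ j : Fin 2) {τ : Set (Vec 2) → ℝ}
    (hτ : ∀ b, τ (atomElement N flip (idx j (N - 1) b) (hiPerm flip j)) =
      τ (atomElement N flip (idx j (-(N : ℤ) - 1) b) (hiPerm flip j))) {δ : ℤ → ℤ → ℝ}
    (hδ : ∀ a b, idx j a b ∈ cells 2 N →
      (τ (atomElement N flip (idx j a b) (loPerm flip j)) -
          τ (atomElement N flip (idx j a b) (hiPerm flip j))) *
            diagIntegral N flip j (fun x => u x c₀ - v x c₀) a b +
        (τ (atomElement N flip (idx j (a - 1) b) (hiPerm flip j)) -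
          τ (atomElement N flip (idx j a b) (loPerm flip j))) *
            wallIntegral N j (fun x => u x c₀ - v x c₀) a b ≤
      δ a b * (|wallIntegral N j (fun x => u x c₀ - v x c₀) a b| +
        |diagIntegral N flip j (fun x => u x c₀ - v x c₀) a b -
          wallIntegral N j (fun x => u x c₀ - v x c₀) a b|)) :
    ∑ z ∈ cells 2 N, ∑ π, τ (atomElement N flip z π) *
        ∫ x in atomElement N flip z π, (pderiv u c₀ j x - pderiv v c₀ j x) ≤
      ∑ b ∈ Finset.Ico (-(N : ℤ)) N, ∑ a ∈ Finset.Ico (-(N : ℤ)) N,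
        δ a b * (|wallIntegral N j (fun x => u x c₀ - v x c₀) a b| +
          |diagIntegral N flip j (fun x => u x c₀ - v x c₀) a b -
            wallIntegral N j (fun x => u x c₀ - v x c₀) a b|) := by
  rw [sum_cells_two j]
  refine Finset.sum_le_sum fun b hb => ?_
  have h1 : ∀ a ∈ Finset.Ico (-(N : ℤ)) N, ∑ π, τ (atomElement N flip (idx j a b) π) *
      ∫ x in atomElement N flip (idx j a b) π, (pderiv u c₀ j x - pderiv v c₀ j x) =
      τ (atomElement N flip (idx j a b) (loPerm flip j)) *
        (diagIntegral N flip j (fun x => u x c₀ - v x c₀) a b -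
          wallIntegral N j (fun x => u x c₀ - v x c₀) a b) +
      τ (atomElement N flip (idx j a b) (hiPerm flip j)) *
        (wallIntegral N j (fun x => u x c₀ - v x c₀) (a + 1) b -
          diagIntegral N flip j (fun x => u x c₀ - v x c₀) a b) := by
    intro a ha
    have hab : idx j a b ∈ cells 2 N := idx_mem_cells.2 ⟨ha, hb⟩
    rw [univ_perm_fin_two flip j, Finset.sum_pair (loPerm_ne_hiPerm flip j),
      integral_lo hN h𝒯 hu hv c₀ j hab, integral_hi hN h𝒯 hu hv c₀ j hab]
  rw [Finset.sum_congr rfl h1,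
    sum_by_parts (fun a => τ (atomElement N flip (idx j a b) (loPerm flip j)))
      (fun a => τ (atomElement N flip (idx j a b) (hiPerm flip j)))
      (fun a => diagIntegral N flip j (fun x => u x c₀ - v x c₀) a b)
      (fun a => wallIntegral N j (fun x => u x c₀ - v x c₀) a b)
      (wallIntegral_periodic hN hup hvp c₀ b) (hτ b)]
  exact Finset.sum_le_sum fun a ha => hδ a b (idx_mem_cells.2 ⟨ha, hb⟩)

end Two

/-! ### Hölder's inequality and the sum over the components. -/

section Coupling

variable {N : ℕ} {flip : Bool}

/-- Hölder's inequality pairs the step function of the jump bounds, whose norm is at most `2 M ε`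
times the oscillation term, with a function of norm at most `4`. The product is the constant `8`. -/
theorem component_le (hN : 0 < N) {Th : Set (Finset (Vec 2))} (h : IsPeriodicTriangulation N Th)
    {u v y : Vec 2 → Vec 2} (hu : IsP1 (elements Th) u) (hup : IsPeriodic u)
    (hv : v ∈ displacements (atomMeshExt 2 N flip))
    (huv : ∀ z : Fin 2 → ℤ, u (latticePt N z) = v (latticePt N z))
    (hy : y ∈ deformations (atomMeshExt 2 N flip)) {F : Set (Vec 2) → Vec 2 →L[ℝ] Vec 2}
    (hF : HasJacobians (atomMeshExt 2 N flip) y F) {σ : (Vec 2 →L[ℝ] Vec 2) → ℝ} {M : ℝ}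
    (hM : 0 ≤ M) (hσ : ∀ G G', |σ G - σ G'| ≤ M * tensorNorm 2 (G - G')) {S : Set (Vec 2)}
    (hdich : ∀ K ∈ atomMesh 2 N flip, K ⊆ S ∨ ∀ x ∈ K, u x = v x) {p : ℝ≥0∞} (hp : 1 ≤ p)
    (hu1 : gradNorm p.conjExponent u ≤ 1) (hv1 : gradNorm p.conjExponent v ≤ 1) (c₀ j : Fin 2) :
    ENNReal.ofReal (∑ z ∈ cells 2 N, ∑ π, σ (F (atomElement N flip z π)) *
        ∫ x in atomElement N flip z π, (pderiv u c₀ j x - pderiv v c₀ j x)) ≤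
      ENNReal.ofReal (M * 8 * eps N) * oscSum N flip p S y := by
  have he := eps_pos hN
  have h𝒯 := h.isConvexCover hN
  have hA := isConvexCover_atomMesh (d := 2) (flip := flip) hN
  have hv' := hv.1.mono (atomMesh_subset (d := 2))
  have : ENNReal.HolderConjugate p p.conjExponent := ENNReal.HolderConjugate.conjExponent hp
  have hq : 1 ≤ p.conjExponent := ENNReal.HolderConjugate.one_le p.conjExponent p
  have hzero : ∀ {K : Set (Vec 2)}, (∀ x ∈ K, u x = v x) → ∀ x ∈ K, u x c₀ - v x c₀ = 0 :=
    fun h x hx => by rw [h x hx, sub_self]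
  choose c hc hcw using fun a b : ℤ =>
    exists_abs_wallIntegral_le (j := j) (a := a) (b := b) hN hu.1 hv.1 huv c₀
  have hcell : ∀ a b : ℤ, idx j a b ∈ cells 2 N → _ := fun a b hab =>
    exists_cell_bound (w := fun x => u x c₀ - v x c₀) (j := j) (a := a) (b := b) hN hF hM hσ
      (S := S) ((hdich _ (atomElement_mem_atomMesh hN hab)).imp_right hzero)
      fun a b => (subset_perExt_or_eq hN hup hv.2 hdich _ _).imp_right hzero
  choose! δ hδ0 hδS hδG hδ using hcell
  -- The indices `N - 1` and `-N - 1` differ by the period `2 N`; this closes the summation by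
  -- parts.
  have hτ : ∀ b, σ (F (atomElement N flip (idx j (N - 1) b) (hiPerm flip j))) =
      σ (F (atomElement N flip (idx j (-(N : ℤ) - 1) b) (hiPerm flip j))) := by
    intro b
    rw [← gradient_shift hN hy hF (idx j 1 0) (idx j (-(N : ℤ) - 1) b)]
    congr 3
    funext i
    by_cases hi : i = j <;> simp [idx, hi]
    ring
  refine (ENNReal.ofReal_le_ofReal (sum_cells_le_sum_cell_bounds hN h𝒯 hu hv' hup hv.2 c₀ j
    (τ := fun K => σ (F K)) hτ hδ)).trans ?_
  set B : Vec 2 → ℝ := fun x => 2 * edgeFun N flip j (fun x => u x c₀) c x +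
    |pderiv u c₀ j x - pderiv v c₀ j x| with hB
  have hBm : Measurable B := ((measurable_edgeFun N flip j _ c).const_mul 2).add
    ((measurable_pderiv u c₀ j).sub (measurable_pderiv v c₀ j)).abs
  set δ' : (Fin 2 → ℤ) → ℝ := fun z => δ (z j) (z (1 - j)) with hδ'
  have hz : ∀ z ∈ cells 2 N, idx j (z j) (z (1 - j)) ∈ cells 2 N := fun z hz => by
    rwa [← eq_idx]
  have hδ0' : ∀ z ∈ cells 2 N, 0 ≤ δ' z := fun z h => hδ0 _ _ (hz z h)
  have h1 : ENNReal.ofReal (∑ b ∈ Finset.Ico (-(N : ℤ)) N, ∑ a ∈ Finset.Ico (-(N : ℤ)) N,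
        δ a b * (|wallIntegral N j (fun x => u x c₀ - v x c₀) a b| +
          |diagIntegral N flip j (fun x => u x c₀ - v x c₀) a b -
            wallIntegral N j (fun x => u x c₀ - v x c₀) a b|)) ≤
      ∑ z ∈ cells 2 N, ENNReal.ofReal (δ' z) *
        ∫⁻ x in atomInterior N flip z (loPerm flip j), ‖B x‖ₑ ∂(volume.restrict (Omega 2)) := by
    rw [sum_cells_two j]
    simp only [hδ', idx_same, idx_other]
    have hnn : ∀ b ∈ Finset.Ico (-(N : ℤ)) N, ∀ a ∈ Finset.Ico (-(N : ℤ)) N, 0 ≤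
        δ a b * (|wallIntegral N j (fun x => u x c₀ - v x c₀) a b| +
          |diagIntegral N flip j (fun x => u x c₀ - v x c₀) a b -
            wallIntegral N j (fun x => u x c₀ - v x c₀) a b|) := fun b hb a ha =>
      mul_nonneg (hδ0 a b (idx_mem_cells.2 ⟨ha, hb⟩)) (by positivity)
    rw [ENNReal.ofReal_sum_of_nonneg fun b hb => Finset.sum_nonneg (hnn b hb)]
    refine Finset.sum_le_sum fun b hb => ?_
    rw [ENNReal.ofReal_sum_of_nonneg (hnn b hb)]
    refine Finset.sum_le_sum fun a ha => ?_
    have hab : idx j a b ∈ cells 2 N := idx_mem_cells.2 ⟨ha, hb⟩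
    rw [ENNReal.ofReal_mul (hδ0 a b hab)]
    exact mul_le_mul_right (ofReal_cell_le_lintegral hN h𝒯 hu hv' c₀ j hab (hcw a b)) _
  have h2 := sum_mul_lintegral_le (pairwiseDisjoint_atomInterior (N := N) (flip := flip)
    (loPerm flip j) (cells 2 N)) (fun z _ => (isOpen_atomInterior z _).measurableSet) hδ0'
    (hBm.aestronglyMeasurable (μ := volume.restrict (Omega 2))) p p.conjExponent
  have h3 := eLpNorm_stepFun_le_oscSum (S := S) (y := y) hN (loPerm flip j) hp hδ0'
    (fun z hzc hzS => hδS _ _ (hz z hzc) (by rwa [← eq_idx]))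
    (fun z hzc => by
      have := hδG _ _ (hz z hzc)
      rwa [← eq_idx] at this)
  -- Twice the edge variations, plus `∂_j u` and `∂_j v`, each of norm at most one.
  have h4 : eLpNorm B p.conjExponent (volume.restrict (Omega 2)) ≤ 4 := by
    obtain ⟨L, hL⟩ := hu.exists_hasJacobians
    have e1 := h.eLpNorm_edgeFun_le hN (hL.comp_proj c₀) flip j c hc hq
    have e2 : eLpNorm (edgeFun N flip j (fun x => u x c₀) c) p.conjExponent
        (volume.restrict (Omega 2)) ≤ 1 :=
      e1.trans ((eLpNorm_pderiv_le_gradNorm h𝒯 hu hq c₀ (1 - j)).trans hu1)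
    have e3 : eLpNorm (fun x => |pderiv u c₀ j x - pderiv v c₀ j x|) p.conjExponent
        (volume.restrict (Omega 2)) ≤ 1 + 1 := by
      refine (eLpNorm_norm (fun x => pderiv u c₀ j x - pderiv v c₀ j x)).le.trans ?_
      refine (eLpNorm_sub_le (measurable_pderiv u c₀ j).aestronglyMeasurable
        (measurable_pderiv v c₀ j).aestronglyMeasurable hq).trans ?_
      exact add_le_add ((eLpNorm_pderiv_le_gradNorm h𝒯 hu hq c₀ j).trans hu1)
        ((eLpNorm_pderiv_le_gradNorm hA hv' hq c₀ j).trans hv1)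
    have e4 : eLpNorm (fun x => 2 * edgeFun N flip j (fun x => u x c₀) c x) p.conjExponent
        (volume.restrict (Omega 2)) ≤ 2 := by
      refine (eLpNorm_const_smul (2 : ℝ) _ _ _).le.trans ?_
      calc _ ≤ ‖(2 : ℝ)‖ₑ * 1 := mul_le_mul_right e2 _
        _ = 2 := by rw [mul_one, Real.enorm_of_nonneg (by norm_num)]; simp
    refine (eLpNorm_add_le ((measurable_edgeFun N flip j _ c).const_mul 2).aestronglyMeasurable
      ((measurable_pderiv u c₀ j).sub (measurable_pderiv v c₀ j)).abs.aestronglyMeasurable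
      hq).trans ((add_le_add e4 e3).trans (le_of_eq ?_))
    norm_num
  refine h1.trans (h2.trans ((mul_le_mul' h3 h4).trans (le_of_eq ?_)))
  rw [mul_right_comm]
  congr 1
  rw [show (4 : ℝ≥0∞) = ENNReal.ofReal 4 by simp, ← ENNReal.ofReal_mul (by positivity)]
  congr 1
  ring

/-- Each of the four entries of the gradient contributes the constant `8`. -/
theorem ofReal_integral_sub_integral_le (hN : 0 < N) {Th : Set (Finset (Vec 2))}
    (h : IsPeriodicTriangulation N Th) {u v y : Vec 2 → Vec 2} (hu : IsP1 (elements Th) u)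
    (hup : IsPeriodic u) (hv : v ∈ displacements (atomMeshExt 2 N flip))
    (huv : ∀ z : Fin 2 → ℤ, u (latticePt N z) = v (latticePt N z))
    (hy : y ∈ deformations (atomMeshExt 2 N flip))
    {Λ : (Vec 2 →L[ℝ] Vec 2) → (Vec 2 →L[ℝ] Vec 2) →L[ℝ] ℝ} {M : ℝ} (hM : 0 ≤ M)
    (hΛ : ∀ G G' c j, |Λ G (matrixUnit c j) - Λ G' (matrixUnit c j)| ≤ M * tensorNorm 2 (G - G'))
    {S : Set (Vec 2)} (hS : S ⊆ OmegaBar 2)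
    (hdich : ∀ K ∈ atomMesh 2 N flip, K ⊆ S ∨ ∀ x ∈ K, u x = v x) {p : ℝ≥0∞} (hp : 1 ≤ p)
    (hu1 : gradNorm p.conjExponent u ≤ 1) (hv1 : gradNorm p.conjExponent v ≤ 1) :
    ENNReal.ofReal ((∫ x in S, Λ (fderiv ℝ y x) (fderiv ℝ u x)) -
        ∫ x in S, Λ (fderiv ℝ y x) (fderiv ℝ v x)) ≤
      ENNReal.ofReal (M * 32 * eps N) * oscSum N flip p S y := by
  have he := eps_pos hN
  obtain ⟨F, hF⟩ := hy.1.exists_hasJacobians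
  have hF' : HasJacobians (atomMesh 2 N flip) y F :=
    ⟨hF.continuous, fun T hT => hF.affine T (atomMesh_subset hT)⟩
  rw [integral_sub_integral_eq_sum hN (h.isConvexCover hN) (hy.1.mono atomMesh_subset) hF' hu
    (hv.1.mono atomMesh_subset) hS hdich Λ]
  have hcomp : ∀ c j, _ := fun c j => component_le hN h hu hup hv huv hy hF
    (σ := fun G => Λ G (matrixUnit c j)) hM (fun G G' => hΛ G G' c j) hdich hp hu1 hv1 c j
  have hswap : ∑ z ∈ cells 2 N, ∑ π, ∑ c, ∑ j, Λ (F (atomElement N flip z π)) (matrixUnit c j) *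
        ∫ x in atomElement N flip z π, (pderiv u c j x - pderiv v c j x) =
      ∑ c, ∑ j, ∑ z ∈ cells 2 N, ∑ π, Λ (F (atomElement N flip z π)) (matrixUnit c j) *
        ∫ x in atomElement N flip z π, (pderiv u c j x - pderiv v c j x) := by
    simp only [Fin.sum_univ_two, Finset.sum_add_distrib]
  rw [hswap]
  simp only [Fin.sum_univ_two (M := ℝ)]
  refine ENNReal.ofReal_add_le.trans ((add_le_add (ENNReal.ofReal_add_le.trans
    (add_le_add (hcomp 0 0) (hcomp 0 1))) (ENNReal.ofReal_add_le.trans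
    (add_le_add (hcomp 1 0) (hcomp 1 1)))).trans (le_of_eq ?_))
  rw [show M * 32 * eps N = (M * 8 * eps N + M * 8 * eps N) + (M * 8 * eps N + M * 8 * eps N) by
    ring, ENNReal.ofReal_add (by positivity) (by positivity),
    ENNReal.ofReal_add (by positivity) (by positivity), add_mul, add_mul]

end Coupling

/-! ### Assembly of the estimate. -/

theorem boundConst_nonneg {d : ℕ} {R : Finset (Fin d → ℤ)} {M : R → R → ℝ}
    (hM : ∀ r s, 0 ≤ M r s) : 0 ≤ boundConst M :=
  Finset.sum_nonneg fun r _ => Finset.sum_nonneg fun s _ => by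
    have := hM r s
    positivity

/-- The estimate for one coarse displacement `u`, given an atomistic interpolant `v` of `u` and a
bound for the continuum stress error. -/
theorem ofReal_firstVar_sub_le {d N : ℕ} {flip : Bool} (hN : 0 < N) {R : Finset (Fin d → ℤ)}
    {V : (R → Vec d) → ℝ} (hV : ContDiff ℝ 2 V) {Th Tc Ti Ta : Set (Finset (Vec d))}
    (h : IsPeriodicTriangulation N Th) (hTh : Th = Tc ∪ Ti ∪ Ta)
    {Ei : (interfaceBonds N R (region Ti) → Vec d) → ℝ} (hEi : ContDiff ℝ 2 Ei)
    {y : Vec d → Vec d} (hy : y ∈ deformations (atomMeshExt d N flip)) {p : ℝ≥0∞}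
    {u v : Vec d → Vec d} (hu : IsP1 (elements Th) u)
    (hv : v ∈ displacements (atomMeshExt d N flip))
    (huv : ∀ z : Fin d → ℤ, u (latticePt N z) = v (latticePt N z))
    (hv1 : gradNorm p.conjExponent v ≤ 1) {G : ℝ≥0∞}
    (hG : ENNReal.ofReal
      ((∫ x in region Tc, fderiv ℝ (cauchyBorn V) (fderiv ℝ y x) (fderiv ℝ u x)) -
        ∫ x in region Tc, fderiv ℝ (cauchyBorn V) (fderiv ℝ y x) (fderiv ℝ v x)) ≤ G) :
    ENNReal.ofReal (firstVar (energyAC N V (region Tc) (region Ti) (region Ta) Ei) y u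
        - firstVar (energyA N V) y u) ≤
      G + negNorm p (displacements (atomMeshExt d N flip)) (fun v =>
        firstVar (energyAC N V (region Tc) (region Ti) (region Ta) Ei) y v
          - firstVar (energyA N V) y v) := by
  have hA := isConvexCover_atomMesh (d := d) (flip := flip) hN
  have hsub : region Tc ⊆ OmegaBar d := by
    rw [← h.covers]
    exact sUnion_subset_sUnion (image_mono (by rw [hTh, union_assoc]; exact subset_union_left))
  rw [firstVar_sub_eq hV hEi hsub hA (hy.1.mono atomMesh_subset) hA (hv.1.mono atomMesh_subset)
    (h.isConvexCover hN) hu huv]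
  refine ENNReal.ofReal_add_le.trans (add_le_add hG ?_)
  refine ofReal_le_negNorm hN (Φ := fun v =>
    firstVar (energyAC N V (region Tc) (region Ti) (region Ta) Ei) y v
      - firstVar (energyA N V) y v) (fun t v => ?_) (fun w => ?_) hv hv1
  · simp only [firstVar_smul]
    ring
  · obtain ⟨h1, h2⟩ := firstVar_const_eq_zero (N := N) (V := V) (Ωc := region Tc)
      (Ωi := region Ti) (Ωa := region Ta) (Ei := Ei) y w
    simp only [h1, h2, sub_zero]

end ACCoupling

theorem mainTheorem2 :
    ∃ C : ℝ, 0 < C ∧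
      ∀ (d : ℕ), (d = 1 ∨ d = 2) →
      ∀ (N : ℕ), 0 < N →
      -- the choice of the diagonal in the atomistic mesh (irrelevant for `d = 1`)
      ∀ (flip : Bool),
      -- the interaction range and the interaction potential
      ∀ (R : Finset (Fin d → ℤ)), 0 ∉ R →
      ∀ (V : (R → Vec d) → ℝ), ContDiff ℝ 2 V →
      ∀ (M : R → R → ℝ), (∀ r s, 0 ≤ M r s) → (∀ g r s, ‖partial2 V r s g‖ ≤ M r s) →
      -- the coarse mesh and its continuum, interface and atomistic parts
      ∀ (Th Tc Ti Ta : Set (Finset (Vec d))),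
      IsPeriodicTriangulation N Th →
      Th = Tc ∪ Ti ∪ Ta → Disjoint Tc Ti → Disjoint Tc Ta → Disjoint Ti Ta →
      elements Ta ∪ elements Ti ⊆ atomMesh d N flip →
      -- the interface potential
      ∀ (Ei : (interfaceBonds N R (region Ti) → Vec d) → ℝ), ContDiff ℝ 2 Ei →
      ∀ y ∈ deformations (atomMeshExt d N flip),
      ∀ p : ENNReal, 1 ≤ p →
        negNorm p (displacements (extElements Th)) (fun v =>
            firstVar (energyAC N V (region Tc) (region Ti) (region Ta) Ei) y v
              - firstVar (energyA N V) y v)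
          ≤ ENNReal.ofReal (boundConst M * C * eps N) * oscSum N flip p (region Tc) y
            + negNorm p (displacements (atomMeshExt d N flip)) (fun v =>
                firstVar (energyAC N V (region Tc) (region Ti) (region Ta) Ei) y v
                  - firstVar (energyA N V) y v) := by
  -- Four gradient entries, two stress jumps per cell, and the norm `4` of the function paired with
  -- them.
  refine ⟨32, by norm_num, ?_⟩
  intro d hd N hN flip R _ V hV M hM0 hM Th Tc Ti Ta h hTh _ _ _ hsub Ei hEi y hy p hp
  have hq : 1 ≤ p.conjExponent := by simp [ENNReal.conjExponent]
  have hc : region Tc ⊆ OmegaBar d := by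
    rw [← h.covers]
    exact sUnion_subset_sUnion (image_mono (by rw [hTh, union_assoc]; exact subset_union_left))
  rw [negNorm]
  refine iSup₂_le fun u hu => iSup_le fun hu1 => ?_
  have hu' : IsP1 (elements Th) u := hu.1.mono (elements_subset_extElements Th)
  rcases hd with rfl | rfl
  · obtain ⟨v, hv, huv⟩ := exists_interpolant_one (flip := flip) hN hu.2
    have hdich : ∀ K ∈ atomMesh 1 N flip, K ⊆ region Tc ∨ ∀ x ∈ K, u x = v x := fun K hK =>
      h.subset_region_or_eq hN hTh hsub hu' (hv.1.mono atomMesh_subset) huv hK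
    refine ofReal_firstVar_sub_le hN hV h hTh hEi hy hu' hv huv
      ((gradNorm_interpolant_le_one hN (h.isConvexCover hN) hu' hv.1 huv hq).trans hu1.le) ?_
    -- In one dimension there is no coupling term at all, so the oscillation term is only an upper
    -- bound for zero.
    rw [integral_sub_integral_eq_zero_one hN (h.isConvexCover hN) (hy.1.mono atomMesh_subset) hu'
      (hv.1.mono atomMesh_subset) huv hc hdich, ENNReal.ofReal_zero]
    exact zero_le
  · obtain ⟨v, hv, huv⟩ := exists_interpolant_two (flip := flip) hN hu.2
    have hdich : ∀ K ∈ atomMesh 2 N flip, K ⊆ region Tc ∨ ∀ x ∈ K, u x = v x := fun K hK =>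
      h.subset_region_or_eq hN hTh hsub hu' (hv.1.mono atomMesh_subset) huv hK
    have hv1 := (gradNorm_interpolant_le_two hN h hu' hv.1 huv hq).trans hu1.le
    exact ofReal_firstVar_sub_le hN hV h hTh hEi hy hu' hv huv hv1
      (ofReal_integral_sub_integral_le hN h hu' hu.2 hv huv hy (boundConst_nonneg hM0)
        (fun G G' c j => abs_stress_sub_le hV hM0 hM G G' c j) hc hdich hp hu1.le hv1)
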